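/- Let $p$ be a prime, $K$ a finite extension of $\mathbb{Q}_p$ with ring of integers $\mathcal{O}$, maximal ideal $\mathfrak{p}$ and residue field $k$. Let $F(x)\in\mathcal{O}[x]$ be a monic cubic polynomial that is square-free over $K$, and let $E: y^2=F(x)$ be the corresponding elliptic curve over $K$. Put $A_K=K[T]/(F(T))$, and let $A_{\mathcal{O}}$ be the integral closure of $\mathcal{O}$ in $A_K$. Assume that $E$ satisfies condition (†), that is, at least one of the following holds: (i) $A_K$ is a field; (ii) $A_{\mathcal{O}}=\mathcal{O}[T]/(F(T))$; (iii) $\operatorname{char}(k)>2$ and the index $[E(K):E_0(K)]$ is odd, where $E_0(K)$ is the subgroup of the points of $E(K)$ whose reduction on a minimal Weierstrass equation is non-singular; (iv) $\operatorname{char}(k)=2$, $K/\mathbb{Q}_2$ is unramified, and $E$ has good reduction. Let $\bar K$ be an algebraic closure of $K$ and $G_K=\operatorname{Gal}(\bar K/K)$. Let $\delta_K$ be the Kummer map $$\delta_K: E(K)/2E(K)\to H^1(G_K,E(\bar K)[2])\cong\{[a]\in A_K^\times/(A_K^\times)^2 : N_{A_K/K}(a)\in (K^\times)^2\},$$ where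 the first map sends $P$ to the class of the cocycle $\sigma\mapsto\sigma Q-Q$ with $Q\in E(\bar K)$, $2Q=P$, and the isomorphism is the one induced by the map $E(\bar K)[2]\to\mu_2(A_K\otimes_K\bar K)$ that sends $S$ to the function $\theta\mapsto e_2(S,(\theta,0))$ on the set of roots $\theta$ of $F$ in $\bar K$ ($e_2$ is the Weil pairing). (Thus $\delta_K(P)$ is the class of $x(P)-T$ whenever $x(P)-T$ is invertible in $A_K$.) Let $(A_{\mathcal{O}}^\times/(A_{\mathcal{O}}^\times)^2)_\square$ be the group of the classes in $A_{\mathcal{O}}^\times/(A_{\mathcal{O}}^\times)^2$ whose norm is a square, regarded as a subgroup of $A_K^\times/(A_K^\times)^2$. Then every point $P\in E(K)$ has a unique well-defined class $\delta_K(P)\in A_K^\times/(A_K^\times)^2$, and the image $\delta_K(E)$ of the Kummer map satisfies $$\delta_K(E)\subset (A_{\mathcal{O}}^\times/(A_{\mathcal{O}}^\times)^2)_\square .$$ -/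

import Mathlib

open Polynomial WeierstrassCurve

/-! ### The ring of integers of a finite extension of `ℚ_p` -/

/-- The ring of integers `𝒪` of a finite extension `K` of `ℚ_p`: the integral closure of `ℤ_p`
in `K`. -/
noncomputable abbrev RingOfInt (p : ℕ) [Fact p.Prime] (K : Type*) [Field K] [Algebra ℤ_[p] K] :
    Subalgebra ℤ_[p] K :=
  integralClosure ℤ_[p] K

section RingOfInt

variable (p : ℕ) [Fact p.Prime] (K : Type*) [Field K] [Algebra ℚ_[p] K] [Algebra ℤ_[p] K]
  [IsScalarTower ℤ_[p] ℚ_[p] K] [FiniteDimensional ℚ_[p] K]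

instance RingOfInt.isFractionRing : IsFractionRing (RingOfInt p K) K :=
  integralClosure.isFractionRing_of_finite_extension ℚ_[p] K

instance RingOfInt.isDedekindDomain : IsDedekindDomain (RingOfInt p K) :=
  integralClosure.isDedekindDomain ℤ_[p] ℚ_[p] K

theorem RingOfInt.mem_iff_spectralNorm_le_one (x : K) :
    x ∈ RingOfInt p K ↔ spectralNorm ℚ_[p] K x ≤ 1 := by
  have hx : IsIntegral ℚ_[p] x := Algebra.IsIntegral.isIntegral x
  rw [spectralNorm, spectralValue_le_one_iff (minpoly.monic hx)]
  constructor
  · intro h n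
    have h' : IsIntegral ℤ_[p] x := h
    rw [minpoly.isIntegrallyClosed_eq_field_fractions' ℚ_[p] h', coeff_map]
    exact PadicInt.norm_le_one _
  · intro h
    have hl : minpoly ℚ_[p] x ∈ Polynomial.lifts (algebraMap ℤ_[p] ℚ_[p]) := by
      rw [Polynomial.lifts_iff_coeff_lifts]
      intro n
      exact ⟨⟨(minpoly ℚ_[p] x).coeff n, h n⟩, rfl⟩
    obtain ⟨q, hq, -, hqm⟩ := Polynomial.lifts_and_natDegree_eq_and_monic hl (minpoly.monic hx)
    refine ⟨q, hqm, ?_⟩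
    have := minpoly.aeval ℚ_[p] x
    rw [← hq, aeval_map_algebraMap] at this
    exact this

instance RingOfInt.isLocalRing : IsLocalRing (RingOfInt p K) := by
  have : ValuationRing (RingOfInt p K) := by
    rw [ValuationRing.iff_isInteger_or_isInteger (RingOfInt p K) K]
    intro x
    by_cases hx : spectralNorm ℚ_[p] K x ≤ 1
    · exact Or.inl ⟨⟨x, (mem_iff_spectralNorm_le_one p K x).2 hx⟩, rfl⟩
    · right
      have hx0 : x ≠ 0 := by
        rintro rfl
        exact hx (by simp [spectralNorm_zero])
      have hmul : spectralNorm ℚ_[p] K x * spectralNorm ℚ_[p] K x⁻¹ = 1 := by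
        have := spectralAlgNorm_mul (K := ℚ_[p]) (L := K) x x⁻¹
        rw [mul_inv_cancel₀ hx0, spectralAlgNorm_one] at this
        exact this.symm
      refine ⟨⟨x⁻¹, (mem_iff_spectralNorm_le_one p K x⁻¹).2 ?_⟩, rfl⟩
      have h0 := spectralNorm_nonneg (K := ℚ_[p]) (L := K) x⁻¹
      push Not at hx
      nlinarith
  infer_instance

theorem RingOfInt.not_isField : ¬ IsField (RingOfInt p K) := by
  intro h
  have hinj : Function.Injective (algebraMap ℤ_[p] (RingOfInt p K)) := by
    intro a b hab
    have h1 : algebraMap ℤ_[p] K a = algebraMap ℤ_[p] K b := congrArg Subtype.val hab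
    rw [IsScalarTower.algebraMap_apply ℤ_[p] ℚ_[p] K,
      IsScalarTower.algebraMap_apply ℤ_[p] ℚ_[p] K] at h1
    exact IsFractionRing.injective ℤ_[p] ℚ_[p] ((algebraMap ℚ_[p] K).injective h1)
  exact IsDiscreteValuationRing.not_isField ℤ_[p]
    (isField_of_isIntegral_of_isField hinj h)

instance RingOfInt.isDiscreteValuationRing : IsDiscreteValuationRing (RingOfInt p K) :=
  have h : IsDiscreteValuationRing (RingOfInt p K) ↔ IsDedekindDomain (RingOfInt p K) :=
    (IsDiscreteValuationRing.TFAE (RingOfInt p K) (RingOfInt.not_isField p K)).out 0 2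
  h.2 inferInstance

end RingOfInt

/-! ### Square classes -/

/-- The group `M / M²` of square classes of a commutative group `M`. -/
abbrev SqClass (M : Type*) [CommGroup M] : Type _ :=
  M ⧸ (powMonoidHom 2 : M →* M).range

/-- The homomorphism `M / M² → N / N²` induced by a homomorphism `M → N`. -/
def SqClass.map {M N : Type*} [CommGroup M] [CommGroup N] (f : M →* N) :
    SqClass M →* SqClass N :=
  QuotientGroup.map _ _ f (by
    rintro _ ⟨m, rfl⟩
    exact ⟨f m, by simp⟩)

/-! ### The elliptic curve `y² = F(x)` and its Kummer map -/

section Kummer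

variable {K : Type*} [Field K]

/-- The Weierstrass curve `y² = x³ + a x² + b x + c`, for `F = X³ + a X² + b X + c`. -/
def cubicCurve (F : K[X]) : WeierstrassCurve K where
  a₁ := 0
  a₂ := F.coeff 2
  a₃ := 0
  a₄ := F.coeff 1
  a₆ := F.coeff 0

/-- The Weil pairing `e₂(S, (θ, 0)) ∈ {1, -1}` of a `2`-torsion point `S` of `y² = F(x)` with the
`2`-torsion point `(θ, 0)`, where `F(θ) = 0`: it is `1` if `S` is `0` or `(θ, 0)`,
and `-1` if `S` is one of the other two points of order `2`. -/
noncomputable def weilPairingTwo {L : Type*} [Field L] {W : WeierstrassCurve.Affine L} (S : W.Point)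
    (θ : L) : L := by
  classical
  exact match S with
  | .zero => 1
  | .some x _ _ => if x = θ then 1 else -1

open scoped Classical in
/-- The class `c ∈ A_K^× / (A_K^×)²`, where `A_K = K[T]/(F(T))`, is the Kummer class `δ_K(P)` of
the point `P ∈ E(K)` of the elliptic curve `E : y² = F(x)`.

The connecting map of `0 → E[2] → E(K̄) → E(K̄) → 0` sends `P` to the class in `H¹(G_K, E[2])` of
the cocycle `σ ↦ σ Q - Q`, where `2 Q = P`. The group `H¹(G_K, E[2])` is identified with the
subgroup of elements of square norm in `A_K^× / (A_K^×)²` by the map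
`w : E[2] → μ₂(A_K ⊗ K̄)` given by the Weil pairing. Here `A_K ⊗ K̄` is the ring of functions on the
set of `K`-algebra maps `φ : A_K → K̄`, that is, of roots `φ(T)` of `F` in `K̄`, and `w(S)` is the
function `φ ↦ e₂(S, (φ(T), 0))`. The class of `a ∈ A_K^×` corresponds to the class of a cocycle
`ξ` if there is a square root `β` of `a` in `A_K ⊗ K̄` with `σ(β) = w(ξ(σ)) β` for all `σ ∈ G_K`,
that is, `σ(β_φ) = e₂(ξ(σ), ((σ ∘ φ)(T), 0)) β_{σ ∘ φ}` for all `σ` and all `φ`. -/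
def IsKummerClass (F : K[X]) (P : ((cubicCurve F)⁄K).toAffine.Point) (c : SqClass (AdjoinRoot F)ˣ) : Prop :=
  ∃ a : (AdjoinRoot F)ˣ, (QuotientGroup.mk a : SqClass (AdjoinRoot F)ˣ) = c ∧
  ∃ Q : ((cubicCurve F)⁄(AlgebraicClosure K)).toAffine.Point,
    2 • Q = Affine.Point.baseChange K (AlgebraicClosure K) P ∧
  ∃ β : (AdjoinRoot F →ₐ[K] AlgebraicClosure K) → AlgebraicClosure K,
    (∀ φ, β φ ^ 2 = φ a) ∧
    ∀ (σ : AlgebraicClosure K ≃ₐ[K] AlgebraicClosure K)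
      (φ : AdjoinRoot F →ₐ[K] AlgebraicClosure K),
      σ (β φ) =
        weilPairingTwo (Affine.Point.map (σ : AlgebraicClosure K →ₐ[K] AlgebraicClosure K) Q - Q)
          (σ (φ (AdjoinRoot.root F))) *
        β ((σ : AlgebraicClosure K →ₐ[K] AlgebraicClosure K).comp φ)

/-- The image `δ_K(E)` of the Kummer map of `E : y² = F(x)`, inside `A_K^× / (A_K^×)²`. -/
def kummerImage (F : K[X]) : Set (SqClass (AdjoinRoot F)ˣ) :=
  {c | ∃ P : ((cubicCurve F)⁄K).toAffine.Point, IsKummerClass F P c}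

end Kummer

/-! ### Integral structures -/

section Integral

variable (p : ℕ) [Fact p.Prime] {K : Type*} [Field K] [Algebra ℤ_[p] K]

/-- The ring of integers `A_𝒪` of `A_K = K[T]/(F(T))`: the integral closure of `𝒪` in `A_K`. -/
noncomputable abbrev algInt (F : K[X]) : Subalgebra (RingOfInt p K) (AdjoinRoot F) :=
  integralClosure (RingOfInt p K) (AdjoinRoot F)

/-- The inclusion `A_𝒪^× → A_K^×`. -/
noncomputable def unitsIncl (F : K[X]) : (algInt p F)ˣ →* (AdjoinRoot F)ˣ :=
  Units.map ((algInt p F).val : algInt p F →* AdjoinRoot F)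

/-- `(A_𝒪^× / (A_𝒪^×)²)_□`: the classes in `A_𝒪^× / (A_𝒪^×)²` whose norm is a square. -/
noncomputable def unitSquareNormClasses (F : K[X]) : Subgroup (SqClass (algInt p F)ˣ) :=
  (SqClass.map ((Units.map (Algebra.norm K : AdjoinRoot F →* K)).comp (unitsIncl p F))).ker

/-- `(A_𝒪^× / (A_𝒪^×)²)_□`, as a subgroup of `A_K^× / (A_K^×)²` by the natural inclusion. -/
noncomputable def unitSquareNormClassesIn (F : K[X]) : Subgroup (SqClass (AdjoinRoot F)ˣ) :=
  (unitSquareNormClasses p F).map (SqClass.map (unitsIncl p F))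

variable [Algebra ℚ_[p] K] [IsScalarTower ℤ_[p] ℚ_[p] K] [FiniteDimensional ℚ_[p] K]

/-- The point `P` of a minimal Weierstrass equation over `K` has nonsingular reduction:
it reduces to the point at infinity (that is, `P = 0` or a coordinate of `P` is not in `𝒪`), or
to a nonsingular affine point of the reduced curve. -/
def HasNonsingularReduction (W : WeierstrassCurve K) [IsMinimal (RingOfInt p K) W] :
    W.toAffine.Point → Prop
  | .zero => True
  | .some x y _ => ∀ x' y' : RingOfInt p K, (x' : K) = x → (y' : K) = y →
      (W.reduction (RingOfInt p K)).toAffine.Nonsingular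
        (IsLocalRing.residue (RingOfInt p K) x') (IsLocalRing.residue (RingOfInt p K) y')

open scoped Classical in
/-- The subgroup `E_0(K)` of the points of nonsingular reduction, for a minimal Weierstrass
equation. (The set of these points is closed under addition and negation, so that taking the
subgroup it generates adds no point.) -/
noncomputable def nonsingularPart (W : WeierstrassCurve K) [IsMinimal (RingOfInt p K) W] :
    AddSubgroup W.toAffine.Point :=
  AddSubgroup.closure {P | HasNonsingularReduction p W P}

open scoped Classical in
/-- The condition (†) on `E : y² = F(x)`. The residue field of `𝒪` has characteristic `p`. -/
structure SatisfiesDagger (F : K[X]) : Prop where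
  coeff_mem : ∀ i, F.coeff i ∈ RingOfInt p K
  monic : F.Monic
  natDegree_eq : F.natDegree = 3
  squarefree : Squarefree F
  cases :
    -- `A_K` is a field
    IsField (AdjoinRoot F) ∨
    -- `A_𝒪 = 𝒪[T]/(F(T))`
    algInt p F = Algebra.adjoin (RingOfInt p K) {AdjoinRoot.root F} ∨
    -- the residue characteristic is odd and `[E(K) : E_0(K)]` is odd
    (2 < p ∧ Odd (nonsingularPart p ((cubicCurve F).minimal (RingOfInt p K))).index) ∨
    -- `p = 2`, the extension `K / ℚ_2` is unramified, and `E` has good reduction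
    (p = 2 ∧ IsLocalRing.maximalIdeal (RingOfInt p K) = Ideal.span {(p : RingOfInt p K)} ∧
      ((cubicCurve F).minimal (RingOfInt p K)).HasGoodReduction (RingOfInt p K))

end Integral

/-! Over `K̄` the algebra `A_K ⊗ K̄` is the ring of functions on the three roots `e i` of `F`, and
by descent an element of `A_K` is a Galois-equivariant family indexed by the roots
(`exists_of_equivariant`). If `r i` are square roots of `x - e i` with product `y`, explicit
polynomials in the `r i` give a half `Q` of `P = (x, y)`. Sign changes of product `1` on the `r i`
translate `Q` by a `2`-torsion point, and the signs are its Weil pairings. Hence `δ_K(P)` is the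
class of the family `x - e i`, with `F'(x)` in place of a zero entry (`isKummerClass_some`);
uniqueness is descent again.

Let `v` be the Galois-invariant extension of the absolute value to `K̄`. If `v (a i) = v (γ i) ^ 2`
for an equivariant family `γ`, then `γ` descends to some `g` in `A_K^×` and `a / g²` is a unit of
`A_𝒪` (`mk_mem_unitSquareNormClassesIn`). So it suffices to find `γ` for the family `x - e i`. This
is `HasSquareValuation`, which is compatible with changes of Weierstrass equation.

If all `v (x - e i)` agree, `γ i = y / (x - e i)` works. This covers case (i), where Galois is
transitive on the roots. If the derivative of the cubic is a unit at an integral `x`, at most one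
difference is a nonunit and `γ = y` works there. In case (ii), when `x` is integral and `y` is a
nonunit, a nonunit derivative would produce an integral element outside `𝒪[T]/(F)`. In case (iii)
nonsingular reduction gives the same dichotomy for points of `E_0(K)`; the remaining points follow
because classes are killed by `2` and the index is odd.

In case (iv) the reduction is supersingular or ordinary, according as `a₁` is a nonunit or a unit.
In the supersingular case the roots have a common valuation which no element of `K` has, so all
differences agree. In the ordinary case one root has the valuation of `1/4`, the other two are
divisible by `2`, and `hasSquareValuation_ordinary` finds `γ` according to the position of `x`. The
delicate subcase needs an element of a quadratic extension whose square has the valuation of `2`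
(`Valuation.sq_eq_two_of_ordinary`). -/

/-! ### The cubic algebra `K[T]/(F(T))` and its embeddings -/

section CubicAlgebra

variable {K : Type*} [Field K]

/-- The family `e` lists the roots of the monic cubic `F`, which are distinct. -/
structure IsRootTriple (F : K[X]) (e : Fin 3 → AlgebraicClosure K) : Prop where
  injective : Function.Injective e
  map_eq : F.map (algebraMap K (AlgebraicClosure K)) = ∏ i, (X - C (e i))

theorem exists_isRootTriple [CharZero K] {F : K[X]} (hm : F.Monic) (hd : F.natDegree = 3)
    (hs : Squarefree F) : ∃ e, IsRootTriple F e := by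
  set G := F.map (algebraMap K (AlgebraicClosure K)) with hG
  have hsplit : G.Splits := IsAlgClosed.splits G
  have hGm : G.Monic := hm.map _
  have hcard : Multiset.card G.roots = 3 := by
    rw [← hsplit.natDegree_eq_card_roots, hG, natDegree_map, hd]
  have hsep : F.Separable := (PerfectField.separable_iff_squarefree).2 hs
  have hnodup : G.roots.Nodup := nodup_roots hsep.map
  obtain ⟨a, b, c, habc⟩ := Multiset.card_eq_three.1 hcard
  have hprod := hsplit.eq_prod_roots_of_monic hGm
  rw [habc] at hnodup hprod
  refine ⟨![a, b, c], ?_, ?_⟩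
  · have h := hnodup
    simp only [Multiset.insert_eq_cons, Multiset.nodup_cons, Multiset.mem_cons,
      Multiset.mem_singleton, not_or, Multiset.nodup_singleton, and_true] at h
    obtain ⟨⟨hab, hac⟩, hbc⟩ := h
    intro i j hij
    fin_cases i <;> fin_cases j <;> simp_all
  · rw [← hG, hprod]
    simp [Fin.prod_univ_three, mul_assoc]

namespace IsRootTriple

variable {F : K[X]} {e : Fin 3 → AlgebraicClosure K} (he : IsRootTriple F e)
include he

theorem monic : F.Monic :=
  monic_of_injective (algebraMap K (AlgebraicClosure K)).injective
    (he.map_eq ▸ monic_prod_of_monic _ _ fun i _ => monic_X_sub_C (e i))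

theorem natDegree_eq : F.natDegree = 3 := by
  rw [← natDegree_map (algebraMap K (AlgebraicClosure K)), he.map_eq,
    natDegree_prod_of_monic _ _ fun i _ => monic_X_sub_C (e i)]
  simp

theorem aeval_eq (x : AlgebraicClosure K) : aeval x F = ∏ i, (x - e i) := by
  rw [aeval_def, ← eval_map, he.map_eq, eval_prod]
  simp

theorem aeval_root (i : Fin 3) : aeval (e i) F = 0 := by
  rw [he.aeval_eq]
  exact Finset.prod_eq_zero (Finset.mem_univ i) (sub_self _)

theorem exists_eq_of_aeval_eq_zero {x : AlgebraicClosure K} (hx : aeval x F = 0) :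
    ∃ i, e i = x := by
  rw [he.aeval_eq, Finset.prod_eq_zero_iff] at hx
  obtain ⟨i, -, hi⟩ := hx
  exact ⟨i, (sub_eq_zero.1 hi).symm⟩

/-- The embedding of `K[T]/(F(T))` sending `T` to the root `e i`. -/
noncomputable def hom (i : Fin 3) : AdjoinRoot F →ₐ[K] AlgebraicClosure K :=
  AdjoinRoot.liftAlgHom F (Algebra.ofId _ _) (e i) (he.aeval_root i)

theorem hom_root (i : Fin 3) : he.hom i (AdjoinRoot.root F) = e i :=
  AdjoinRoot.liftAlgHom_root ..

theorem hom_mk (i : Fin 3) (g : K[X]) : he.hom i (AdjoinRoot.mk F g) = aeval (e i) g := by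
  rw [← AdjoinRoot.aeval_eq, ← aeval_algHom_apply, he.hom_root]

omit he in
theorem aeval_hom_root (φ : AdjoinRoot F →ₐ[K] AlgebraicClosure K) :
    aeval (φ (AdjoinRoot.root F)) F = 0 := by
  rw [aeval_algHom_apply, AdjoinRoot.aeval_eq, AdjoinRoot.mk_self, map_zero]

theorem exists_hom_eq (φ : AdjoinRoot F →ₐ[K] AlgebraicClosure K) : ∃ i, he.hom i = φ := by
  obtain ⟨i, hi⟩ := he.exists_eq_of_aeval_eq_zero (aeval_hom_root φ)
  exact ⟨i, AdjoinRoot.algHom_ext (by rw [he.hom_root, hi])⟩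

theorem eq_zero_of_hom {a : AdjoinRoot F} (ha : ∀ i, he.hom i a = 0) : a = 0 := by
  obtain ⟨g, rfl⟩ := AdjoinRoot.mk_surjective a
  rw [AdjoinRoot.mk_eq_zero, ← map_dvd_map _ (algebraMap K (AlgebraicClosure K)).injective
    he.monic, he.map_eq]
  refine Finset.prod_dvd_of_coprime (fun i _ j _ hij => ?_) fun i _ => ?_
  · exact pairwise_coprime_X_sub_C he.injective hij
  · rw [dvd_iff_isRoot, IsRoot.def, eval_map_algebraMap, ← he.hom_mk i g, ha]

theorem ext_hom {a b : AdjoinRoot F} (h : ∀ i, he.hom i a = he.hom i b) : a = b :=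
  sub_eq_zero.1 (he.eq_zero_of_hom fun i => by rw [map_sub, h, sub_self])

/-- The permutation of the roots induced by an automorphism. -/
theorem exists_perm (σ : AlgebraicClosure K ≃ₐ[K] AlgebraicClosure K) :
    ∃ π : Equiv.Perm (Fin 3), ∀ i, σ (e i) = e (π i) := by
  have h : ∀ i, ∃ j, e j = σ (e i) := fun i => he.exists_eq_of_aeval_eq_zero (by
    have h := aeval_algHom_apply (σ : AlgebraicClosure K →ₐ[K] AlgebraicClosure K) (e i) F
    rw [he.aeval_root, map_zero] at h
    exact h)
  choose f hf using h
  have hinj : Function.Injective f := fun i j hij =>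
    he.injective (σ.injective (by rw [← hf, ← hf, hij]))
  exact ⟨Equiv.ofBijective f (Finite.injective_iff_bijective.1 hinj), fun i => (hf i).symm⟩

theorem comp_hom {σ : AlgebraicClosure K ≃ₐ[K] AlgebraicClosure K} {π : Equiv.Perm (Fin 3)}
    (hπ : ∀ i, σ (e i) = e (π i)) (i : Fin 3) :
    (σ : AlgebraicClosure K →ₐ[K] AlgebraicClosure K).comp (he.hom i) = he.hom (π i) :=
  AdjoinRoot.algHom_ext (by
    rw [he.hom_root, ← hπ, AlgHom.comp_apply, he.hom_root]
    rfl)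

/-- Galois descent for the étale algebra `K[T]/(F(T))`. -/
theorem exists_of_equivariant [CharZero K] (γ : Fin 3 → AlgebraicClosure K)
    (hγ : ∀ (σ : AlgebraicClosure K ≃ₐ[K] AlgebraicClosure K) (i j : Fin 3),
      σ (e i) = e j → σ (γ i) = γ j) :
    ∃ g : AdjoinRoot F, ∀ i, he.hom i g = γ i := by
  have hinj : Set.InjOn e (Finset.univ : Finset (Fin 3)) := he.injective.injOn
  set q := Lagrange.interpolate Finset.univ e γ with hq
  have hqd : q.degree < (Finset.univ : Finset (Fin 3)).card :=
    Lagrange.degree_interpolate_lt _ hinj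
  -- An automorphism permutes the nodes and the prescribed values compatibly, so uniqueness of
  -- interpolation makes `q` invariant and its coefficients lie in `K`.
  have hfix : ∀ σ : AlgebraicClosure K ≃ₐ[K] AlgebraicClosure K,
      q.map (σ : AlgebraicClosure K →+* AlgebraicClosure K) = q := by
    intro σ
    obtain ⟨π, hπ⟩ := he.exists_perm σ
    refine Lagrange.eq_interpolate_of_eval_eq γ hinj ?_ fun i _ => ?_
    · exact (degree_map_le).trans_lt hqd
    · obtain ⟨j, rfl⟩ := π.surjective i
      have h := Lagrange.eval_interpolate_at_node γ hinj (Finset.mem_univ j)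
      have h2 : eval ((σ : AlgebraicClosure K →+* AlgebraicClosure K) (e j))
          (q.map (σ : AlgebraicClosure K →+* AlgebraicClosure K)) = σ (q.eval (e j)) :=
        eval_map_apply _ _
      rw [← hπ j, ← hγ σ j (π j) (hπ j), ← h]
      exact h2
  have hl : q ∈ lifts (algebraMap K (AlgebraicClosure K)) := by
    rw [lifts_iff_coeff_lifts]
    intro n
    rw [InfiniteGalois.mem_range_algebraMap_iff_fixed]
    intro σ
    have := congrArg (fun r => coeff r n) (hfix σ)
    simpa using this
  obtain ⟨g, hg⟩ := hl
  refine ⟨AdjoinRoot.mk F g, fun i => ?_⟩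
  rw [he.hom_mk, ← eval_map_algebraMap]
  have h := Lagrange.eval_interpolate_at_node γ hinj (Finset.mem_univ i)
  rw [← hq, ← hg] at h
  exact h

theorem isUnit_of_hom [CharZero K] {a : AdjoinRoot F} (ha : ∀ i, he.hom i a ≠ 0) : IsUnit a := by
  obtain ⟨b, hb⟩ := he.exists_of_equivariant (fun i => (he.hom i a)⁻¹) (by
    intro σ i j hij
    obtain ⟨π, hπ⟩ := he.exists_perm σ
    have : π i = j := he.injective (by rw [← hπ, hij])
    subst this
    rw [map_inv₀, ← he.comp_hom hπ]
    rfl)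
  refine IsUnit.of_mul_eq_one b (he.ext_hom fun i => ?_)
  rw [map_mul, hb, map_one, mul_inv_cancel₀ (ha i)]

theorem exists_unit_of_equivariant [CharZero K] (γ : Fin 3 → AlgebraicClosure K)
    (hγ0 : ∀ i, γ i ≠ 0)
    (hγ : ∀ (σ : AlgebraicClosure K ≃ₐ[K] AlgebraicClosure K) (i j : Fin 3),
      σ (e i) = e j → σ (γ i) = γ j) :
    ∃ g : (AdjoinRoot F)ˣ, ∀ i, he.hom i g = γ i := by
  obtain ⟨g, hg⟩ := he.exists_of_equivariant γ hγ
  have hu : IsUnit g := he.isUnit_of_hom fun i => by rw [hg]; exact hγ0 i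
  exact ⟨hu.unit, hg⟩

/-- The Vandermonde matrix of the roots, which is invertible, diagonalises multiplication by `a` in
the power basis, with the values of `a` at the roots as eigenvalues. -/
theorem norm_eq (a : AdjoinRoot F) :
    algebraMap K (AlgebraicClosure K) (Algebra.norm K a) = ∏ i, he.hom i a := by
  have hF0 := he.monic.ne_zero
  let b := (AdjoinRoot.powerBasis hF0).basis.reindex
    (finCongr (show (AdjoinRoot.powerBasis hF0).dim = 3 by
      rw [AdjoinRoot.powerBasis_dim, he.natDegree_eq]))
  have hb : ∀ j, b j = AdjoinRoot.root F ^ (j : ℕ) := by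
    intro j
    simp [b]
  let V := Matrix.vandermonde e
  let M := (Algebra.leftMulMatrix b a).map (algebraMap K (AlgebraicClosure K))
  have hV : V * M = Matrix.diagonal (fun i => he.hom i a) * V := by
    ext i j
    have h1 : a * b j = ∑ k, Algebra.leftMulMatrix b a k j • b k := by
      rw [← b.sum_repr (a * b j)]
      refine Finset.sum_congr rfl fun k _ => ?_
      rw [Algebra.leftMulMatrix_eq_repr_mul]
    have h2 := congrArg (he.hom i) h1
    simp only [map_mul, map_sum, map_smul, hb, map_pow, he.hom_root] at h2
    rw [Matrix.diagonal_mul, Matrix.mul_apply]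
    simp only [V, M, Matrix.vandermonde_apply, Matrix.map_apply]
    rw [h2]
    refine Finset.sum_congr rfl fun k _ => ?_
    rw [Algebra.smul_def, mul_comm]
  have hdet : V.det ≠ 0 := Matrix.det_vandermonde_ne_zero_iff.2 he.injective
  have h3 := congrArg Matrix.det hV
  rw [Matrix.det_mul, Matrix.det_mul, Matrix.det_diagonal, mul_comm] at h3
  have h4 := mul_right_cancel₀ hdet h3
  rw [← h4, Algebra.norm_eq_matrix_det b a]
  exact RingHom.map_det _ _

end IsRootTriple

end CubicAlgebra

/-! ### Curves `y² = (x - a)(x - b)(x - c)` -/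

section TwoTorsion

variable {L : Type*} [Field L] {W : WeierstrassCurve.Affine L} {a b c : L}

/-- The affine Weierstrass curve `W` is `y² = (x - a)(x - b)(x - c)`. -/
structure IsTwoTorsionForm (W : WeierstrassCurve.Affine L) (a b c : L) : Prop where
  a₁ : W.a₁ = 0
  a₂ : W.a₂ = -(a + b + c)
  a₃ : W.a₃ = 0
  a₄ : W.a₄ = a * b + a * c + b * c
  a₆ : W.a₆ = -(a * b * c)

namespace IsTwoTorsionForm

theorem swap (h : IsTwoTorsionForm W a b c) : IsTwoTorsionForm W b a c where
  a₁ := h.a₁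
  a₂ := by rw [h.a₂]; ring
  a₃ := h.a₃
  a₄ := by rw [h.a₄]; ring
  a₆ := by rw [h.a₆]; ring

theorem rotate (h : IsTwoTorsionForm W a b c) : IsTwoTorsionForm W b c a where
  a₁ := h.a₁
  a₂ := by rw [h.a₂]; ring
  a₃ := h.a₃
  a₄ := by rw [h.a₄]; ring
  a₆ := by rw [h.a₆]; ring

variable (h : IsTwoTorsionForm W a b c)
include h

theorem equation_iff (x y : L) : W.Equation x y ↔ y ^ 2 = (x - a) * (x - b) * (x - c) := by
  rw [Affine.equation_iff, h.a₁, h.a₂, h.a₃, h.a₄, h.a₆]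
  constructor <;> intro h <;> linear_combination h

theorem negY_eq (x y : L) : W.negY x y = -y := by
  rw [Affine.negY, h.a₁, h.a₃]
  ring

theorem nonsingular [NeZero (2 : L)] (hab : a ≠ b) (hac : a ≠ c) (hbc : b ≠ c) {x y : L}
    (hxy : y ^ 2 = (x - a) * (x - b) * (x - c)) : W.Nonsingular x y := by
  refine (Affine.equation_iff_nonsingular_of_Δ_ne_zero ?_).1 ((h.equation_iff x y).2 hxy)
  have hΔ : W.Δ = 2 ^ 4 * ((a - b) * (a - c) * (b - c)) ^ 2 := by
    simp only [WeierstrassCurve.Δ, WeierstrassCurve.b₂, WeierstrassCurve.b₄, WeierstrassCurve.b₆,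
      WeierstrassCurve.b₈]
    rw [h.a₁, h.a₂, h.a₃, h.a₄, h.a₆]
    ring
  rw [hΔ]
  exact mul_ne_zero (pow_ne_zero _ two_ne_zero) (pow_ne_zero _ (mul_ne_zero (mul_ne_zero
    (sub_ne_zero.2 hab) (sub_ne_zero.2 hac)) (sub_ne_zero.2 hbc)))

variable [DecidableEq L]

theorem add_of_X_ne {x₁ y₁ x₂ y₂ x₃ y₃ : L} (h₁ : W.Nonsingular x₁ y₁) (h₂ : W.Nonsingular x₂ y₂)
    (h₃ : W.Nonsingular x₃ y₃) (hx : x₁ ≠ x₂) (m : L) (hm : m * (x₁ - x₂) = y₁ - y₂)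
    (hx₃ : x₃ = m ^ 2 + (a + b + c) - x₁ - x₂) (hy₃ : y₃ = -(m * (x₃ - x₁) + y₁)) :
    Affine.Point.some _ _ h₁ + Affine.Point.some _ _ h₂ = Affine.Point.some _ _ h₃ := by
  have hs : W.slope x₁ x₂ y₁ y₂ = m := by
    rw [Affine.slope_of_X_ne hx, div_eq_iff (sub_ne_zero.2 hx), hm]
  have hX : W.addX x₁ x₂ (W.slope x₁ x₂ y₁ y₂) = x₃ := by
    rw [hs, Affine.addX, h.a₁, h.a₂, hx₃]
    ring
  have hY : W.addY x₁ x₂ y₁ (W.slope x₁ x₂ y₁ y₂) = y₃ := by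
    rw [Affine.addY, Affine.negAddY, hX, h.negY_eq, hs, hy₃]
  rw [Affine.Point.add_of_X_ne hx, Affine.Point.some.injEq]
  exact ⟨hX, hY⟩

theorem add_self [NeZero (2 : L)] {x₁ y₁ x₃ y₃ : L} (h₁ : W.Nonsingular x₁ y₁)
    (h₃ : W.Nonsingular x₃ y₃) (hy : y₁ ≠ 0) (m : L)
    (hm : m * (2 * y₁) = (x₁ - a) * (x₁ - b) + (x₁ - a) * (x₁ - c) + (x₁ - b) * (x₁ - c))
    (hx₃ : x₃ = m ^ 2 + (a + b + c) - x₁ - x₁) (hy₃ : y₃ = -(m * (x₃ - x₁) + y₁)) :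
    Affine.Point.some _ _ h₁ + Affine.Point.some _ _ h₁ = Affine.Point.some _ _ h₃ := by
  have hy' : y₁ ≠ W.negY x₁ y₁ := by
    rw [h.negY_eq]
    intro h0
    exact mul_ne_zero two_ne_zero hy (by linear_combination h0)
  have hs : W.slope x₁ x₁ y₁ y₁ = m := by
    rw [Affine.slope_of_Y_ne rfl hy', div_eq_iff (sub_ne_zero.2 hy'), h.negY_eq, h.a₁, h.a₂, h.a₄]
    linear_combination -hm
  have hX : W.addX x₁ x₁ (W.slope x₁ x₁ y₁ y₁) = x₃ := by
    rw [hs, Affine.addX, h.a₁, h.a₂, hx₃]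
    ring
  have hY : W.addY x₁ x₁ y₁ (W.slope x₁ x₁ y₁ y₁) = y₃ := by
    rw [Affine.addY, Affine.negAddY, hX, h.negY_eq, hs, hy₃]
  rw [Affine.Point.add_self_of_Y_ne hy', Affine.Point.some.injEq]
  exact ⟨hX, hY⟩

/-- The point `(x + rs + rt + st, (r + s)(r + t)(s + t))` halves `(x, rst)` when `r`, `s`, `t`
are square roots of `x - a`, `x - b`, `x - c`. -/
theorem two_nsmul_half [NeZero (2 : L)] (hab : a ≠ b) (hac : a ≠ c) (hbc : b ≠ c)
    {x r s t u v : L}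
    (hr : r ^ 2 = x - a) (hs : s ^ 2 = x - b) (ht : t ^ 2 = x - c)
    (hu : u = x + r * s + r * t + s * t) (hv : v = (r + s) * (r + t) * (s + t))
    (h₁ : W.Nonsingular u v) (h₃ : W.Nonsingular x (r * s * t)) :
    2 • Affine.Point.some _ _ h₁ = Affine.Point.some _ _ h₃ := by
  -- If `r + s` vanished, then `r² = s²` and `a = b`. Eliminating `a`, `b`, `c` afterwards turns all
  -- conditions into polynomial identities in `x`, `r`, `s`, `t`.
  have hrs : r + s ≠ 0 := fun h0 => hab (by linear_combination (s - r) * h0 + hr - hs)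
  have hrt : r + t ≠ 0 := fun h0 => hac (by linear_combination (t - r) * h0 + hr - ht)
  have hst : s + t ≠ 0 := fun h0 => hbc (by linear_combination (t - s) * h0 + hs - ht)
  obtain rfl : a = x - r ^ 2 := by rw [hr]; ring
  obtain rfl : b = x - s ^ 2 := by rw [hs]; ring
  obtain rfl : c = x - t ^ 2 := by rw [ht]; ring
  rw [two_nsmul]
  refine h.add_self h₁ h₃ ?_ (r + s + t) ?_ ?_ ?_
  · rw [hv]
    exact mul_ne_zero (mul_ne_zero hrs hrt) hst
  · rw [hu, hv]; ring
  · rw [hu]; ring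
  · rw [hu, hv]; ring

/-- Changing the signs of two of the square roots adds a `2`-torsion point to the half. -/
theorem half_add_torsion (hab : a ≠ b) (hac : a ≠ c) (hbc : b ≠ c) {x r s t u v u' v' : L}
    (hr : r ^ 2 = x - a) (hs : s ^ 2 = x - b) (ht : t ^ 2 = x - c)
    (hu : u = x + r * s + r * t + s * t) (hv : v = (r + s) * (r + t) * (s + t))
    (hu' : u' = x - r * s - r * t + s * t) (hv' : v' = -((r - s) * (r - t) * (s + t)))
    (h₁ : W.Nonsingular u v) (h₂ : W.Nonsingular a 0) (h₃ : W.Nonsingular u' v') :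
    Affine.Point.some _ _ h₁ + Affine.Point.some _ _ h₂ = Affine.Point.some _ _ h₃ := by
  have hrs : r + s ≠ 0 := fun h0 => hab (by linear_combination (s - r) * h0 + hr - hs)
  have hrt : r + t ≠ 0 := fun h0 => hac (by linear_combination (t - r) * h0 + hr - ht)
  obtain rfl : a = x - r ^ 2 := by rw [hr]; ring
  obtain rfl : b = x - s ^ 2 := by rw [hs]; ring
  obtain rfl : c = x - t ^ 2 := by rw [ht]; ring
  refine h.add_of_X_ne h₁ h₂ h₃ ?_ (s + t) ?_ ?_ ?_
  · rw [hu, ← sub_ne_zero]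
    convert mul_ne_zero hrs hrt using 1
    ring
  · rw [hu, hv]; ring
  · rw [hu, hu']; ring
  · rw [hu, hv, hu', hv']; ring

theorem torsion_add_torsion (hab : a ≠ b) (h₁ : W.Nonsingular a 0) (h₂ : W.Nonsingular b 0)
    (h₃ : W.Nonsingular c 0) :
    Affine.Point.some _ _ h₁ + Affine.Point.some _ _ h₂ = Affine.Point.some _ _ h₃ :=
  h.add_of_X_ne h₁ h₂ h₃ hab 0 (by ring) (by ring) (by ring)

theorem torsion_add_self (h₁ : W.Nonsingular a 0) :
    Affine.Point.some _ _ h₁ + Affine.Point.some _ _ h₁ = 0 :=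
  Affine.Point.add_self_of_Y_eq (by rw [h.negY_eq, neg_zero])

theorem eq_torsion_of_add_self [NeZero (2 : L)] {S : W.Point} (hS : S + S = 0) :
    S = 0 ∨ ∃ x, ∃ hx : W.Nonsingular x 0, (x = a ∨ x = b ∨ x = c) ∧ S = .some x 0 hx := by
  rcases S with _ | ⟨x, y, hxy⟩
  · exact Or.inl rfl
  · right
    have hy : y = 0 := by
      by_contra hy
      have hy' : y ≠ W.negY x y := by
        rw [h.negY_eq]
        intro h0
        exact mul_ne_zero two_ne_zero hy (by linear_combination h0)
      rw [Affine.Point.add_self_of_Y_ne hy'] at hS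
      exact Affine.Point.some_ne_zero _ hS
    subst hy
    refine ⟨x, hxy, ?_, rfl⟩
    have := (h.equation_iff x 0).1 hxy.1
    rw [zero_pow two_ne_zero, eq_comm, mul_eq_zero, mul_eq_zero, sub_eq_zero, sub_eq_zero,
      sub_eq_zero] at this
    tauto

end IsTwoTorsionForm

theorem weilPairingTwo_zero (θ : L) : weilPairingTwo (0 : W.Point) θ = 1 := rfl

theorem weilPairingTwo_some_self {x y : L} (h : W.Nonsingular x y) :
    weilPairingTwo (.some x y h) x = 1 := if_pos rfl

theorem weilPairingTwo_some_of_ne {x y θ : L} (h : W.Nonsingular x y) (hx : x ≠ θ) :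
    weilPairingTwo (.some x y h) θ = -1 := if_neg hx

theorem weilPairingTwo_eq_one_or (S : W.Point) (θ : L) :
    weilPairingTwo S θ = 1 ∨ weilPairingTwo S θ = -1 := by
  rcases S with _ | ⟨x, y, h⟩
  · exact Or.inl rfl
  · by_cases hx : x = θ
    · exact Or.inl (if_pos hx)
    · exact Or.inr (if_neg hx)

theorem weilPairingTwo_mul_self (S : W.Point) (θ : L) :
    weilPairingTwo S θ * weilPairingTwo S θ = 1 := by
  rcases weilPairingTwo_eq_one_or S θ with h | h <;> rw [h] <;> ring

theorem IsTwoTorsionForm.weilPairingTwo_add [NeZero (2 : L)] [DecidableEq L]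
    (h : IsTwoTorsionForm W a b c) (hab : a ≠ b) (hac : a ≠ c) (hbc : b ≠ c) {S T : W.Point}
    (hS : S + S = 0) (hT : T + T = 0) {θ : L} (hθ : θ = a ∨ θ = b ∨ θ = c) :
    weilPairingTwo (S + T) θ = weilPairingTwo S θ * weilPairingTwo T θ := by
  -- Two distinct nonzero torsion points add up to the third one; the six ordered pairs are obtained
  -- from this one by relabelling `a`, `b`, `c`.
  have key : ∀ {a b c : L}, IsTwoTorsionForm W a b c → a ≠ b → a ≠ c → b ≠ c →
      ∀ (h₁ : W.Nonsingular a 0) (h₂ : W.Nonsingular b 0), (θ = a ∨ θ = b ∨ θ = c) →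
      weilPairingTwo (Affine.Point.some _ _ h₁ + Affine.Point.some _ _ h₂) θ =
        weilPairingTwo (.some _ _ h₁) θ * weilPairingTwo (.some _ _ h₂) θ := by
    intro a b c h hab hac hbc h₁ h₂ hθ
    rw [h.torsion_add_torsion hab h₁ h₂ (h.nonsingular hab hac hbc (by ring))]
    rcases hθ with rfl | rfl | rfl
    · rw [weilPairingTwo_some_self, weilPairingTwo_some_of_ne _ hab.symm,
        weilPairingTwo_some_of_ne _ hac.symm, one_mul]
    · rw [weilPairingTwo_some_self, weilPairingTwo_some_of_ne _ hab,
        weilPairingTwo_some_of_ne _ hbc.symm, mul_one]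
    · rw [weilPairingTwo_some_self, weilPairingTwo_some_of_ne _ hac,
        weilPairingTwo_some_of_ne _ hbc]
      ring
  rcases h.eq_torsion_of_add_self hS with rfl | ⟨x, hx, hxe, rfl⟩
  · rw [zero_add, weilPairingTwo_zero, one_mul]
  rcases h.eq_torsion_of_add_self hT with rfl | ⟨y, hy, hye, rfl⟩
  · rw [add_zero, weilPairingTwo_zero, mul_one]
  rcases hxe with rfl | rfl | rfl <;> rcases hye with rfl | rfl | rfl
  · rw [h.torsion_add_self, weilPairingTwo_mul_self, weilPairingTwo_zero]
  · exact key h hab hac hbc _ _ hθ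
  · exact key h.swap.rotate hac hab hbc.symm _ _ (by tauto)
  · exact key h.swap hab.symm hbc hac _ _ (by tauto)
  · rw [h.swap.torsion_add_self, weilPairingTwo_mul_self, weilPairingTwo_zero]
  · exact key h.rotate hbc hab.symm hac.symm _ _ (by tauto)
  · exact key h.rotate.rotate hac.symm hbc.symm hab _ _ (by tauto)
  · exact key h.rotate.swap hbc.symm hac.symm hab.symm _ _ (by tauto)
  · rw [h.rotate.rotate.torsion_add_self, weilPairingTwo_mul_self, weilPairingTwo_zero]

end TwoTorsion

/-! ### The Kummer map -/

section KummerMap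

open scoped Classical

variable {K : Type*} [Field K] {F : K[X]} {e : Fin 3 → AlgebraicClosure K}

namespace IsRootTriple

variable (he : IsRootTriple F e)
include he

theorem map_eq_three : F.map (algebraMap K (AlgebraicClosure K)) =
    X ^ 3 - C (e 0 + e 1 + e 2) * X ^ 2 + C (e 0 * e 1 + e 0 * e 2 + e 1 * e 2) * X -
      C (e 0 * e 1 * e 2) := by
  rw [he.map_eq, Fin.prod_univ_three]
  simp only [map_add, map_mul]
  ring

theorem coeff_two : algebraMap K (AlgebraicClosure K) (F.coeff 2) = -(e 0 + e 1 + e 2) := by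
  rw [← coeff_map, he.map_eq_three]
  simp [-map_add, -map_mul]

theorem coeff_one : algebraMap K (AlgebraicClosure K) (F.coeff 1) =
    e 0 * e 1 + e 0 * e 2 + e 1 * e 2 := by
  rw [← coeff_map, he.map_eq_three]
  simp [coeff_C, -map_add, -map_mul]

theorem coeff_zero : algebraMap K (AlgebraicClosure K) (F.coeff 0) = -(e 0 * e 1 * e 2) := by
  rw [← coeff_map, he.map_eq_three]
  simp [coeff_X, coeff_C, -map_add, -map_mul]

theorem isTwoTorsionForm :
    IsTwoTorsionForm ((cubicCurve F)⁄(AlgebraicClosure K)).toAffine (e 0) (e 1) (e 2) where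
  a₁ := map_zero _
  a₂ := he.coeff_two
  a₃ := map_zero _
  a₄ := he.coeff_one
  a₆ := he.coeff_zero

theorem ne {i j : Fin 3} (hij : i ≠ j) : e i ≠ e j := he.injective.ne hij

theorem ne₀₁ : e 0 ≠ e 1 := he.ne (by decide)
theorem ne₀₂ : e 0 ≠ e 2 := he.ne (by decide)
theorem ne₁₂ : e 1 ≠ e 2 := he.ne (by decide)

theorem weilPairingTwo_add [CharZero K] {S T : ((cubicCurve F)⁄(AlgebraicClosure K)).toAffine.Point}
    (hS : S + S = 0) (hT : T + T = 0) (i : Fin 3) :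
    weilPairingTwo (S + T) (e i) = weilPairingTwo S (e i) * weilPairingTwo T (e i) :=
  he.isTwoTorsionForm.weilPairingTwo_add he.ne₀₁ he.ne₀₂ he.ne₁₂ hS hT
    (by fin_cases i <;> simp)

/-- Embeddings of `A_K` correspond to the indices of the roots, so the square roots `β` may be
indexed by `Fin 3`; all later work uses this form. -/
theorem isKummerClass_iff {P : ((cubicCurve F)⁄K).toAffine.Point} {c : SqClass (AdjoinRoot F)ˣ} :
    IsKummerClass F P c ↔
      ∃ a : (AdjoinRoot F)ˣ, (QuotientGroup.mk a : SqClass (AdjoinRoot F)ˣ) = c ∧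
      ∃ Q : ((cubicCurve F)⁄(AlgebraicClosure K)).toAffine.Point,
        Q + Q = Affine.Point.baseChange K (AlgebraicClosure K) P ∧
      ∃ β : Fin 3 → AlgebraicClosure K, (∀ i, β i ^ 2 = he.hom i a) ∧
        ∀ (σ : AlgebraicClosure K ≃ₐ[K] AlgebraicClosure K) (i j : Fin 3), σ (e i) = e j →
          σ (β i) = weilPairingTwo (Affine.Point.map
            (σ : AlgebraicClosure K →ₐ[K] AlgebraicClosure K) Q - Q) (e j) * β j := by
  constructor
  · rintro ⟨a, ha, Q, hQ, β, hβ, hσ⟩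
    refine ⟨a, ha, Q, (two_nsmul Q).symm.trans hQ, fun i => β (he.hom i), fun i => hβ _, ?_⟩
    intro σ i j hij
    obtain ⟨π, hπ⟩ := he.exists_perm σ
    obtain rfl : π i = j := he.injective (by rw [← hπ, hij])
    have h := hσ σ (he.hom i)
    rw [he.comp_hom hπ, he.hom_root, hij] at h
    exact h
  · rintro ⟨a, ha, Q, hQ, β, hβ, hσ⟩
    choose ix hix using he.exists_hom_eq
    have hix' : ∀ i, ix (he.hom i) = i := fun i => he.injective (by
      rw [← he.hom_root, hix, he.hom_root])
    refine ⟨a, ha, Q, (two_nsmul Q).trans hQ, fun φ => β (ix φ), fun φ => ?_, ?_⟩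
    · rw [hβ, hix]
    · intro σ φ
      obtain ⟨π, hπ⟩ := he.exists_perm σ
      obtain ⟨i, rfl⟩ := he.exists_hom_eq φ
      dsimp only
      rw [he.comp_hom hπ, he.hom_root, hπ, hix', hix', hσ σ i (π i) (hπ i)]

end IsRootTriple

theorem map_baseChange_point (σ : AlgebraicClosure K ≃ₐ[K] AlgebraicClosure K)
    (P : ((cubicCurve F)⁄K).toAffine.Point) :
    Affine.Point.map (W' := cubicCurve F) (σ : AlgebraicClosure K →ₐ[K] AlgebraicClosure K)
      (Affine.Point.baseChange K (AlgebraicClosure K) P) =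
      Affine.Point.baseChange K (AlgebraicClosure K) P :=
  Affine.Point.map_baseChange _ P

theorem map_sub_self_add_self {P : ((cubicCurve F)⁄K).toAffine.Point}
    {Q : ((cubicCurve F)⁄(AlgebraicClosure K)).toAffine.Point}
    (hQ : Q + Q = Affine.Point.baseChange K (AlgebraicClosure K) P)
    (σ : AlgebraicClosure K ≃ₐ[K] AlgebraicClosure K) :
    (Affine.Point.map (σ : AlgebraicClosure K →ₐ[K] AlgebraicClosure K) Q - Q) +
      (Affine.Point.map (σ : AlgebraicClosure K →ₐ[K] AlgebraicClosure K) Q - Q) = 0 := by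
  rw [sub_add_sub_comm, ← map_add, hQ, map_baseChange_point, sub_self]

theorem weilPairingTwo_map (σ : AlgebraicClosure K ≃ₐ[K] AlgebraicClosure K)
    (S : ((cubicCurve F)⁄(AlgebraicClosure K)).toAffine.Point) (θ : AlgebraicClosure K) :
    weilPairingTwo (Affine.Point.map (σ : AlgebraicClosure K →ₐ[K] AlgebraicClosure K) S) (σ θ) =
      weilPairingTwo S θ := by
  rcases S with _ | ⟨x, y, h⟩
  · rfl
  · by_cases hx : x = θ
    · subst hx
      exact (weilPairingTwo_some_self _).trans (weilPairingTwo_some_self _).symm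
    · exact (weilPairingTwo_some_of_ne _ (fun h => hx (σ.injective h))).trans
        (weilPairingTwo_some_of_ne _ hx).symm

namespace IsRootTriple

variable (he : IsRootTriple F e) [CharZero K]
include he

/-- Two halves of `P` differ by a torsion point `S`, which changes the cocycle by the coboundary of
`S`. The family `β' / (β · e₂(S, ·))` is therefore equivariant and descends to a unit `g`, whose
square is `a' / a`. -/
theorem isKummerClass_unique {P : ((cubicCurve F)⁄K).toAffine.Point}
    {c c' : SqClass (AdjoinRoot F)ˣ} (h : IsKummerClass F P c) (h' : IsKummerClass F P c') :
    c = c' := by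
  obtain ⟨a, rfl, Q, hQ, β, hβ, hσ⟩ := he.isKummerClass_iff.1 h
  obtain ⟨a', rfl, Q', hQ', β', hβ', hσ'⟩ := he.isKummerClass_iff.1 h'
  have hβ0 : ∀ i, β i ≠ 0 := fun i h0 => (a.isUnit.map (he.hom i)).ne_zero (by
    rw [← hβ, h0, zero_pow two_ne_zero])
  have hβ0' : ∀ i, β' i ≠ 0 := fun i h0 => (a'.isUnit.map (he.hom i)).ne_zero (by
    rw [← hβ', h0, zero_pow two_ne_zero])
  obtain ⟨S, hS⟩ : ∃ S, Q' = Q + S := ⟨Q' - Q, by abel⟩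
  have hSS : S + S = 0 := by
    have : Q' + Q' = (Q + Q) + (S + S) := by rw [hS]; abel
    rwa [hQ', hQ, left_eq_add] at this
  have hw0 : ∀ i, weilPairingTwo S (e i) ≠ 0 := fun i h0 => by
    have := weilPairingTwo_mul_self S (e i)
    rw [h0, mul_zero] at this
    exact zero_ne_one this
  obtain ⟨g, hg⟩ := he.exists_unit_of_equivariant
    (fun i => β' i / (β i * weilPairingTwo S (e i)))
    (fun i => div_ne_zero (hβ0' i) (mul_ne_zero (hβ0 i) (hw0 i))) (by
    intro σ i j hij
    have hσS : Affine.Point.map (σ : AlgebraicClosure K →ₐ[K] AlgebraicClosure K) S +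
        Affine.Point.map (σ : AlgebraicClosure K →ₐ[K] AlgebraicClosure K) S = 0 := by
      rw [← map_add, hSS, map_zero]
    have h1 : Affine.Point.map (σ : AlgebraicClosure K →ₐ[K] AlgebraicClosure K) Q' - Q' =
        (Affine.Point.map (σ : AlgebraicClosure K →ₐ[K] AlgebraicClosure K) Q - Q) +
        (Affine.Point.map (σ : AlgebraicClosure K →ₐ[K] AlgebraicClosure K) S + S) := by
      rw [hS, map_add, ← sub_eq_zero]
      calc _ = -(S + S) := by abel
        _ = 0 := by rw [hSS, neg_zero]
    have h2 : weilPairingTwo (Affine.Point.map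
        (σ : AlgebraicClosure K →ₐ[K] AlgebraicClosure K) Q' - Q') (e j) =
        weilPairingTwo (Affine.Point.map
        (σ : AlgebraicClosure K →ₐ[K] AlgebraicClosure K) Q - Q) (e j) *
        (weilPairingTwo S (e i) * weilPairingTwo S (e j)) := by
      rw [h1, he.weilPairingTwo_add (map_sub_self_add_self hQ σ)
        (by rw [add_add_add_comm, hσS, hSS, add_zero]), he.weilPairingTwo_add hσS hSS, ← hij,
        weilPairingTwo_map]
    have h3 : σ (weilPairingTwo S (e i)) = weilPairingTwo S (e i) := by
      rcases weilPairingTwo_eq_one_or S (e i) with h | h <;> rw [h] <;> simp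
    have h4 : weilPairingTwo (Affine.Point.map
        (σ : AlgebraicClosure K →ₐ[K] AlgebraicClosure K) Q - Q) (e j) ≠ 0 := by
      intro h0
      have := hσ σ i j hij
      rw [h0, zero_mul, EmbeddingLike.map_eq_zero_iff] at this
      exact hβ0 i this
    rw [map_div₀, map_mul, h3, hσ σ i j hij, hσ' σ i j hij, h2]
    have h5 := weilPairingTwo_mul_self S (e j)
    have := hw0 i
    have := hw0 j
    have := hβ0 j
    rw [div_eq_div_iff (mul_ne_zero (mul_ne_zero h4 (hβ0 j)) (hw0 i)) (mul_ne_zero (hβ0 j) (hw0 j))]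
    linear_combination (weilPairingTwo (Affine.Point.map
        (σ : AlgebraicClosure K →ₐ[K] AlgebraicClosure K) Q - Q) (e j) *
        weilPairingTwo S (e i) * β' j * β j) * h5)
  rw [QuotientGroup.eq]
  refine ⟨g, Units.ext (he.ext_hom fun i => ?_)⟩
  have h5 := weilPairingTwo_mul_self S (e i)
  have h6 := hβ0 i
  have h7 := hw0 i
  simp only [powMonoidHom_apply, Units.val_pow_eq_pow_val, map_pow, hg, Units.val_mul, map_mul,
    ← hβ']
  have h8 : he.hom i (a⁻¹ : (AdjoinRoot F)ˣ) * β i ^ 2 = 1 := by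
    rw [hβ, ← map_mul, Units.inv_mul, map_one]
  rw [div_pow, div_eq_iff (pow_ne_zero _ (mul_ne_zero h6 h7))]
  linear_combination -(β' i ^ 2) * h8 - (he.hom i (a⁻¹ : (AdjoinRoot F)ˣ) * β' i ^ 2 * β i ^ 2) * h5

/-- Bilinearity of the Weil pairing: halves are added and square roots multiplied. -/
theorem isKummerClass_add {P P' : ((cubicCurve F)⁄K).toAffine.Point}
    {c c' : SqClass (AdjoinRoot F)ˣ} (h : IsKummerClass F P c) (h' : IsKummerClass F P' c') :
    IsKummerClass F (P + P') (c * c') := by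
  obtain ⟨a, rfl, Q, hQ, β, hβ, hσ⟩ := he.isKummerClass_iff.1 h
  obtain ⟨a', rfl, Q', hQ', β', hβ', hσ'⟩ := he.isKummerClass_iff.1 h'
  refine he.isKummerClass_iff.2 ⟨a * a', rfl, Q + Q', ?_, β * β', fun i => ?_, fun σ i j hij => ?_⟩
  · rw [add_add_add_comm, hQ, hQ', map_add]
  · rw [Pi.mul_apply, mul_pow, hβ, hβ', Units.val_mul, map_mul]
  · rw [Pi.mul_apply, Pi.mul_apply, map_mul, hσ σ i j hij, hσ' σ i j hij, map_add,
      add_sub_add_comm, he.weilPairingTwo_add (map_sub_self_add_self hQ σ)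
      (map_sub_self_add_self hQ' σ)]
    ring

omit [CharZero K] in
theorem isKummerClass_zero : IsKummerClass F (0 : ((cubicCurve F)⁄K).toAffine.Point) 1 := by
  refine he.isKummerClass_iff.2 ⟨1, rfl, 0, ?_, 1, fun i => ?_, fun σ i j hij => ?_⟩
  · rw [map_zero, add_zero]
  · simp
  · rw [map_zero, sub_zero, weilPairingTwo_zero]
    simp

end IsRootTriple

end KummerMap

/-! ### Explicit representatives of Kummer classes -/

section ExplicitKummer

open scoped Classical

variable {K : Type*} [Field K] {F : K[X]} {e : Fin 3 → AlgebraicClosure K}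

/-- The value of a representative of the Kummer class of a point with first coordinate `x` at the
root `θ` of `F`: it is `x - θ` unless this vanishes, and `F'(x)` otherwise. -/
noncomputable def kummerValue (F : K[X]) (x θ : AlgebraicClosure K) : AlgebraicClosure K :=
  if x = θ then aeval x (derivative F) else x - θ

theorem kummerValue_of_ne {x θ : AlgebraicClosure K} (h : x ≠ θ) : kummerValue F x θ = x - θ :=
  if_neg h

theorem kummerValue_self {x : AlgebraicClosure K} :
    kummerValue F x x = aeval x (derivative F) :=
  if_pos rfl

theorem kummerValue_equivariant (x : K) (σ : AlgebraicClosure K ≃ₐ[K] AlgebraicClosure K)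
    (θ : AlgebraicClosure K) :
    σ (kummerValue F (algebraMap K _ x) θ) = kummerValue F (algebraMap K _ x) (σ θ) := by
  by_cases h : algebraMap K _ x = θ
  · subst h
    rw [AlgEquiv.commutes, kummerValue_self, aeval_algebraMap_apply, AlgEquiv.commutes]
  · have h' : algebraMap K _ x ≠ σ θ := fun h0 => h (σ.injective (by rw [← h0, AlgEquiv.commutes]))
    rw [kummerValue_of_ne h, kummerValue_of_ne h', map_sub, AlgEquiv.commutes]

namespace IsRootTriple

variable (he : IsRootTriple F e)
include he

theorem aeval_derivative (x : AlgebraicClosure K) : aeval x (derivative F) =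
    (x - e 0) * (x - e 1) + (x - e 0) * (x - e 2) + (x - e 1) * (x - e 2) := by
  rw [← eval_map_algebraMap, ← derivative_map, he.map_eq_three]
  simp [-map_add, -map_mul]
  ring

theorem aeval_derivative_root_ne_zero (i : Fin 3) : aeval (e i) (derivative F) ≠ 0 := by
  have h1 := sub_ne_zero.2 he.ne₀₁
  have h2 := sub_ne_zero.2 he.ne₀₂
  have h3 := sub_ne_zero.2 he.ne₁₂
  have h4 := sub_ne_zero.2 he.ne₀₁.symm
  have h5 := sub_ne_zero.2 he.ne₀₂.symm
  have h6 := sub_ne_zero.2 he.ne₁₂.symm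
  rw [he.aeval_derivative]
  fin_cases i <;> simp [*]

theorem kummerValue_ne_zero (x : AlgebraicClosure K) (i : Fin 3) :
    kummerValue F x (e i) ≠ 0 := by
  by_cases h : x = e i
  · rw [h, kummerValue_self]
    exact he.aeval_derivative_root_ne_zero i
  · rw [kummerValue_of_ne h]
    exact sub_ne_zero.2 h

theorem exists_unit_kummerValue [CharZero K] (x : K) :
    ∃ a : (AdjoinRoot F)ˣ, ∀ i, he.hom i a = kummerValue F (algebraMap K _ x) (e i) :=
  he.exists_unit_of_equivariant _ (fun i => he.kummerValue_ne_zero _ i)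
    fun σ i j hij => by rw [kummerValue_equivariant, hij]

theorem prod_kummerValue {x y : AlgebraicClosure K} (hxy : y ^ 2 = aeval x F) :
    ∏ i, kummerValue F x (e i) = y ^ 2 ∧ y ≠ 0 ∨
      ∏ i, kummerValue F x (e i) = (aeval x (derivative F)) ^ 2 ∧ y = 0 := by
  by_cases hy : y = 0
  · right
    refine ⟨?_, hy⟩
    obtain ⟨i, rfl⟩ := he.exists_eq_of_aeval_eq_zero
      (show aeval x F = 0 by rw [← hxy, hy, zero_pow two_ne_zero])
    have h (j : Fin 3) (hj : i ≠ j) : kummerValue F (e i) (e j) = e i - e j :=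
      kummerValue_of_ne (he.ne hj)
    rw [Fin.prod_univ_three]
    fin_cases i
    · have h1 := h 1 (by decide)
      have h2 := h 2 (by decide)
      simp only [Fin.zero_eta] at h1 h2 ⊢
      rw [h1, h2, kummerValue_self, he.aeval_derivative]
      ring
    · have h1 := h 0 (by decide)
      have h2 := h 2 (by decide)
      simp only [Fin.mk_one] at h1 h2 ⊢
      rw [h1, h2, kummerValue_self, he.aeval_derivative]
      ring
    · have h1 := h 0 (by decide)
      have h2 := h 1 (by decide)
      simp only [Fin.reduceFinMk] at h1 h2 ⊢
      rw [h1, h2, kummerValue_self, he.aeval_derivative]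
      ring
  · left
    refine ⟨?_, hy⟩
    rw [hxy, he.aeval_eq]
    refine Finset.prod_congr rfl fun i _ => kummerValue_of_ne ?_
    rintro rfl
    rw [he.aeval_root] at hxy
    exact hy (pow_eq_zero_iff two_ne_zero |>.1 hxy)

/-- Square roots of the differences `x - e i` with given product. -/
theorem exists_sqrt {x y : AlgebraicClosure K} (hxy : y ^ 2 = aeval x F) :
    ∃ r : Fin 3 → AlgebraicClosure K, (∀ i, r i ^ 2 = x - e i) ∧ r 0 * r 1 * r 2 = y := by
  have h : ∀ i, ∃ r, r ^ 2 = x - e i := fun i => IsAlgClosed.exists_pow_nat_eq _ two_pos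
  choose r hr using h
  have h1 : (r 0 * r 1 * r 2) ^ 2 = y ^ 2 := by
    rw [hxy, he.aeval_eq, Fin.prod_univ_three, ← hr, ← hr, ← hr]
    ring
  rcases sq_eq_sq_iff_eq_or_eq_neg.1 h1 with h1 | h1
  · exact ⟨r, hr, h1⟩
  · refine ⟨fun i => -r i, fun i => by rw [neg_sq, hr], ?_⟩
    rw [← neg_neg y, ← h1]
    ring

/-- Square roots of the Kummer values, compatible with given square roots of the `x - e i`, and
whose product is rational. -/
theorem exists_sqrt_kummerValue {x y : K} {r : Fin 3 → AlgebraicClosure K}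
    (hr : ∀ i, r i ^ 2 = algebraMap K _ x - e i) (hry : r 0 * r 1 * r 2 = algebraMap K _ y) :
    ∃ β : Fin 3 → AlgebraicClosure K,
      (∀ i, β i ^ 2 = kummerValue F (algebraMap K _ x) (e i)) ∧
      (∃ b, β 0 * β 1 * β 2 = algebraMap K _ b) ∧ ∀ i, r i = 0 ∨ r i = β i := by
  by_cases h : ∃ i, r i = 0
  · obtain ⟨i, hi⟩ := h
    have hx : algebraMap K (AlgebraicClosure K) x = e i := by
      have := hr i
      rw [hi, zero_pow two_ne_zero] at this
      exact (sub_eq_zero.1 this.symm)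
    have hne (j : Fin 3) (hj : j ≠ i) : kummerValue F (algebraMap K _ x) (e j) = r j ^ 2 := by
      rw [hr, kummerValue_of_ne]
      rw [hx]
      exact he.ne hj.symm
    have hd : kummerValue F (algebraMap K _ x) (e i) = r 0 ^ 2 * r 1 ^ 2 + r 0 ^ 2 * r 2 ^ 2 +
        r 1 ^ 2 * r 2 ^ 2 := by
      rw [← hx, kummerValue_self, he.aeval_derivative, hr, hr, hr]
    have hd' : algebraMap K (AlgebraicClosure K) (aeval x (derivative F)) =
        r 0 ^ 2 * r 1 ^ 2 + r 0 ^ 2 * r 2 ^ 2 + r 1 ^ 2 * r 2 ^ 2 := by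
      rw [← hd, ← hx, kummerValue_self, aeval_algebraMap_apply]
    -- At the vanishing index, `F'(x)` is the product of the other two differences, with square root
    -- `r (i + 1) * r (i + 2)`. The product of all three roots is then `F'(x)`, which is rational.
    refine ⟨fun j => if j = i then r (i + 1) * r (i + 2) else r j, fun j => ?_,
      ⟨aeval x (derivative F), ?_⟩, fun j => ?_⟩
    · by_cases hj : j = i
      · subst hj
        simp only [if_true]
        rw [hd]
        fin_cases j <;> simp at hi <;> simp [hi] <;> ring
      · simp only [if_neg hj]
        rw [hne j hj]
    · rw [hd']
      fin_cases i <;> simp at hi <;> simp [hi] <;> ring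
    · by_cases hj : j = i
      · exact Or.inl (hj ▸ hi)
      · exact Or.inr (if_neg hj).symm
  · push Not at h
    refine ⟨r, fun i => ?_, ⟨y, hry⟩, fun i => Or.inr rfl⟩
    rw [hr, kummerValue_of_ne]
    intro h0
    have := hr i
    rw [h0, sub_self] at this
    exact h i ((pow_eq_zero_iff two_ne_zero).1 this)

variable [CharZero K]

/-- Sign triples of product `1` form a group of order four, matched with `E[2]` by the Weil pairing.
The formula for `v'` is `(r + s)(r + t)(s + t) = (r + s + t)(rs + rt + st) - rst` after the sign
change, which leaves `rst` fixed. -/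
theorem exists_torsion_of_signs {x : AlgebraicClosure K} {r s : Fin 3 → AlgebraicClosure K}
    (hr : ∀ i, r i ^ 2 = x - e i) (hs : ∀ i, s i = 1 ∨ s i = -1) (hs1 : s 0 * s 1 * s 2 = 1)
    {u v u' v' : AlgebraicClosure K}
    (hu : u = x + r 0 * r 1 + r 0 * r 2 + r 1 * r 2)
    (hv : v = (r 0 + r 1) * (r 0 + r 2) * (r 1 + r 2))
    (hu' : u' = x + s 0 * s 1 * (r 0 * r 1) + s 0 * s 2 * (r 0 * r 2) + s 1 * s 2 * (r 1 * r 2))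
    (hv' : v' = (s 0 * r 0 + s 1 * r 1 + s 2 * r 2) * (u' - x) - r 0 * r 1 * r 2)
    (h₁ : ((cubicCurve F)⁄(AlgebraicClosure K)).toAffine.Nonsingular u v)
    (h₂ : ((cubicCurve F)⁄(AlgebraicClosure K)).toAffine.Nonsingular u' v') :
    ∃ S : ((cubicCurve F)⁄(AlgebraicClosure K)).toAffine.Point,
      Affine.Point.some _ _ h₁ + S = Affine.Point.some _ _ h₂ ∧
      ∀ i, weilPairingTwo S (e i) = s i := by
  have hW := he.isTwoTorsionForm
  have hns (i : Fin 3) : ((cubicCurve F)⁄(AlgebraicClosure K)).toAffine.Nonsingular (e i) 0 :=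
    hW.nonsingular he.ne₀₁ he.ne₀₂ he.ne₁₂ (by fin_cases i <;> simp)
  have h2 : (-1 : AlgebraicClosure K) ≠ 1 := by
    intro h
    exact two_ne_zero (α := AlgebraicClosure K) (by linear_combination -h)
  have hweil (i j : Fin 3) : weilPairingTwo (Affine.Point.some _ _ (hns i)) (e j) =
      if i = j then 1 else -1 := by
    by_cases h : i = j
    · subst h
      rw [if_pos rfl, weilPairingTwo_some_self]
    · rw [if_neg h, weilPairingTwo_some_of_ne _ (he.ne h)]
  -- Of the eight sign patterns, the four of product `-1` are excluded; the others give `0` and the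
  -- three points `(e i, 0)`, where `i` is the index whose sign is kept.
  rcases hs 0 with h0 | h0 <;> rcases hs 1 with h1 | h1 <;> rcases hs 2 with h2' | h2' <;>
    rw [h0, h1, h2'] at hs1 hu' hv'
  · refine ⟨0, ?_, fun i => ?_⟩
    · rw [add_zero, Affine.Point.some.injEq]
      constructor
      · rw [hu, hu']; ring
      · rw [hv, hv', hu']; ring
    · rw [weilPairingTwo_zero]
      fin_cases i <;> simp [*]
  · exact absurd (by linear_combination hs1) h2
  · exact absurd (by linear_combination hs1) h2
  · refine ⟨.some _ _ (hns 0), ?_, fun i => ?_⟩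
    · refine hW.half_add_torsion he.ne₀₁ he.ne₀₂ he.ne₁₂ (hr 0) (hr 1) (hr 2) hu hv ?_ ?_ _ _ _
      · rw [hu']; ring
      · rw [hv', hu']; ring
    · rw [hweil]
      fin_cases i <;> simp [*]
  · exact absurd (by linear_combination hs1) h2
  · refine ⟨.some _ _ (hns 1), ?_, fun i => ?_⟩
    · refine hW.rotate.half_add_torsion he.ne₁₂ he.ne₀₁.symm he.ne₀₂.symm (hr 1) (hr 2) (hr 0)
        ?_ ?_ ?_ ?_ _ _ _
      · rw [hu]; ring
      · rw [hv]; ring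
      · rw [hu']; ring
      · rw [hv', hu']; ring
    · rw [hweil]
      fin_cases i <;> simp [*]
  · refine ⟨.some _ _ (hns 2), ?_, fun i => ?_⟩
    · refine hW.rotate.rotate.half_add_torsion he.ne₀₂.symm he.ne₁₂.symm he.ne₀₁ (hr 2) (hr 0)
        (hr 1) ?_ ?_ ?_ ?_ _ _ _
      · rw [hu]; ring
      · rw [hv]; ring
      · rw [hu']; ring
      · rw [hv', hu']; ring
    · rw [hweil]
      fin_cases i <;> simp [*]
  · exact absurd (by linear_combination hs1) h2

omit [CharZero K] in
theorem equation_iff {x y : K} : ((cubicCurve F)⁄K).toAffine.Equation x y ↔ y ^ 2 = aeval x F := by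
  have hF : aeval x F = x ^ 3 + F.coeff 2 * x ^ 2 + F.coeff 1 * x + F.coeff 0 := by
    have h3 : F.coeff 3 = 1 := by
      have := he.monic.coeff_natDegree
      rwa [he.natDegree_eq] at this
    rw [aeval_eq_sum_range, he.natDegree_eq]
    simp [Finset.sum_range_succ, h3]
    ring
  rw [hF, Affine.equation_iff]
  simp [cubicCurve, WeierstrassCurve.baseChange]

/-- An automorphism acts on the chosen square roots by permuting indices and changing signs. The
same signs describe `σ Q - Q`, which is the cocycle condition. -/
theorem isKummerClass_some {x y : K} (h : ((cubicCurve F)⁄K).toAffine.Nonsingular x y)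
    {a : (AdjoinRoot F)ˣ} (ha : ∀ i, he.hom i a = kummerValue F (algebraMap K _ x) (e i)) :
    IsKummerClass F (.some x y h) (QuotientGroup.mk a) := by
  have hW := he.isTwoTorsionForm
  have hxy : (algebraMap K (AlgebraicClosure K) y) ^ 2 = aeval (algebraMap K _ x) F := by
    rw [← map_pow, he.equation_iff.1 h.1, aeval_algebraMap_apply]
  obtain ⟨r, hr, hry⟩ := he.exists_sqrt hxy
  obtain ⟨β, hβ, ⟨b, hb⟩, hrβ⟩ := he.exists_sqrt_kummerValue hr hry
  have hβ0 : ∀ i, β i ≠ 0 := fun i h0 => he.kummerValue_ne_zero (algebraMap K _ x) i (by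
    rw [← hβ, h0, zero_pow two_ne_zero])
  have hσX (σ : AlgebraicClosure K ≃ₐ[K] AlgebraicClosure K) := σ.commutes x
  have hkv := kummerValue_equivariant (F := F) x
  generalize hX : algebraMap K (AlgebraicClosure K) x = X at *
  set u := X + r 0 * r 1 + r 0 * r 2 + r 1 * r 2 with hu
  set v := (r 0 + r 1) * (r 0 + r 2) * (r 1 + r 2) with hv
  have huv : v ^ 2 = (u - e 0) * (u - e 1) * (u - e 2) := by
    have h0 : e 0 = X - r 0 ^ 2 := by rw [hr]; ring
    have h1 : e 1 = X - r 1 ^ 2 := by rw [hr]; ring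
    have h2 : e 2 = X - r 2 ^ 2 := by rw [hr]; ring
    rw [hu, hv, h0, h1, h2]
    ring
  have hns := hW.nonsingular he.ne₀₁ he.ne₀₂ he.ne₁₂ huv
  refine he.isKummerClass_iff.2 ⟨a, rfl, .some u v hns, ?_, β, fun i => by rw [hβ, ha], ?_⟩
  · have hns' : ((cubicCurve F)⁄(AlgebraicClosure K)).toAffine.Nonsingular X (r 0 * r 1 * r 2) :=
      hW.nonsingular he.ne₀₁ he.ne₀₂ he.ne₁₂ (by
        rw [hry, hxy, he.aeval_eq, Fin.prod_univ_three])
    have := hW.two_nsmul_half he.ne₀₁ he.ne₀₂ he.ne₁₂ (hr 0) (hr 1) (hr 2) hu hv hns hns'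
    rw [two_nsmul] at this
    rw [this]
    exact (Affine.Point.some.injEq ..).mpr ⟨hX.symm, hry⟩
  · intro σ i j hij
    obtain ⟨π, hπ⟩ := he.exists_perm σ
    obtain rfl : π i = j := he.injective (by rw [← hπ, hij])
    let s : Fin 3 → AlgebraicClosure K := fun j => σ (β (π.symm j)) / β j
    have hsβ : ∀ i, σ (β i) = s (π i) * β (π i) := fun i => by
      simp only [s, Equiv.symm_apply_apply]
      rw [div_mul_cancel₀ _ (hβ0 _)]
    have hs : ∀ j, s j = 1 ∨ s j = -1 := fun j => by
      rw [← sq_eq_one_iff]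
      simp only [s]
      rw [div_pow, div_eq_one_iff_eq (pow_ne_zero _ (hβ0 j)), ← map_pow, hβ, hβ,
        hkv, hπ, Equiv.apply_symm_apply]
    have hprod : ∀ f : Fin 3 → AlgebraicClosure K, f 0 * f 1 * f 2 = ∏ i, f i := fun f =>
      (Fin.prod_univ_three f).symm
    -- The product of the `β i` is rational, hence fixed by `σ`; this is why the zero entry needs a
    -- square root with rational total product.
    have hs1 : s 0 * s 1 * s 2 = 1 := by
      have h1 : ∏ i, σ (β i) = ∏ i, β i := by
        rw [← map_prod, ← hprod, hb, AlgEquiv.commutes]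
      simp only [hsβ] at h1
      rw [Equiv.prod_comp π (fun i => s i * β i), Finset.prod_mul_distrib] at h1
      rw [hprod]
      exact mul_eq_right₀ (Finset.prod_ne_zero_iff.2 fun i _ => hβ0 i) |>.1 h1
    have hsr : ∀ i, σ (r i) = s (π i) * r (π i) := fun i => by
      have h1 : r i = 0 ↔ r (π i) = 0 := by
        rw [← pow_eq_zero_iff two_ne_zero, hr, ← pow_eq_zero_iff (a := r (π i)) two_ne_zero, hr,
          ← hπ, ← hσX σ, ← map_sub, EmbeddingLike.map_eq_zero_iff,
          hσX σ]
      rcases hrβ i with h2 | h2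
      · rw [h2, h1.1 h2, map_zero, mul_zero]
      · rcases hrβ (π i) with h3 | h3
        · rw [h1.2 h3, h3, map_zero, mul_zero]
        · rw [h2, h3, hsβ]
    -- The half is rewritten through the sum of the `r i`, the sum of their squares and their
    -- product, so that the permutation `π` disappears from the computation of `σ u` and `σ v`.
    have hR : σ (r 0) + σ (r 1) + σ (r 2) = s 0 * r 0 + s 1 * r 1 + s 2 * r 2 := by
      have h1 : ∑ i, σ (r i) = ∑ i, s i * r i := by
        simp only [hsr]
        exact Equiv.sum_comp π (fun i => s i * r i)
      rwa [Fin.sum_univ_three, Fin.sum_univ_three] at h1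
    obtain ⟨A, hA, hσA⟩ : ∃ A, A = -(e 0 + e 1 + e 2) ∧ σ A = A :=
      ⟨_, he.coeff_two, AlgEquiv.commutes σ _⟩
    have hr3 : r 0 ^ 2 + r 1 ^ 2 + r 2 ^ 2 = 3 * X + A := by
      rw [hr, hr, hr, hA]
      ring
    have hss : ∀ i, s i ^ 2 = 1 := fun i => sq_eq_one_iff.2 (hs i)
    have hu' : σ u = X + s 0 * s 1 * (r 0 * r 1) + s 0 * s 2 * (r 0 * r 2) +
        s 1 * s 2 * (r 1 * r 2) := by
      have h1 : 2 * u = 2 * X + (r 0 + r 1 + r 2) ^ 2 - (3 * X + A) := by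
        rw [← hr3, hu]
        ring
      have h2 := congrArg σ h1
      simp only [map_mul, map_sub, map_add, map_pow, map_ofNat] at h2
      rw [hR, hσX σ, hσA] at h2
      refine mul_left_cancel₀ (two_ne_zero (α := AlgebraicClosure K)) ?_
      linear_combination h2 + hr3 + r 0 ^ 2 * hss 0 + r 1 ^ 2 * hss 1 + r 2 ^ 2 * hss 2
    have hv' : σ v = (s 0 * r 0 + s 1 * r 1 + s 2 * r 2) * (σ u - X) - r 0 * r 1 * r 2 := by
      have h1 : v = (r 0 + r 1 + r 2) * (u - X) - algebraMap K _ y := by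
        rw [← hry, hu, hv]
        ring
      rw [h1]
      simp only [map_mul, map_sub, map_add]
      rw [hR, hσX σ, hry, AlgEquiv.commutes]
    have huv' : (σ v) ^ 2 = (σ u - e 0) * (σ u - e 1) * (σ u - e 2) := by
      have h1 : v ^ 2 = aeval u F := by rw [huv, he.aeval_eq, Fin.prod_univ_three]
      have h2 := aeval_algHom_apply (σ : AlgebraicClosure K →ₐ[K] AlgebraicClosure K) u F
      rw [← map_pow, h1]
      refine h2.symm.trans ?_
      rw [he.aeval_eq, Fin.prod_univ_three]
      rfl
    obtain ⟨S, hS, hSw⟩ := he.exists_torsion_of_signs hr hs hs1 hu hv hu' hv' hns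
      (hW.nonsingular he.ne₀₁ he.ne₀₂ he.ne₁₂ huv')
    have hD : Affine.Point.map (W' := cubicCurve F)
        (σ : AlgebraicClosure K →ₐ[K] AlgebraicClosure K) (.some u v hns) - .some u v hns = S := by
      rw [sub_eq_iff_eq_add, add_comm S]
      exact hS.symm
    rw [hD, hSw, hsβ]

theorem exists_isKummerClass (P : ((cubicCurve F)⁄K).toAffine.Point) :
    ∃ c, IsKummerClass F P c := by
  rcases P with _ | ⟨x, y, h⟩
  · exact ⟨1, he.isKummerClass_zero⟩
  · obtain ⟨a, ha⟩ := he.exists_unit_kummerValue x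
    exact ⟨_, he.isKummerClass_some h ha⟩

theorem existsUnique_isKummerClass (P : ((cubicCurve F)⁄K).toAffine.Point) :
    ∃! c, IsKummerClass F P c := by
  obtain ⟨c, hc⟩ := he.exists_isKummerClass P
  exact ⟨c, hc, fun c' hc' => he.isKummerClass_unique hc' hc⟩

omit [CharZero K] in
theorem exists_norm_eq_sq {x y : K} (hxy : y ^ 2 = aeval x F) {a : AdjoinRoot F}
    (ha : ∀ i, he.hom i a = kummerValue F (algebraMap K _ x) (e i)) :
    ∃ b, Algebra.norm K a = b ^ 2 ∧ (y ≠ 0 → b = y) := by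
  have hxy' : (algebraMap K (AlgebraicClosure K) y) ^ 2 = aeval (algebraMap K _ x) F := by
    rw [← map_pow, hxy, aeval_algebraMap_apply]
  have hinj := (algebraMap K (AlgebraicClosure K)).injective
  rcases he.prod_kummerValue hxy' with ⟨h, hy⟩ | ⟨h, hy⟩
  · refine ⟨y, hinj ?_, fun _ => rfl⟩
    rw [he.norm_eq, map_pow, ← h]
    exact Finset.prod_congr rfl fun i _ => ha i
  · refine ⟨aeval x (derivative F), hinj ?_, fun h => absurd (hinj (hy.trans (map_zero _).symm)) h⟩
    rw [he.norm_eq, map_pow, ← aeval_algebraMap_apply, ← h]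
    exact Finset.prod_congr rfl fun i _ => ha i

end IsRootTriple

end ExplicitKummer

/-! ### The valuation of the algebraic closure -/

section Valuation

open scoped NNReal

variable (p : ℕ) [Fact p.Prime] (K : Type*) [Field K] [Algebra ℚ_[p] K] [FiniteDimensional ℚ_[p] K]

/-- The valuation on the algebraic closure of a finite extension of `ℚ_p` given by the spectral
norm. -/
noncomputable def spectralValuation : Valuation (AlgebraicClosure K) ℝ≥0 where
  toFun x := ⟨spectralNorm ℚ_[p] (AlgebraicClosure K) x, spectralNorm_nonneg x⟩
  map_zero' := NNReal.eq spectralNorm_zero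
  map_one' := NNReal.eq spectralNorm_one
  map_mul' x y := NNReal.eq (spectralAlgNorm_mul (K := ℚ_[p]) x y)
  map_add_le_max' x y := isNonarchimedean_spectralNorm (K := ℚ_[p]) x y

theorem coe_spectralValuation (x : AlgebraicClosure K) :
    (spectralValuation p K x : ℝ) = spectralNorm ℚ_[p] (AlgebraicClosure K) x := rfl

theorem spectralValuation_algEquiv (σ : AlgebraicClosure K ≃ₐ[K] AlgebraicClosure K)
    (x : AlgebraicClosure K) : spectralValuation p K (σ x) = spectralValuation p K x :=
  NNReal.eq (spectralNorm_eq_of_equiv (σ.restrictScalars ℚ_[p]) x).symm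

theorem spectralValuation_natCast :
    (spectralValuation p K (p : AlgebraicClosure K) : ℝ) = (p : ℝ)⁻¹ := by
  rw [coe_spectralValuation, ← map_natCast (algebraMap ℚ_[p] (AlgebraicClosure K)),
    spectralNorm_extends, Padic.norm_p]

variable [Algebra ℤ_[p] K] [IsScalarTower ℤ_[p] ℚ_[p] K]

theorem mem_ringOfInt_iff (x : K) :
    x ∈ RingOfInt p K ↔ spectralValuation p K (algebraMap K _ x) ≤ 1 := by
  rw [RingOfInt.mem_iff_spectralNorm_le_one, ← NNReal.coe_le_coe, coe_spectralValuation,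
    ← spectralNorm.eq_of_tower (L := AlgebraicClosure K) x, NNReal.coe_one]

theorem isIntegral_of_spectralValuation_le_one {x : AlgebraicClosure K}
    (h : spectralValuation p K x ≤ 1) : _root_.IsIntegral ℤ_[p] x := by
  have hx : _root_.IsIntegral ℚ_[p] x := Algebra.IsIntegral.isIntegral x
  rw [← NNReal.coe_le_coe, coe_spectralValuation, NNReal.coe_one, spectralNorm,
    spectralValue_le_one_iff (minpoly.monic hx)] at h
  have hl : minpoly ℚ_[p] x ∈ Polynomial.lifts (algebraMap ℤ_[p] ℚ_[p]) := by
    rw [Polynomial.lifts_iff_coeff_lifts]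
    intro n
    exact ⟨⟨(minpoly ℚ_[p] x).coeff n, h n⟩, rfl⟩
  obtain ⟨q, hq, -, hqm⟩ := Polynomial.lifts_and_natDegree_eq_and_monic hl (minpoly.monic hx)
  refine ⟨q, hqm, ?_⟩
  have := minpoly.aeval ℚ_[p] x
  rwa [← hq, aeval_map_algebraMap] at this

variable {p K}

/-- Each value of `u` is a root of a monic integral `q i`; the product of the `q i` kills `u` at
every root, hence kills `u`. -/
theorem IsRootTriple.isIntegral_of_hom {F : K[X]} {e : Fin 3 → AlgebraicClosure K}
    (he : IsRootTriple F e) {u : AdjoinRoot F}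
    (hu : ∀ i, spectralValuation p K (he.hom i u) ≤ 1) : u ∈ algInt p F := by
  choose q hqm hq using fun i => isIntegral_of_spectralValuation_le_one p K (hu i)
  have h : _root_.IsIntegral ℤ_[p] u := by
    refine ⟨∏ i, q i, monic_prod_of_monic _ _ fun i _ => hqm i, he.eq_zero_of_hom fun i => ?_⟩
    rw [← aeval_def, ← AlgHom.restrictScalars_apply ℤ_[p] (he.hom i), ← aeval_algHom_apply,
      map_prod]
    exact Finset.prod_eq_zero (Finset.mem_univ i) (hq i)
  exact h.tower_top

/-- The class of `a` is a unit class if, at each root of `F`, the valuation of `a` is the square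
of the valuation of an element defined over the residue field of that root. -/
theorem IsRootTriple.mk_mem_unitSquareNormClassesIn {F : K[X]} {e : Fin 3 → AlgebraicClosure K}
    (he : IsRootTriple F e) {a : (AdjoinRoot F)ˣ} {b : K}
    (hb : Algebra.norm K (a : AdjoinRoot F) = b ^ 2) (γ : Fin 3 → AlgebraicClosure K)
    (hγ : ∀ (σ : AlgebraicClosure K ≃ₐ[K] AlgebraicClosure K) (i j : Fin 3),
      σ (e i) = e j → σ (γ i) = γ j)
    (hv : ∀ i, spectralValuation p K (he.hom i a) = spectralValuation p K (γ i) ^ 2) :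
    (QuotientGroup.mk a : SqClass (AdjoinRoot F)ˣ) ∈ unitSquareNormClassesIn p F := by
  have : CharZero K := charZero_of_injective_algebraMap (algebraMap ℚ_[p] K).injective
  set v := spectralValuation p K
  have hva : ∀ i, v (he.hom i a) ≠ 0 := fun i =>
    (Valuation.ne_zero_iff _).2 (a.isUnit.map (he.hom i)).ne_zero
  have hγ0 : ∀ i, γ i ≠ 0 := fun i h0 => hva i (by
    rw [hv, h0, map_zero, zero_pow two_ne_zero])
  obtain ⟨g, hg⟩ := he.exists_unit_of_equivariant γ hγ0 hγ
  -- The unit of `A_𝒪` is `a / g²`, where `g` is the descent of `γ`; it and its inverse have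
  -- valuation `1` at every root.
  have hu (i : Fin 3) : v (he.hom i (a * (g⁻¹) ^ 2 : (AdjoinRoot F)ˣ)) = 1 := by
    have h1 : he.hom i (g⁻¹ : (AdjoinRoot F)ˣ) * γ i = 1 := by
      rw [← hg, ← map_mul, Units.inv_mul, map_one]
    rw [Units.val_mul, map_mul, map_mul, hv, Units.val_pow_eq_pow_val, map_pow, map_pow,
      ← mul_pow, ← map_mul, mul_comm, h1, map_one, one_pow]
  have hu' (i : Fin 3) :
      v (he.hom i ((a * (g⁻¹) ^ 2 : (AdjoinRoot F)ˣ)⁻¹ : (AdjoinRoot F)ˣ)) = 1 := by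
    have h1 : v (he.hom i (((a * (g⁻¹) ^ 2 : (AdjoinRoot F)ˣ)⁻¹ * (a * (g⁻¹) ^ 2) :
      (AdjoinRoot F)ˣ) : AdjoinRoot F)) = 1 := by
      rw [inv_mul_cancel, Units.val_one, map_one, map_one]
    rwa [Units.val_mul, map_mul, map_mul, hu, mul_one] at h1
  let w : (algInt p F)ˣ :=
    { val := ⟨_, he.isIntegral_of_hom fun i => (hu i).le⟩
      inv := ⟨_, he.isIntegral_of_hom fun i => (hu' i).le⟩
      val_inv := Subtype.ext (Units.mul_inv (a * (g⁻¹) ^ 2 : (AdjoinRoot F)ˣ))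
      inv_val := Subtype.ext (Units.inv_mul (a * (g⁻¹) ^ 2 : (AdjoinRoot F)ˣ)) }
  have hw : unitsIncl p F w = a * (g⁻¹) ^ 2 := Units.ext rfl
  refine ⟨QuotientGroup.mk w, ?_, ?_⟩
  · have hnorm : Algebra.norm K ((a * (g⁻¹) ^ 2 : (AdjoinRoot F)ˣ) : AdjoinRoot F) =
        (b * Algebra.norm K ((g⁻¹ : (AdjoinRoot F)ˣ) : AdjoinRoot F)) ^ 2 := by
      rw [Units.val_mul, map_mul, hb, Units.val_pow_eq_pow_val, map_pow, mul_pow]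
    have hb0 : b * Algebra.norm K ((g⁻¹ : (AdjoinRoot F)ˣ) : AdjoinRoot F) ≠ 0 := by
      intro h0
      rw [h0, zero_pow two_ne_zero] at hnorm
      exact ((a * (g⁻¹) ^ 2 : (AdjoinRoot F)ˣ).isUnit.map (Algebra.norm K)).ne_zero hnorm
    change _ = (1 : SqClass Kˣ)
    refine (QuotientGroup.eq_one_iff _).2 ⟨Units.mk0 _ hb0, Units.ext ?_⟩
    simp only [powMonoidHom_apply, Units.val_pow_eq_pow_val, Units.val_mk0, MonoidHom.comp_apply,
      hw]
    exact hnorm.symm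
  · change (QuotientGroup.mk (unitsIncl p F w) : SqClass (AdjoinRoot F)ˣ) = _
    rw [hw, QuotientGroup.eq]
    exact ⟨g, by simp⟩

end Valuation

/-! ### Square valuations at the roots of a cubic -/

section SquareValuation

open scoped NNReal

variable {K : Type*} [Field K]

/-- The family `E` of three distinct elements of the algebraic closure is stable under Galois. -/
structure IsGaloisTriple (E : Fin 3 → AlgebraicClosure K) : Prop where
  injective : Function.Injective E
  exists_eq : ∀ (σ : AlgebraicClosure K ≃ₐ[K] AlgebraicClosure K) i, ∃ j, σ (E i) = E j

open scoped Classical in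
/-- `X - E i` if this is nonzero, and the product of the other two differences otherwise. -/
noncomputable def rootValue (E : Fin 3 → AlgebraicClosure K) (X : AlgebraicClosure K) (i : Fin 3) :
    AlgebraicClosure K :=
  if X = E i then (X - E (i + 1)) * (X - E (i + 2)) else X - E i

theorem rootValue_of_ne {E : Fin 3 → AlgebraicClosure K} {X : AlgebraicClosure K} {i : Fin 3}
    (h : X ≠ E i) : rootValue E X i = X - E i :=
  if_neg h

theorem Fin.three_comm {M : Type*} [CommMonoid M] (f : Fin 3 → M) {i j k : Fin 3} (hij : i ≠ j)
    (hik : i ≠ k) (hjk : j ≠ k) : f i * f j * f k = ∏ l, f l := by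
  have h : (Finset.univ : Finset (Fin 3)) = {i, j, k} := by
    revert i j k
    decide
  rw [h, Finset.prod_insert (by simp [hij, hik]), Finset.prod_pair hjk, mul_assoc]

theorem Fin.three_cases {i j k : Fin 3} (hij : i ≠ j) (hik : i ≠ k) (hjk : j ≠ k) (l : Fin 3) :
    l = i ∨ l = j ∨ l = k := by
  revert i j k l
  decide

theorem Fin.exists_three (i : Fin 3) : ∃ j k, i ≠ j ∧ i ≠ k ∧ j ≠ k := by
  revert i
  decide

theorem rootValue_of_eq {E : Fin 3 → AlgebraicClosure K} {X : AlgebraicClosure K} {i j k : Fin 3}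
    (hij : i ≠ j) (hik : i ≠ k) (hjk : j ≠ k) (h : X = E i) :
    rootValue E X i = (X - E j) * (X - E k) := by
  rw [rootValue, if_pos h]
  have : j = i + 1 ∧ k = i + 2 ∨ j = i + 2 ∧ k = i + 1 := by
    clear h
    revert i j k
    decide
  rcases this with ⟨rfl, rfl⟩ | ⟨rfl, rfl⟩
  · rfl
  · ring

theorem IsRootTriple.isGaloisTriple {F : K[X]} {e : Fin 3 → AlgebraicClosure K}
    (he : IsRootTriple F e) : IsGaloisTriple e where
  injective := he.injective
  exists_eq σ i := by
    obtain ⟨π, hπ⟩ := he.exists_perm σ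
    exact ⟨π i, hπ i⟩

/-- `rootValue` uses only the roots, so it makes sense for any Weierstrass equation and can be
transported along changes of variables. -/
theorem IsRootTriple.kummerValue_eq {F : K[X]} {e : Fin 3 → AlgebraicClosure K}
    (he : IsRootTriple F e) (X : AlgebraicClosure K) (i : Fin 3) :
    kummerValue F X (e i) = rootValue e X i := by
  by_cases h : X = e i
  · rw [h, kummerValue_self, rootValue, if_pos rfl, he.aeval_derivative]
    fin_cases i <;> simp [mul_comm]
  · rw [kummerValue_of_ne h, rootValue_of_ne h]

theorem IsGaloisTriple.affine {E : Fin 3 → AlgebraicClosure K} (hE : IsGaloisTriple E) {c r : K}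
    (hc : c ≠ 0) : IsGaloisTriple fun i => algebraMap K _ c * E i + algebraMap K _ r where
  injective i j hij := hE.injective (mul_left_cancel₀
    ((_root_.map_ne_zero (algebraMap K (AlgebraicClosure K))).2 hc) (add_right_cancel hij))
  exists_eq σ i := by
    obtain ⟨j, hj⟩ := hE.exists_eq σ i
    exact ⟨j, by rw [map_add, map_mul, hj, AlgEquiv.commutes, AlgEquiv.commutes]⟩

variable (p : ℕ) [Fact p.Prime] [Algebra ℚ_[p] K] [FiniteDimensional ℚ_[p] K]

/-- At each root `E i`, the valuation of `rootValue E X i` is the square of the valuation of an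
element of the field generated by the root. -/
def HasSquareValuation (E : Fin 3 → AlgebraicClosure K) (X : AlgebraicClosure K) : Prop :=
  ∃ γ : Fin 3 → AlgebraicClosure K,
    (∀ (σ : AlgebraicClosure K ≃ₐ[K] AlgebraicClosure K) (i j : Fin 3),
      σ (E i) = E j → σ (γ i) = γ j) ∧
    ∀ i, spectralValuation p K (rootValue E X i) = spectralValuation p K (γ i) ^ 2

variable {p}

theorem HasSquareValuation.affine {E : Fin 3 → AlgebraicClosure K} {x : K}
    (h : HasSquareValuation p E (algebraMap K _ x)) {u r : K} (hu : u ≠ 0) :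
    HasSquareValuation p (fun i => algebraMap K _ (u ^ 2) * E i + algebraMap K _ r)
      (algebraMap K _ (u ^ 2 * x + r)) := by
  classical
  obtain ⟨γ, hγ, hv⟩ := h
  have hu' : algebraMap K (AlgebraicClosure K) (u ^ 2) ≠ 0 :=
    (_root_.map_ne_zero _).2 (pow_ne_zero 2 hu)
  have hiff (i : Fin 3) : algebraMap K (AlgebraicClosure K) (u ^ 2 * x + r) =
      algebraMap K _ (u ^ 2) * E i + algebraMap K _ r ↔
      algebraMap K (AlgebraicClosure K) x = E i := by
    rw [map_add, map_mul, add_left_inj, mul_right_inj' hu']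
  -- A difference of abscissas scales by `u²`, so `γ` scales by `u`; the value at `x = E i` is a
  -- product of two differences, so there `γ` scales by `u²`.
  refine ⟨fun i => if algebraMap K (AlgebraicClosure K) x = E i then algebraMap K _ (u ^ 2) * γ i
    else algebraMap K _ u * γ i, fun σ i j hij => ?_, fun i => ?_⟩
  · have hij' : σ (E i) = E j := by
      rw [map_add, map_mul, AlgEquiv.commutes, AlgEquiv.commutes] at hij
      exact mul_left_cancel₀ hu' (add_right_cancel hij)
    have : algebraMap K (AlgebraicClosure K) x = E i ↔
        algebraMap K (AlgebraicClosure K) x = E j := by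
      rw [← hij', ← σ.injective.eq_iff, AlgEquiv.commutes]
    dsimp only
    by_cases h : algebraMap K (AlgebraicClosure K) x = E i
    · rw [if_pos h, if_pos (this.1 h), map_mul, hγ σ i j hij', AlgEquiv.commutes]
    · rw [if_neg h, if_neg (mt this.2 h), map_mul, hγ σ i j hij', AlgEquiv.commutes]
  · have := hv i
    rw [rootValue] at this ⊢
    by_cases h : algebraMap K (AlgebraicClosure K) x = E i
    · simp only [if_pos h] at this ⊢
      rw [if_pos ((hiff i).2 h), map_mul (spectralValuation p K) _ (γ i), mul_pow, ← this,
        ← map_pow, ← map_mul]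
      congr 1
      simp only [map_add, map_mul]
      ring
    · simp only [if_neg h] at this ⊢
      rw [if_neg (mt (hiff i).1 h), map_mul (spectralValuation p K) _ (γ i), mul_pow, ← this,
        ← map_pow, ← map_mul]
      congr 1
      simp only [map_add, map_mul, map_pow]
      ring

theorem IsRootTriple.mk_mem_of_hasSquareValuation [Algebra ℤ_[p] K] [IsScalarTower ℤ_[p] ℚ_[p] K]
    {F : K[X]} {e : Fin 3 → AlgebraicClosure K} (he : IsRootTriple F e) {x y : K}
    (h : ((cubicCurve F)⁄K).toAffine.Nonsingular x y)
    (hx : HasSquareValuation p e (algebraMap K _ x)) {c : SqClass (AdjoinRoot F)ˣ}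
    (hc : IsKummerClass F (.some x y h) c) : c ∈ unitSquareNormClassesIn p F := by
  have : CharZero K := charZero_of_injective_algebraMap (algebraMap ℚ_[p] K).injective
  obtain ⟨a, ha⟩ := he.exists_unit_kummerValue x
  rw [he.isKummerClass_unique hc (he.isKummerClass_some h ha)]
  obtain ⟨b, hb, -⟩ := he.exists_norm_eq_sq (he.equation_iff.1 h.1) ha
  obtain ⟨γ, hγ, hv⟩ := hx
  exact he.mk_mem_unitSquareNormClassesIn hb γ hγ fun i => by rw [ha, he.kummerValue_eq, hv]

variable {E : Fin 3 → AlgebraicClosure K} {X Y : AlgebraicClosure K}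

local notation "v" => spectralValuation p K

theorem spectralValuation_sub_eq {σ : AlgebraicClosure K ≃ₐ[K] AlgebraicClosure K} {i j : Fin 3}
    (hX : σ X = X) (h : σ (E i) = E j) : v (X - E j) = v (X - E i) := by
  rw [← spectralValuation_algEquiv p K σ (X - E i), map_sub σ, hX, h]

/-- The common valuation `m` satisfies `v Y ^ 2 = m ^ 3`, so `Y / (X - E i)` has valuation with
square `m`. No difference vanishes, since otherwise all would and the roots would coincide. -/
theorem hasSquareValuation_of_forall_eq (hE : IsGaloisTriple E)
    (hX : ∀ σ : AlgebraicClosure K ≃ₐ[K] AlgebraicClosure K, σ X = X)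
    (hY : ∀ σ : AlgebraicClosure K ≃ₐ[K] AlgebraicClosure K, σ Y = Y)
    (hXY : Y ^ 2 = ∏ i, (X - E i)) (h : ∀ i j, v (X - E i) = v (X - E j)) :
    HasSquareValuation p E X := by
  have hne : ∀ i, X - E i ≠ 0 := by
    intro i h0
    have h1 : ∀ j, E j = X := fun j => by
      have := h j i
      rw [h0, map_zero, Valuation.zero_iff, sub_eq_zero] at this
      exact this.symm
    exact absurd (hE.injective ((h1 0).trans (h1 1).symm)) (by decide)
  refine ⟨fun i => Y / (X - E i), fun σ i j hij => by rw [map_div₀, map_sub, hX, hY, hij],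
    fun i => ?_⟩
  have hv : v Y ^ 2 = v (X - E i) ^ 3 := by
    rw [← map_pow, hXY, map_prod, Finset.prod_congr rfl fun j _ => h j i, Finset.prod_const]
    rfl
  have hi : v (X - E i) ≠ 0 := (Valuation.ne_zero_iff _).2 (hne i)
  rw [rootValue_of_ne (sub_ne_zero.1 (hne i)), map_div₀, div_pow, hv, pow_succ, mul_comm,
    mul_div_cancel_right₀ _ (pow_ne_zero 2 hi)]

theorem hasSquareValuation_of_one_lt (hE : IsGaloisTriple E)
    (hX : ∀ σ : AlgebraicClosure K ≃ₐ[K] AlgebraicClosure K, σ X = X)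
    (hY : ∀ σ : AlgebraicClosure K ≃ₐ[K] AlgebraicClosure K, σ Y = Y)
    (hXY : Y ^ 2 = ∏ i, (X - E i)) (hEi : ∀ i, v (E i) ≤ 1) (h1 : 1 < v X) :
    HasSquareValuation p E X := by
  have h (i : Fin 3) : v (X - E i) = v X :=
    Valuation.map_sub_eq_of_lt_left _ ((hEi i).trans_lt h1)
  exact hasSquareValuation_of_forall_eq hE hX hY hXY fun i j => by rw [h, h]

theorem hasSquareValuation_of_forall_eq_one (h : ∀ i, v (X - E i) = 1) :
    HasSquareValuation p E X := by
  refine ⟨1, fun σ i j _ => map_one σ, fun i => ?_⟩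
  have : X ≠ E i := fun h0 => by
    have := h i
    rw [h0, sub_self, map_zero] at this
    exact zero_ne_one this
  rw [rootValue_of_ne this, h, Pi.one_apply, map_one, one_pow]

theorem eq_one_of_mul_eq_one {a b : ℝ≥0} (ha : a ≤ 1) (hb : b ≤ 1) (h : a * b = 1) : a = 1 := by
  refine le_antisymm ha ?_
  rw [← h]
  exact mul_le_of_le_one_right' hb

theorem hasSquareValuation_of_eq_one (hXY : Y ^ 2 = ∏ i, (X - E i)) (hEi : ∀ i, v (E i) ≤ 1)
    (h1 : v X ≤ 1) (h2 : v Y = 1) : HasSquareValuation p E X := by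
  have h (i : Fin 3) : v (X - E i) ≤ 1 := Valuation.map_sub_le _ h1 (hEi i)
  have h3 : ∏ i, v (X - E i) = 1 := by rw [← map_prod, ← hXY, map_pow, h2, one_pow]
  refine hasSquareValuation_of_forall_eq_one fun i => ?_
  rw [← Fin.three_comm (fun i => v (X - E i)) (i := i) (j := i + 1) (k := i + 2)
    (by revert i; decide) (by revert i; decide) (by revert i; decide), mul_assoc] at h3
  exact eq_one_of_mul_eq_one (h i) (mul_le_one' (h _) (h _)) h3

/-- A unit derivative leaves room for at most one nonunit difference `X - E i`. Its root is singled
out by the valuation, hence fixed by Galois, and the other two differences are units. -/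
theorem hasSquareValuation_of_derivative
    (hX : ∀ σ : AlgebraicClosure K ≃ₐ[K] AlgebraicClosure K, σ X = X)
    (hY : ∀ σ : AlgebraicClosure K ≃ₐ[K] AlgebraicClosure K, σ Y = Y)
    (hXY : Y ^ 2 = ∏ i, (X - E i)) (hEi : ∀ i, v (E i) ≤ 1) (h1 : v X ≤ 1)
    (h2 : v ((X - E 0) * (X - E 1) + (X - E 0) * (X - E 2) + (X - E 1) * (X - E 2)) = 1) :
    HasSquareValuation p E X := by
  classical
  have h (i : Fin 3) : v (X - E i) ≤ 1 := Valuation.map_sub_le _ h1 (hEi i)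
  by_cases hall : ∀ i, v (X - E i) = 1
  · exact hasSquareValuation_of_forall_eq_one hall
  push Not at hall
  obtain ⟨i, hi⟩ := hall
  have hi' := lt_of_le_of_ne (h i) hi
  obtain ⟨j, k, hij, hik, hjk⟩ : ∃ j k, i ≠ j ∧ i ≠ k ∧ j ≠ k :=
    Fin.exists_three i
  have h3 : v ((X - E j) * (X - E k)) = 1 := by
    have hsum : (X - E 0) * (X - E 1) + (X - E 0) * (X - E 2) + (X - E 1) * (X - E 2) =
        (X - E i) * ((X - E j) + (X - E k)) + (X - E j) * (X - E k) := by
      fin_cases i <;> fin_cases j <;> fin_cases k <;> simp at hij hik hjk ⊢ <;> ring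
    have hlt : v ((X - E i) * ((X - E j) + (X - E k))) < 1 := by
      rw [map_mul]
      exact mul_lt_one_of_lt_of_le hi' (Valuation.map_add_le _ (h j) (h k))
    rw [hsum] at h2
    by_contra hne
    have hlt' : v ((X - E j) * (X - E k)) < 1 :=
      lt_of_le_of_ne (by rw [map_mul]; exact mul_le_one' (h j) (h k)) hne
    exact absurd h2 (Valuation.map_add_lt _ hlt hlt').ne
  have hj : v (X - E j) = 1 := eq_one_of_mul_eq_one (h j) (h k) (by rw [← map_mul, h3])
  have hk : v (X - E k) = 1 := eq_one_of_mul_eq_one (h k) (h j) (by rw [← map_mul, mul_comm, h3])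
  have hne {l : Fin 3} (hl : v (X - E l) = 1) : X ≠ E l := fun h0 => by
    rw [h0, sub_self, map_zero] at hl
    exact zero_ne_one hl
  have hval (l : Fin 3) (hl : l ≠ i) : v (X - E l) = 1 := by
    rcases Fin.three_cases hij hik hjk l with rfl | rfl | rfl
    exacts [absurd rfl hl, hj, hk]
  -- At the exceptional root `v (X - E i) = v Y ^ 2`. If `Y = 0` then `X = E i`, and the value there
  -- is the product of the two unit differences, so `1` is used instead.
  refine ⟨fun l => if l = i ∧ Y ≠ 0 then Y else 1, fun σ l m hlm => ?_, fun l => ?_⟩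
  · have hiff : l = i ↔ m = i := by
      have h4 := spectralValuation_sub_eq (p := p) (hX σ) hlm
      constructor
      · rintro rfl
        by_contra hm
        exact hi (by rw [← h4, hval m hm])
      · rintro rfl
        by_contra hl
        exact hi (by rw [h4, hval l hl])
    dsimp only
    by_cases hl : l = i ∧ Y ≠ 0
    · rw [if_pos hl, if_pos ⟨hiff.1 hl.1, hl.2⟩, hY]
    · rw [if_neg hl, if_neg (fun h => hl ⟨hiff.2 h.1, h.2⟩), map_one]
  · dsimp only
    by_cases hl : l = i
    · subst hl
      by_cases hY0 : Y = 0
      · have hXl : X = E l := by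
          rw [hY0, zero_pow two_ne_zero, ← Fin.three_comm _ hij hik hjk] at hXY
          by_contra h0
          exact mul_ne_zero (mul_ne_zero (sub_ne_zero.2 h0) (sub_ne_zero.2 (hne hj)))
            (sub_ne_zero.2 (hne hk)) hXY.symm
        rw [if_neg (by simp [hY0]), rootValue_of_eq hij hik hjk hXl, h3, map_one, one_pow]
      · have hXl : X ≠ E l := by
          intro h0
          rw [← Fin.three_comm _ hij hik hjk, h0, sub_self, zero_mul, zero_mul] at hXY
          exact hY0 ((pow_eq_zero_iff two_ne_zero).1 hXY)
        rw [if_pos ⟨rfl, hY0⟩, rootValue_of_ne hXl, ← map_pow, hXY,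
          ← Fin.three_comm _ hij hik hjk, map_mul, map_mul, hj, hk, mul_one, mul_one]
    · rw [if_neg (fun h => hl h.1), rootValue_of_ne (hne (hval l hl)), hval l hl, map_one, one_pow]

/-- A root of a monic cubic with integral coefficients is integral. -/
theorem Valuation.le_one_of_cubic {R : Type*} [Field R] (w : Valuation R ℝ≥0) {x a b c : R}
    (ha : w a ≤ 1) (hb : w b ≤ 1) (hc : w c ≤ 1) (h : x ^ 3 + a * x ^ 2 + b * x + c = 0) :
    w x ≤ 1 := by
  by_contra! hx
  have h0 : 0 < w x := zero_lt_one.trans hx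
  have h1 : w (a * x ^ 2 + b * x + c) ≤ w x ^ 2 := by
    refine Valuation.map_add_le _ (Valuation.map_add_le _ ?_ ?_) (hc.trans (one_le_pow₀ hx.le))
    · rw [map_mul, map_pow]
      exact mul_le_of_le_one_left' ha
    · rw [map_mul, pow_two]
      exact mul_le_mul' (hb.trans hx.le) le_rfl
  have h2 : x ^ 3 = -(a * x ^ 2 + b * x + c) := by linear_combination h
  rw [← Valuation.map_neg, ← h2, map_pow] at h1
  exact absurd h1 (not_le.2 (pow_lt_pow_right₀ hx (by norm_num)))

end SquareValuation

/-! ### Good reduction in residue characteristic two -/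

section ValuationLemmas

open scoped NNReal

variable {L : Type*} [Field L] (w : Valuation L ℝ≥0)

theorem Valuation.eq_of_add_eq_zero {x y : L} (h : x + y = 0) : w x = w y := by
  rw [eq_neg_of_add_eq_zero_left h, Valuation.map_neg]

/-- The roots of `4 x³ + b₂ x² + 2 b₄ x + b₆` when `b₂ ≡ 0 mod 4`, `b₄ ≡ 0 mod 2` and `b₆` is a
unit. -/
theorem Valuation.root_of_supersingular (ht : w 2 < 1) {x b₂ b₄ b₆ : L} (hb₂ : w b₂ ≤ w 2 ^ 2)
    (hb₄ : w b₄ ≤ w 2) (hb₆ : w b₆ = 1)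
    (h : 4 * x ^ 3 + b₂ * x ^ 2 + 2 * b₄ * x + b₆ = 0) : w 2 ^ 2 * w x ^ 3 = 1 ∧ 1 < w x := by
  have h4 : w 4 = w 2 ^ 2 := by rw [← map_pow]; norm_num
  have ht2 : w 2 ^ 2 < 1 := pow_lt_one₀ zero_le ht two_ne_zero
  have hB2 : w (b₂ * x ^ 2) ≤ w 2 ^ 2 * w x ^ 2 := by
    rw [map_mul, map_pow]
    exact mul_le_mul' hb₂ le_rfl
  have hB4 : w (2 * b₄ * x) ≤ w 2 ^ 2 * w x := by
    rw [map_mul, map_mul, pow_two]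
    exact mul_le_mul' (mul_le_mul' le_rfl hb₄) le_rfl
  have hA : w (4 * x ^ 3) = w 2 ^ 2 * w x ^ 3 := by rw [map_mul, map_pow, h4]
  have h6 := w.eq_of_add_eq_zero h
  rw [hb₆] at h6
  -- For `w x ≤ 1` all terms other than the unit `b₆` would be small. Once `w x > 1`, the cubic term
  -- dominates the two middle ones and must balance `b₆`.
  have hx : 1 < w x := by
    by_contra! hx
    refine absurd h6 (ne_of_lt (Valuation.map_add_lt _ (Valuation.map_add_lt _ ?_ ?_) ?_))
    · rw [hA]
      exact (mul_le_of_le_one_right' (pow_le_one₀ zero_le hx)).trans_lt ht2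
    · exact hB2.trans_lt ((mul_le_of_le_one_right' (pow_le_one₀ zero_le hx)).trans_lt ht2)
    · exact hB4.trans_lt ((mul_le_of_le_one_right' hx).trans_lt ht2)
  refine ⟨?_, hx⟩
  have h0 : w 2 ^ 2 ≠ 0 := by
    intro h0
    rw [h0, zero_mul] at hA hB2 hB4
    refine absurd h6 (ne_of_lt (Valuation.map_add_lt _ (Valuation.map_add_lt _ ?_ ?_) ?_))
    · rw [hA]; exact one_pos
    · exact hB2.trans_lt one_pos
    · exact hB4.trans_lt one_pos
  have hlt : w 2 ^ 2 * w x ^ 2 < w 2 ^ 2 * w x ^ 3 :=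
    mul_lt_mul_of_pos_left (pow_lt_pow_right₀ hx (by norm_num)) (pos_iff_ne_zero.2 h0)
  have hle : w 2 ^ 2 * w x ≤ w 2 ^ 2 * w x ^ 2 := by
    refine mul_le_mul' le_rfl ?_
    rw [pow_two]
    exact le_mul_of_one_le_left' hx.le
  rw [add_assoc, Valuation.map_add_eq_of_lt_left, hA] at h6
  · exact h6
  · rw [hA]
    exact (Valuation.map_add_le _ hB2 (hB4.trans hle)).trans_lt hlt

/-- The roots of `4 x³ + b₂ x² + 4 a₄ x + 4 a₆` when `b₂` is a unit. -/
theorem Valuation.root_of_ordinary (ht : w 2 < 1) {x b₂ a₄ a₆ : L} (hb₂ : w b₂ = 1)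
    (ha₄ : w a₄ ≤ 1) (ha₆ : w a₆ ≤ 1)
    (h : 4 * x ^ 3 + b₂ * x ^ 2 + 4 * a₄ * x + 4 * a₆ = 0) : w x ≤ w 2 ∨ w 4 * w x = 1 := by
  have h4 : w 4 = w 2 ^ 2 := by rw [← map_pow]; norm_num
  by_contra! hc
  obtain ⟨h1, h2⟩ := hc
  have h3 : x ^ 2 * (4 * x + b₂) + 4 * (a₄ * x + a₆) = 0 := by linear_combination h
  have h5 := w.eq_of_add_eq_zero h3
  have h6 : 1 ≤ w (4 * x + b₂) := by
    rw [Valuation.map_add_of_distinct_val, hb₂]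
    · exact le_max_right _ _
    · rw [hb₂, map_mul]
      exact h2
  have h7 : w (4 * (a₄ * x + a₆)) ≤ w 2 ^ 2 * max (w x) 1 := by
    rw [map_mul, h4]
    refine mul_le_mul' le_rfl (Valuation.map_add_le _ (le_max_of_le_left ?_)
      (le_max_of_le_right ha₆))
    rw [map_mul]
    exact mul_le_of_le_one_left' ha₄
  have h8 : w 2 ^ 2 * max (w x) 1 < w x ^ 2 := by
    have h9 : w 2 ^ 2 < w x ^ 2 := pow_lt_pow_left₀ h1 zero_le two_ne_zero
    rcases le_total (w x) 1 with hx | hx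
    · rwa [max_eq_right hx, mul_one]
    · rw [max_eq_left hx]
      rw [pow_two (w x)]
      exact mul_lt_mul_of_pos_right ((pow_lt_one₀ zero_le ht two_ne_zero).trans_le hx)
        (zero_lt_one.trans_le hx)
  have h9 : w x ^ 2 ≤ w (x ^ 2 * (4 * x + b₂)) := by
    rw [map_mul, map_pow]
    exact le_mul_of_one_le_right' h6
  exact absurd (h9.trans (h5.le.trans h7)) (not_le.2 h8)

/-- The element whose valuation is the square root of that of `2` when the two small roots generate
a ramified quadratic extension. -/
theorem Valuation.sq_eq_two_of_ordinary (ht : w 2 < 1) (h2 : w 2 ≠ 0)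
    {a₁ a₂ a₄ a₆ b z s t d y : w.integer}
    (hb : b = a₁ ^ 2 + 4 * a₂)
    (ha₁ : w a₁ = 1) (hy : w y = 1) (hd : w d = 1) (hst : s - t = 2 * d)
    (h₄ : 2 * a₄ = -(b + 8 * (s + t)) * (s + t) + 8 * (s * t))
    (h₆ : a₆ = (b + 8 * (s + t)) * (s * t))
    (hyz : y ^ 2 = 8 * z ^ 3 + b * z ^ 2 + 2 * a₄ * z + a₆) :
    w ((b * (s + z) + 2 * a₄ + a₁ * y : w.integer) : L) ^ 2 = w 2 ∧
      w ((b * (t + z) + 2 * a₄ + a₁ * y : w.integer) : L) ^ 2 = w 2 := by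
  have hint (m : w.integer) : w m ≤ 1 := m.2
  have htwo (m : w.integer) : w ((2 * m : w.integer) : L) < 1 := by
    rw [Subring.coe_mul, map_mul]
    exact mul_lt_one_of_lt_of_le ht (hint m)
  have hunit (u m : w.integer) (hu : w u = 1) : w ((u + 2 * m : w.integer) : L) = 1 := by
    rw [Subring.coe_add, Valuation.map_add_eq_of_lt_left _ ((htwo m).trans_eq hu.symm), hu]
  have hwb : w b = 1 := by
    have := hunit (a₁ ^ 2) (2 * a₂) (by push_cast; rw [map_pow, ha₁, one_pow])
    rwa [show a₁ ^ 2 + 2 * (2 * a₂) = b by rw [hb]; ring] at this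
  have htwo0 : (2 : w.integer) ≠ 0 := fun h => h2 (by
    have := congrArg (Subtype.val : w.integer → L) h
    rw [show (2 : L) = ((2 : w.integer) : L) from rfl, this]
    exact map_zero w)
  -- Modulo `2` this is minus the square of the unit `b * d`. It comes from the discriminant of the
  -- two small roots, computed after multiplication by `4`.
  have hdisc : b * a₆ - a₄ ^ 2 = -(b * d) ^ 2 + 2 * (-4 * a₄ * (s * t - (s + t) ^ 2) +
      8 * (s * t - (s + t) ^ 2) ^ 2 + 4 * b * (s + t) * (s * t)) := by
    have h1 : (b * (2 * d)) ^ 2 = b ^ 2 * ((s + t) ^ 2 - 4 * (s * t)) := by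
      rw [← hst]; ring
    have h2 : b * (s + t) = -(2 * a₄) + 8 * (s * t - (s + t) ^ 2) := by linear_combination h₄
    have h3 : b * (s * t) = a₆ - 8 * (s + t) * (s * t) := by linear_combination -h₆
    have h4 : 4 * (b * a₆ - a₄ ^ 2) = 4 * (-(b * d) ^ 2 + 2 * (-4 * a₄ * (s * t - (s + t) ^ 2) +
        8 * (s * t - (s + t) ^ 2) ^ 2 + 4 * b * (s + t) * (s * t))) := by
      linear_combination h1 + (b * (s + t) - (2 * a₄) + 8 * (s * t - (s + t) ^ 2)) * h2 -
        4 * b * h3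
    have h5 : (4 : w.integer) ≠ 0 := by
      rw [show (4 : w.integer) = 2 * 2 by norm_num]
      exact mul_ne_zero htwo0 htwo0
    exact mul_left_cancel₀ h5 h4
  -- Multiplied by its conjugate `a₁ y - (b z + a₄)`, it becomes congruent to `b a₆ - a₄²` modulo
  -- `2`, a unit; both factors are integral.
  have hw1 : w ((a₁ * y + (b * z + a₄) : w.integer) : L) = 1 := by
    have h1 : (a₁ * y + (b * z + a₄)) * (a₁ * y - (b * z + a₄)) = -(b * d) ^ 2 +
        2 * (-4 * a₄ * (s * t - (s + t) ^ 2) + 8 * (s * t - (s + t) ^ 2) ^ 2 +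
        4 * b * (s + t) * (s * t) + 4 * b * z ^ 3 - 2 * a₂ * y ^ 2) := by
      linear_combination hdisc + b * hyz - y ^ 2 * hb
    have h2 := hunit (-(b * d) ^ 2) (-4 * a₄ * (s * t - (s + t) ^ 2) +
      8 * (s * t - (s + t) ^ 2) ^ 2 + 4 * b * (s + t) * (s * t) + 4 * b * z ^ 3 - 2 * a₂ * y ^ 2)
      (by push_cast; rw [Valuation.map_neg, map_pow, map_mul, hwb, hd, one_mul, one_pow])
    have h3 : w ((a₁ * y + (b * z + a₄) : w.integer) : L) *
        w ((a₁ * y - (b * z + a₄) : w.integer) : L) = 1 := by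
      rw [← map_mul, ← Subring.coe_mul, h1]
      exact h2
    exact eq_one_of_mul_eq_one (hint _) (hint _) h3
  set γ : w.integer := b * (s + z) + 2 * a₄ + a₁ * y with hγ
  set γ' : w.integer := b * (t + z) + 2 * a₄ + a₁ * y with hγ'
  have hprod : w γ * w γ' = w 2 := by
    set c := b * z + 2 * a₄ + a₁ * y with hc
    have h1 : γ * γ' = 2 * (a₁ * y * (a₁ * y + (b * z + a₄)) + 2 * (a₂ * y ^ 2 +
        2 * (c * (s * t - (s + t) ^ 2) - b * (s + t) * (s * t) - b * z ^ 3))) := by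
      have h2 : b * (s + t) = -(2 * a₄) + 8 * (s * t - (s + t) ^ 2) := by linear_combination h₄
      have h3 : b * (s * t) = a₆ - 8 * (s + t) * (s * t) := by linear_combination -h₆
      have h4 : γ * γ' = b * (b * (s * t)) + c * (b * (s + t)) + c ^ 2 := by
        rw [hγ, hγ', hc]; ring
      linear_combination h4 + b * h3 + c * h2 - b * hyz + y ^ 2 * hb + (c + b * z + a₁ * y) * hc
    have h5 := hunit (a₁ * y * (a₁ * y + (b * z + a₄))) (a₂ * y ^ 2 +
        2 * (c * (s * t - (s + t) ^ 2) - b * (s + t) * (s * t) - b * z ^ 3))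
      (by rw [Subring.coe_mul, Subring.coe_mul, map_mul, map_mul, ha₁, hy, one_mul, one_mul]
          exact hw1)
    rw [← map_mul, ← Subring.coe_mul, h1, Subring.coe_mul, map_mul]
    refine (mul_eq_left₀ (by exact h2)).2 h5
  have hdiff : w ((γ - γ' : w.integer) : L) = w 2 := by
    have h1 : γ - γ' = 2 * (b * d) := by
      rw [hγ, hγ']
      linear_combination b * hst
    rw [h1, Subring.coe_mul, Subring.coe_mul, map_mul, map_mul, hwb, hd, one_mul, mul_one]
    rfl
  -- The product and the difference of `γ` and `γ'` both have the valuation of `2`. If their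
  -- valuations differed, the larger would be `w 2`, and the product would be at most `w 2 ^ 2`, too
  -- small.
  have heq : w γ = w γ' := by
    by_contra hne
    have h1 : max (w γ) (w γ') = w 2 := by
      rw [← hdiff, show ((γ - γ' : w.integer) : L) = (γ : L) + -(γ' : L) from sub_eq_add_neg _ _,
        Valuation.map_add_of_distinct_val, Valuation.map_neg]
      rwa [Valuation.map_neg]
    have h2' : w γ * w γ' < w 2 := by
      calc w γ * w γ' ≤ w 2 * w 2 :=
            mul_le_mul' ((le_max_left _ _).trans_eq h1) ((le_max_right _ _).trans_eq h1)
        _ < w 2 * 1 := mul_lt_mul_of_pos_left ht (pos_iff_ne_zero.2 h2)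
        _ = w 2 := mul_one _
    exact h2'.ne hprod
  constructor
  · rw [pow_two]
    nth_rewrite 2 [heq]
    exact hprod
  · rw [pow_two]
    nth_rewrite 1 [← heq]
    exact hprod

/-- The same over the field, for the two small roots `2 s` and `2 t` of a cubic with large root
`e` and for the point with first coordinate `2 z`. -/
theorem Valuation.sq_eq_two_of_ordinary_field (ht : w 2 < 1) (h2 : w 2 ≠ 0)
    {a₁ a₂ a₄ a₆ z s t y e : L} (ha₁ : w a₁ = 1) (ha₂ : w a₂ ≤ 1) (ha₄ : w a₄ ≤ 1)
    (ha₆ : w a₆ ≤ 1) (hb : w (a₁ ^ 2 + 4 * a₂) ≤ 1) (hz : w z ≤ 1) (hs : w s ≤ 1) (ht' : w t ≤ 1)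
    (hy : w y = 1) (hst : w (s - t) = w 2)
    (h₂ : a₁ ^ 2 + 4 * a₂ = -4 * (e + 2 * s + 2 * t))
    (h₄ : e * (2 * s) + e * (2 * t) + 2 * s * (2 * t) = a₄)
    (h₆ : e * (2 * s) * (2 * t) = -a₆)
    (hyz : y ^ 2 = 8 * z ^ 3 + (a₁ ^ 2 + 4 * a₂) * z ^ 2 + 2 * a₄ * z + a₆) :
    w ((a₁ ^ 2 + 4 * a₂) * (s + z) + 2 * a₄ + a₁ * y) ^ 2 = w 2 ∧
      w ((a₁ ^ 2 + 4 * a₂) * (t + z) + 2 * a₄ + a₁ * y) ^ 2 = w 2 := by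
  obtain ⟨d, hd⟩ : ∃ d, s - t = 2 * d :=
    ⟨(s - t) / 2, (mul_div_cancel₀ _ ((Valuation.ne_zero_iff _).1 h2)).symm⟩
  have hvd : w d = 1 := by
    rw [hd, map_mul] at hst
    exact (mul_eq_left₀ h2).1 hst
  have h₂' : 4 * e = -((a₁ ^ 2 + 4 * a₂) + 8 * (s + t)) := by linear_combination h₂
  have h₄' : 2 * a₄ = -((a₁ ^ 2 + 4 * a₂) + 8 * (s + t)) * (s + t) + 8 * (s * t) := by
    rw [← h₂', ← h₄]
    ring
  have h₆' : a₆ = ((a₁ ^ 2 + 4 * a₂) + 8 * (s + t)) * (s * t) := by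
    linear_combination h₆ - s * t * h₂'
  exact Valuation.sq_eq_two_of_ordinary w ht h2 (a₁ := ⟨a₁, ha₁.le⟩) (a₂ := ⟨a₂, ha₂⟩)
    (a₄ := ⟨a₄, ha₄⟩) (a₆ := ⟨a₆, ha₆⟩) (b := ⟨a₁ ^ 2 + 4 * a₂, hb⟩) (z := ⟨z, hz⟩)
    (s := ⟨s, hs⟩) (t := ⟨t, ht'⟩) (d := ⟨d, hvd.le⟩) (y := ⟨y, hy.le⟩) rfl ha₁ hy hvd
    (Subtype.ext hd) (Subtype.ext h₄') (Subtype.ext h₆') (Subtype.ext hyz)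

end ValuationLemmas

/-! ### Supersingular and ordinary reduction over an unramified base -/

section ResidueCharTwo

open scoped NNReal

variable {K : Type*} [Field K] {p : ℕ} [Fact p.Prime] [Algebra ℚ_[p] K] [FiniteDimensional ℚ_[p] K]
  {E : Fin 3 → AlgebraicClosure K} {X Y : AlgebraicClosure K}

local notation "v" => spectralValuation p K

theorem algEquiv_apply_of_mem_bot {x : AlgebraicClosure K}
    (hx : x ∈ (⊥ : IntermediateField K (AlgebraicClosure K)))
    (σ : AlgebraicClosure K ≃ₐ[K] AlgebraicClosure K) : σ x = x := by
  obtain ⟨y, rfl⟩ := IntermediateField.mem_bot.1 hx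
  exact σ.commutes y

/-- All roots have valuation `(v 2)^(-2/3)`, strictly between `1` and `(v 2)^(-1)`. The condition on
`X` keeps `v X` outside this open interval, so either the roots dominate all differences or `X`
does. -/
theorem hasSquareValuation_supersingular (hE : IsGaloisTriple E)
    (hX : X ∈ (⊥ : IntermediateField K (AlgebraicClosure K)))
    (hY : Y ∈ (⊥ : IntermediateField K (AlgebraicClosure K))) (hXY : Y ^ 2 = ∏ i, (X - E i))
    (ht : v 2 < 1) (hXv : v X ≤ 1 ∨ 1 ≤ v 2 * v X) {b₂ b₄ b₆ : AlgebraicClosure K}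
    (hb₂ : v b₂ ≤ v 2 ^ 2) (hb₄ : v b₄ ≤ v 2) (hb₆ : v b₆ = 1)
    (hroot : ∀ i, 4 * E i ^ 3 + b₂ * E i ^ 2 + 2 * b₄ * E i + b₆ = 0) :
    HasSquareValuation p E X := by
  have h (i : Fin 3) := Valuation.root_of_supersingular v ht hb₂ hb₄ hb₆ (hroot i)
  have h20 : v 2 ≠ 0 := fun h0 => by
    have := (h 0).1
    rw [h0, zero_pow two_ne_zero, zero_mul] at this
    exact zero_ne_one this
  have heq (i j : Fin 3) : v (E i) = v (E j) := by
    have := (h i).1.trans (h j).1.symm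
    exact pow_left_injective three_ne_zero
      (mul_left_cancel₀ (pow_ne_zero 2 h20) this)
  refine hasSquareValuation_of_forall_eq hE (algEquiv_apply_of_mem_bot hX)
    (algEquiv_apply_of_mem_bot hY) hXY ?_
  rcases hXv with hXv | hXv
  · have h1 (i : Fin 3) : v (X - E i) = v (E i) :=
      Valuation.map_sub_eq_of_lt_right _ (hXv.trans_lt (h i).2)
    exact fun i j => by rw [h1, h1, heq]
  · have hlt (i : Fin 3) : v (E i) < v X := by
      have h2 : v 2 * v (E i) < 1 := by
        by_contra! h2
        have h3 : (1 : ℝ≥0) < v 2 ^ 2 * v (E i) ^ 3 := by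
          calc (1 : ℝ≥0) < v (E i) := (h i).2
            _ ≤ (v 2 * v (E i)) ^ 2 * v (E i) := le_mul_of_one_le_left' (one_le_pow₀ h2)
            _ = v 2 ^ 2 * v (E i) ^ 3 := by ring
        exact h3.ne (h i).1.symm
      exact lt_of_mul_lt_mul_left (h2.trans_le hXv) zero_le
    have h1 (i : Fin 3) : v (X - E i) = v X := Valuation.map_sub_eq_of_lt_left _ (hlt i)
    exact fun i j => by rw [h1, h1]

/-- The location of the roots of a cubic with `E 0 + E 1 + E 2 = -b₂ / 4` and integral remaining
elementary symmetric functions, when `b₂` is a unit. -/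
theorem exists_large_root_of_ordinary (ht : v 2 < 1) {b₂ a₄ a₆ : AlgebraicClosure K}
    (hb₂ : v b₂ = 1) (ha₄ : v a₄ ≤ 1) (ha₆ : v a₆ ≤ 1)
    (h₂ : 4 * (E 0 + E 1 + E 2) = -b₂) (h₄ : E 0 * E 1 + E 0 * E 2 + E 1 * E 2 = a₄)
    (h₆ : E 0 * E 1 * E 2 = -a₆) :
    ∃ i j k, i ≠ j ∧ i ≠ k ∧ j ≠ k ∧ v 4 * v (E i) = 1 ∧ v (E j) ≤ v 2 ∧ v (E k) ≤ v 2 := by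
  have h4 : v 4 = v 2 ^ 2 := by rw [← map_pow]; norm_num
  have h41 : v 4 < 1 := by rw [h4]; exact pow_lt_one₀ zero_le ht two_ne_zero
  have hroot (i : Fin 3) : v (E i) ≤ v 2 ∨ v 4 * v (E i) = 1 := by
    refine Valuation.root_of_ordinary v ht hb₂ ha₄ ha₆ ?_
    have h0 : (E i - E 0) * (E i - E 1) * (E i - E 2) = 0 := by
      fin_cases i <;> simp
    linear_combination 4 * h0 + E i ^ 2 * h₂ - 4 * E i * h₄ + 4 * h₆
  have hsum : ∃ i, v 4 * v (E i) = 1 := by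
    by_contra! hall
    have h1 (i : Fin 3) : v (E i) ≤ v 2 := (hroot i).resolve_right (hall i)
    have h3 : v (4 * (E 0 + E 1 + E 2)) < 1 := by
      rw [map_mul]
      exact mul_lt_one_of_lt_of_le h41
        ((Valuation.map_add_le _ (Valuation.map_add_le _ (h1 0) (h1 1)) (h1 2)).trans ht.le)
    rw [h₂, Valuation.map_neg, hb₂] at h3
    exact lt_irrefl _ h3
  obtain ⟨i, hi⟩ := hsum
  -- A second large root would make `E i * E j` of valuation `v 16⁻¹`. A small third root then
  -- contradicts the integrality of `a₄`, a large one that of `a₆`.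
  have key (j k : Fin 3) (hij : i ≠ j) (hik : i ≠ k) (hjk : j ≠ k) : v (E j) ≤ v 2 := by
    refine (hroot j).resolve_right fun hj => ?_
    have hs : E i * E j + E k * (E i + E j) = a₄ := by
      rw [← h₄]
      fin_cases i <;> fin_cases j <;> fin_cases k <;> simp at hij hik hjk ⊢ <;> ring
    have hp : E i * E j * E k = -a₆ := by
      rw [← h₆, Fin.three_comm _ hij hik hjk, Fin.prod_univ_three]
    have hij' : v (4 * 4 * (E i * E j)) = 1 := by
      rw [map_mul, map_mul, map_mul, mul_mul_mul_comm, hi, hj, one_mul]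
    rcases hroot k with hk | hk
    · have h1 : 4 * 4 * (E i * E j) = 4 * (4 * a₄) - 4 * (E k * (4 * E i + 4 * E j)) := by
        linear_combination 4 * 4 * hs
      have h2 : v (4 * (4 * a₄) - 4 * (E k * (4 * E i + 4 * E j))) < 1 := by
        refine (Valuation.map_sub _ _ _).trans_lt (max_lt ?_ ?_)
        · rw [map_mul, map_mul]
          exact mul_lt_one_of_lt_of_le h41 (mul_le_one' h41.le ha₄)
        · rw [map_mul, map_mul]
          refine mul_lt_one_of_lt_of_le h41 (mul_le_one' (hk.trans ht.le)
            (Valuation.map_add_le _ ?_ ?_))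
          · rw [map_mul, hi]
          · rw [map_mul, hj]
      rw [← h1, hij'] at h2
      exact lt_irrefl _ h2
    · have h1 : v (4 * (4 * (4 * (E i * E j * E k)))) = 1 := by
        rw [map_mul, map_mul, map_mul, map_mul, map_mul]
        calc _ = (v 4 * v (E i)) * (v 4 * v (E j)) * (v 4 * v (E k)) := by ring
          _ = 1 := by rw [hi, hj, hk, one_mul, one_mul]
      have h2 : v (4 * (4 * (4 * (E i * E j * E k)))) < 1 := by
        rw [hp, map_mul, map_mul, map_mul, Valuation.map_neg]
        exact mul_lt_one_of_lt_of_le h41 (mul_le_one' h41.le (mul_le_one' h41.le ha₆))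
      rw [h1] at h2
      exact lt_irrefl _ h2
  obtain ⟨j, k, hij, hik, hjk⟩ := Fin.exists_three i
  exact ⟨i, j, k, hij, hik, hjk, hi, key j k hij hik hjk, key k j hik hij hjk.symm⟩

-- A root fixed by Galois allows a rational choice of `γ` there, independent of the equivariant
-- choice at the other two roots.
open scoped Classical in
theorem hasSquareValuation_of_stable {i : Fin 3} {α : AlgebraicClosure K}
    {g : Fin 3 → AlgebraicClosure K}
    (hi : ∀ (σ : AlgebraicClosure K ≃ₐ[K] AlgebraicClosure K) (l m : Fin 3), σ (E l) = E m →
      (l = i ↔ m = i))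
    (hα : α ∈ (⊥ : IntermediateField K (AlgebraicClosure K)))
    (hg : ∀ (σ : AlgebraicClosure K ≃ₐ[K] AlgebraicClosure K) (l m : Fin 3), σ (E l) = E m →
      l ≠ i → m ≠ i → σ (g l) = g m)
    (hvi : v (rootValue E X i) = v α ^ 2) (hv : ∀ l, l ≠ i → v (rootValue E X l) = v (g l) ^ 2) :
    HasSquareValuation p E X := by
  refine ⟨fun l => if l = i then α else g l, fun σ l m hlm => ?_, fun l => ?_⟩
  · dsimp only
    by_cases hl : l = i
    · rw [if_pos hl, if_pos ((hi σ l m hlm).1 hl), algEquiv_apply_of_mem_bot hα]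
    · have hm := mt (hi σ l m hlm).2 hl
      rw [if_neg hl, if_neg hm, hg σ l m hlm hl hm]
  · dsimp only
    by_cases hl : l = i
    · rw [if_pos hl, hl, hvi]
    · rw [if_neg hl, hv l hl]

-- The large root `E i` is fixed by Galois, since its valuation differs from the others. For
-- integral `X` its difference has the valuation of `1/4`, so `γ i = 1/2`; the work lies in the two
-- small roots, which may be conjugate.
set_option maxHeartbeats 1000000 in
theorem hasSquareValuation_ordinary (ht : v 2 < 1) (h20 : v 2 ≠ 0)
    (hun : ∀ z ∈ (⊥ : IntermediateField K (AlgebraicClosure K)), v z < 1 → v z ≤ v 2)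
    {y a₁ a₂ a₄ a₆ : AlgebraicClosure K}
    (hX : X ∈ (⊥ : IntermediateField K (AlgebraicClosure K)))
    (hy : y ∈ (⊥ : IntermediateField K (AlgebraicClosure K)))
    (ha₁ : a₁ ∈ (⊥ : IntermediateField K (AlgebraicClosure K)))
    (ha₂ : a₂ ∈ (⊥ : IntermediateField K (AlgebraicClosure K)))
    (ha₄ : a₄ ∈ (⊥ : IntermediateField K (AlgebraicClosure K)))
    (hva₁ : v a₁ = 1) (hva₂ : v a₂ ≤ 1) (hva₄ : v a₄ ≤ 1) (hva₆ : v a₆ ≤ 1)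
    (heq : y ^ 2 + a₁ * X * y = X ^ 3 + a₂ * X ^ 2 + a₄ * X + a₆)
    (h₂ : 4 * (E 0 + E 1 + E 2) = -(a₁ ^ 2 + 4 * a₂))
    (h₄ : E 0 * E 1 + E 0 * E 2 + E 1 * E 2 = a₄) (h₆ : E 0 * E 1 * E 2 = -a₆)
    (hΔ : v (16 * ((E 0 - E 1) * (E 0 - E 2) * (E 1 - E 2)) ^ 2) = 1) :
    HasSquareValuation p E X := by
  have h4 : v 4 = v 2 ^ 2 := by rw [← map_pow]; norm_num
  have h41 : v 4 < 1 := by rw [h4]; exact pow_lt_one₀ zero_le ht two_ne_zero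
  have h40 : v 4 ≠ 0 := by rw [h4]; exact pow_ne_zero 2 h20
  have h2ne : (2 : AlgebraicClosure K) ≠ 0 := (Valuation.ne_zero_iff _).1 h20
  have hb₂ : v (a₁ ^ 2 + 4 * a₂) = 1 := by
    have h1 : v (a₁ ^ 2) = 1 := by rw [map_pow, hva₁, one_pow]
    rw [Valuation.map_add_eq_of_lt_left, h1]
    rw [h1, map_mul]
    exact mul_lt_one_of_lt_of_le h41 hva₂
  obtain ⟨i, j, k, hij, hik, hjk, hi, hj, hk⟩ :=
    exists_large_root_of_ordinary ht hb₂ hva₄ hva₆ h₂ h₄ h₆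
  have hEi1 : 1 < v (E i) := by
    by_contra! h
    exact absurd hi (mul_lt_one_of_lt_of_le h41 h).ne
  have hsmall (l : Fin 3) (hl : l ≠ i) : v (E l) ≤ v 2 := by
    rcases Fin.three_cases hij hik hjk l with rfl | rfl | rfl
    exacts [absurd rfl hl, hj, hk]
  have hne_i (l : Fin 3) (hl : l ≠ i) : v (E l) < 1 := (hsmall l hl).trans_lt ht
  have hsum : E i + E j + E k = E 0 + E 1 + E 2 := by
    fin_cases i <;> fin_cases j <;> fin_cases k <;> simp at hij hik hjk ⊢ <;> ring
  have hpair : E i * E j + E i * E k + E j * E k = a₄ := by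
    rw [← h₄]
    fin_cases i <;> fin_cases j <;> fin_cases k <;> simp at hij hik hjk ⊢ <;> ring
  have hprod : E i * E j * E k = -a₆ := by
    rw [← h₆, Fin.three_comm _ hij hik hjk, Fin.prod_univ_three]
  have hdisc : ((E 0 - E 1) * (E 0 - E 2) * (E 1 - E 2)) ^ 2 =
      ((E i - E j) * (E i - E k) * (E j - E k)) ^ 2 := by
    clear hsum hpair hprod
    fin_cases i <;> fin_cases j <;> fin_cases k <;> simp at hij hik hjk ⊢ <;> ring
  have hb₂' : a₁ ^ 2 + 4 * a₂ = -4 * (E i + E j + E k) := by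
    linear_combination h₂ + 4 * hsum
  -- The discriminant is a unit and the two differences with the large root have the valuation of
  -- `1/4`.
  have hjk4 : v (E j - E k) = v 4 := by
    have h1 : v (E i - E j) = v (E i) :=
      Valuation.map_sub_eq_of_lt_left _ ((hne_i j hij.symm).trans hEi1)
    have h2 : v (E i - E k) = v (E i) :=
      Valuation.map_sub_eq_of_lt_left _ ((hne_i k hik.symm).trans hEi1)
    rw [hdisc, show (16 : AlgebraicClosure K) = 4 ^ 2 by norm_num, map_mul, map_pow, map_pow,
      map_mul, map_mul, h1, h2] at hΔ
    have h3 : v (E j - E k) ^ 2 = v 4 ^ 2 := by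
      calc v (E j - E k) ^ 2 = (v 4 * v (E i)) ^ 4 * v (E j - E k) ^ 2 := by
            rw [hi, one_pow, one_mul]
        _ = v 4 ^ 2 * (v 4 ^ 2 * (v (E i) * v (E i) * v (E j - E k)) ^ 2) := by ring
        _ = v 4 ^ 2 := by rw [hΔ, mul_one]
    exact pow_left_injective two_ne_zero h3
  have hstab (σ : AlgebraicClosure K ≃ₐ[K] AlgebraicClosure K) (l m : Fin 3) (h : σ (E l) = E m) :
      l = i ↔ m = i := by
    have h1 : v (E m) = v (E l) := by rw [← h, spectralValuation_algEquiv]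
    constructor
    · rintro rfl
      by_contra hm
      exact absurd (h1 ▸ hne_i m hm) (not_lt.2 hEi1.le)
    · rintro rfl
      by_contra hl
      exact absurd (h1 ▸ hne_i l hl) (not_lt.2 hEi1.le)
  have hcurve : (2 * y + a₁ * X) ^ 2 = 4 * ((X - E i) * (X - E j) * (X - E k)) := by
    linear_combination 4 * heq + X ^ 2 * hb₂' - 4 * X * hpair + 4 * hprod
  have htwo : (2 : AlgebraicClosure K) ∈ (⊥ : IntermediateField K (AlgebraicClosure K)) :=
    ofNat_mem _ 2
  have hone : v (1 : AlgebraicClosure K) ^ 2 = 1 := by rw [map_one, one_pow]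
  rcases lt_or_ge 1 (v X) with hX1 | hX1
  · have hX0 : v X ≠ 0 := (zero_lt_one.trans hX1).ne'
    have hXl (l : Fin 3) (hl : l ≠ i) : v (X - E l) = v X :=
      Valuation.map_sub_eq_of_lt_left _ ((hne_i l hl).trans hX1)
    have hXne (l : Fin 3) (hl : l ≠ i) : X ≠ E l := fun h => hX0 (by
      rw [← hXl l hl, h, sub_self, map_zero])
    -- For `v X > 1` the terms `y²` and `X³` dominate the equation, so `y / X` serves at the small
    -- roots. At the large root `γ` is `X` or `(2y + a₁X)/(2X)`, according as `X = E i` or not.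
    have hyX : v y ^ 2 = v X ^ 3 := by
      have hle : v (a₂ * X ^ 2 + a₄ * X + a₆) ≤ v X ^ 2 := by
        refine Valuation.map_add_le _ (Valuation.map_add_le _ ?_ ?_)
          (hva₆.trans (one_le_pow₀ hX1.le))
        · rw [map_mul, map_pow]
          exact mul_le_of_le_one_left' hva₂
        · rw [map_mul, pow_two]
          exact mul_le_mul' (hva₄.trans hX1.le) le_rfl
      have hlt : v X ^ 2 < v X ^ 3 := pow_lt_pow_right₀ hX1 (by norm_num)
      have hR : v (y ^ 2 + a₁ * X * y) = v X ^ 3 := by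
        rw [heq, add_assoc, add_assoc, Valuation.map_add_eq_of_lt_left, map_pow]
        rw [map_pow, ← add_assoc]
        exact hle.trans_lt hlt
      have hyX' : v X < v y := by
        by_contra! h
        refine absurd hR (ne_of_lt (lt_of_le_of_lt (Valuation.map_add_le _ ?_ ?_) hlt))
        · rw [map_pow]
          exact pow_le_pow_left₀ zero_le h 2
        · rw [map_mul, map_mul, hva₁, one_mul, pow_two]
          exact mul_le_mul' le_rfl h
      rw [Valuation.map_add_eq_of_lt_left, map_pow] at hR
      · exact hR
      · rw [map_mul, map_mul, hva₁, one_mul, map_pow, pow_two]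
        exact mul_lt_mul_of_pos_right hyX' ((zero_lt_one.trans hX1).trans hyX')
    have hg (l : Fin 3) (hl : l ≠ i) : v (rootValue E X l) = v (y / X) ^ 2 := by
      rw [rootValue_of_ne (hXne l hl), hXl l hl, map_div₀, div_pow, hyX, pow_succ (v X) 2, mul_comm,
        mul_div_cancel_right₀ _ (pow_ne_zero 2 hX0)]
    have hgσ (σ : AlgebraicClosure K ≃ₐ[K] AlgebraicClosure K) : σ (y / X) = y / X :=
      algEquiv_apply_of_mem_bot (div_mem hy hX) σ
    by_cases hXi : X = E i
    · refine hasSquareValuation_of_stable (g := fun _ => y / X) hstab hX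
        (fun σ l m _ _ _ => hgσ σ) ?_ hg
      rw [rootValue_of_eq hij hik hjk hXi, map_mul, hXl j hij.symm, hXl k hik.symm, pow_two]
    · refine hasSquareValuation_of_stable (α := (2 * y + a₁ * X) / (2 * X)) (g := fun _ => y / X)
        hstab (div_mem (add_mem (mul_mem htwo hy) (mul_mem ha₁ hX)) (mul_mem htwo hX))
        (fun σ l m _ _ _ => hgσ σ) ?_ hg
      rw [rootValue_of_ne hXi, map_div₀, div_pow, ← map_pow, hcurve, map_mul, map_mul, map_mul,
        hXl j hij.symm, hXl k hik.symm, map_mul, mul_pow, ← h4, eq_div_iff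
        (mul_ne_zero h40 (pow_ne_zero 2 hX0))]
      ring
  have hXi : v (X - E i) = v (2⁻¹ : AlgebraicClosure K) ^ 2 := by
    rw [Valuation.map_sub_eq_of_lt_right _ (hX1.trans_lt hEi1), map_inv₀, inv_pow, ← h4]
    exact eq_inv_of_mul_eq_one_right hi
  have hXi0 : X ≠ E i := fun h => by
    rw [h] at hX1
    exact absurd hX1 (not_le.2 hEi1)
  rw [← rootValue_of_ne hXi0] at hXi
  have hhalf : (2⁻¹ : AlgebraicClosure K) ∈ (⊥ : IntermediateField K (AlgebraicClosure K)) :=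
    inv_mem htwo
  rcases hX1.lt_or_eq with hX1 | hX1
  swap
  · refine hasSquareValuation_of_stable (g := fun _ => 1) hstab hhalf
      (fun σ l m _ _ _ => map_one σ) hXi fun l hl => ?_
    have h1 : v (X - E l) = 1 := by
      rw [Valuation.map_sub_eq_of_lt_left _ ((hne_i l hl).trans_eq hX1.symm), hX1]
    rw [rootValue_of_ne, h1, hone]
    intro h
    rw [h, sub_self, map_zero] at h1
    exact zero_ne_one h1
  -- As `K` is unramified, a nonunit of `K` is divisible by `2`; abscissa and small roots become
  -- `2z`, `2s`, `2t`.
  have hX2 : v X ≤ v 2 := hun X hX hX1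
  have hdiv (x : AlgebraicClosure K) (hx : v x ≤ v 2) : ∃ z, x = 2 * z ∧ v z ≤ 1 := by
    refine ⟨x / 2, (mul_div_cancel₀ x h2ne).symm, ?_⟩
    rw [map_div₀]
    exact div_le_one_of_le₀ hx zero_le
  obtain ⟨z, hXz, hz⟩ := hdiv X hX2
  have hzbot : z ∈ (⊥ : IntermediateField K (AlgebraicClosure K)) := by
    have : z = X / 2 := by rw [hXz, mul_div_cancel_left₀ _ h2ne]
    rw [this]
    exact div_mem hX htwo
  obtain ⟨s, hs, hvs⟩ := hdiv _ hj
  obtain ⟨t, ht', hvt⟩ := hdiv _ hk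
  have hst : v (s - t) = v 2 := by
    rw [hs, ht', ← mul_sub, map_mul, h4, pow_two] at hjk4
    exact mul_left_cancel₀ h20 hjk4
  set η := y + a₁ * z with hη
  have hηbot : η ∈ (⊥ : IntermediateField K (AlgebraicClosure K)) :=
    add_mem hy (mul_mem ha₁ hzbot)
  have hXs : v (X - E j) = v 2 * v (z - s) := by rw [hXz, hs, ← mul_sub, map_mul]
  have hXt : v (X - E k) = v 2 * v (z - t) := by rw [hXz, ht', ← mul_sub, map_mul]
  -- In these coordinates `η² = (X - E i)(X - E j)(X - E k)`, and the large factor cancels the two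
  -- factors `2`.
  have hηv : v η ^ 2 = v (z - s) * v (z - t) := by
    have h1 : η ^ 2 = (X - E i) * (X - E j) * (X - E k) := by
      have h2 : 4 * η ^ 2 = 4 * ((X - E i) * (X - E j) * (X - E k)) := by
        rw [← hcurve, hη, hXz]
        ring
      exact mul_left_cancel₀ (by rw [show (4 : AlgebraicClosure K) = 2 * 2 by norm_num]
                                 exact mul_ne_zero h2ne h2ne) h2
    rw [← map_pow, h1, map_mul, map_mul, ← rootValue_of_ne hXi0, hXi, map_inv₀, hXs, hXt, inv_pow,
      inv_mul_eq_div, div_mul_eq_mul_div, div_eq_iff (pow_ne_zero 2 h20)]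
    ring
  have hstz : v (s - t) ≤ max (v (z - s)) (v (z - t)) := by
    have h1 : s - t = (z - t) - (z - s) := by ring
    rw [h1, max_comm]
    exact Valuation.map_sub _ _ _
  -- If `z` is closer to `s`, then `v (z - t) = v (s - t) = v 2` and the two roots are not
  -- conjugate. So `2` works at `E k` and `η` at `E j`; if `X = E j`, the value there is a unit and
  -- `1` works.
  have key (j k : Fin 3) (s t : AlgebraicClosure K) (hij : i ≠ j) (hik : i ≠ k) (hjk : j ≠ k)
      (hXs : v (X - E j) = v 2 * v (z - s)) (hXt : v (X - E k) = v 2 * v (z - t))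
      (hst : v (s - t) = v 2) (hηv : v η ^ 2 = v (z - s) * v (z - t))
      (hlt : v (z - s) < v (z - t)) : HasSquareValuation p E X := by
    classical
    have h1 : v (z - t) = v 2 := by
      rw [← hst, show s - t = (z - t) - (z - s) by ring, Valuation.map_sub_eq_of_lt_left _ hlt]
    have hcases (l : Fin 3) (hl : l ≠ i) : l = j ∨ l = k :=
      (Fin.three_cases hij hik hjk l).resolve_left hl
    have hlt' : v (X - E j) < v (X - E k) := by
      rw [hXs, hXt]
      exact mul_lt_mul_of_pos_left hlt (pos_iff_ne_zero.2 h20)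
    refine hasSquareValuation_of_stable
      (g := fun l => if l = j then (if X = E j then 1 else η) else 2) hstab hhalf
      (fun σ l m hlm hl hm => ?_) hXi fun l hl => ?_
    · have h2 := spectralValuation_sub_eq (p := p) (algEquiv_apply_of_mem_bot hX σ) hlm
      have h3 : l = j ↔ m = j := by
        rcases hcases l hl with rfl | rfl <;> rcases hcases m hm with rfl | rfl
        · tauto
        · exact absurd h2 hlt'.ne'
        · exact absurd h2 hlt'.ne
        · tauto
      by_cases hlj : l = j
      · rw [if_pos hlj, if_pos (h3.1 hlj)]
        split_ifs
        · exact map_one σ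
        · exact algEquiv_apply_of_mem_bot hηbot σ
      · rw [if_neg hlj, if_neg (mt h3.2 hlj), map_ofNat]
    · rcases hcases l hl with rfl | rfl
      · rw [if_pos rfl]
        by_cases hXl : X = E l
        · rw [if_pos hXl, rootValue_of_eq hij.symm hjk hik hXl, map_mul, ← rootValue_of_ne hXi0,
            hXi, hXt, h1, hone, map_inv₀, ← pow_two, ← mul_pow, inv_mul_cancel₀ h20, one_pow]
        · rw [if_neg hXl, rootValue_of_ne hXl, hXs, hηv, h1, mul_comm]
      · rw [if_neg hjk.symm, rootValue_of_ne, hXt, h1, pow_two]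
        intro h
        rw [h, sub_self, map_zero] at hlt'
        exact not_lt_zero hlt'
  rcases lt_trichotomy (v (z - s)) (v (z - t)) with hlt | hzz | hlt
  · exact key j k s t hij hik hjk hXs hXt hst hηv hlt
  swap
  · exact key k j t s hik hij hjk.symm hXt hXs (by rw [Valuation.map_sub_swap, hst])
      (by rw [hηv, mul_comm]) hlt
  rw [hzz, max_self, hst] at hstz
  have hηt : v η = v (z - t) := by
    rw [hzz, ← pow_two] at hηv
    exact pow_left_injective two_ne_zero hηv
  have hXl (l : Fin 3) (hl : l ≠ i) : v (X - E l) = v 2 * v (z - t) := by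
    rcases Fin.three_cases hij hik hjk l with rfl | rfl | rfl
    exacts [absurd rfl hl, by rw [hXs, hzz], hXt]
  have hXl0 (l : Fin 3) (hl : l ≠ i) : X ≠ E l := by
    intro h
    have h1 := hXl l hl
    rw [h, sub_self, map_zero] at h1
    exact mul_ne_zero h20 (fun h0 => h20 (le_zero_iff.1 (hstz.trans_eq h0))) h1.symm
  -- Now `v η = v (z - t)` lies between `v 2` and `1`, and `η` is rational, so it is one of these
  -- two ends. At `v 2` the choice `γ = 2` works.
  rcases (Valuation.map_sub_le _ hz hvt : v (z - t) ≤ 1).lt_or_eq with hlt | hone'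
  · have h1 : v (z - t) = v 2 := le_antisymm (by rw [← hηt] at hlt ⊢; exact hun η hηbot hlt) hstz
    refine hasSquareValuation_of_stable (g := fun _ => 2) hstab hhalf
      (fun σ l m _ _ _ => map_ofNat σ 2) hXi fun l hl => ?_
    rw [rootValue_of_ne (hXl0 l hl), hXl l hl, h1, pow_two]
  · have hηone : v η = 1 := hηt.trans hone'
    have hηz : η ^ 2 = 8 * z ^ 3 + (a₁ ^ 2 + 4 * a₂) * z ^ 2 + 2 * a₄ * z + a₆ := by
      rw [hXz] at heq
      rw [hη]
      linear_combination heq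
    -- The small differences have the valuation of `2`. The required element is a rational
    -- polynomial in the root itself, which makes the family equivariant.
    have hram := Valuation.sq_eq_two_of_ordinary_field v ht h20 hva₁ hva₂ hva₄ hva₆ hb₂.le hz hvs
      hvt hηone hst (e := E i) (by rw [hb₂', hs, ht', add_assoc]) (by rw [← hpair, hs, ht'])
      (by rw [← hprod, hs, ht']) hηz
    have hbbot : a₁ ^ 2 + 4 * a₂ ∈ (⊥ : IntermediateField K (AlgebraicClosure K)) :=
      add_mem (pow_mem ha₁ 2) (mul_mem (ofNat_mem _ 4) ha₂)
    refine hasSquareValuation_of_stable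
      (g := fun l => (a₁ ^ 2 + 4 * a₂) * (E l / 2 + z) + 2 * a₄ + a₁ * η) hstab hhalf
      (fun σ l m hlm _ _ => ?_) hXi fun l hl => ?_
    · have hmul : σ ((a₁ ^ 2 + 4 * a₂) * (E l / 2 + z)) = (a₁ ^ 2 + 4 * a₂) * (E m / 2 + z) := by
        rw [map_mul, algEquiv_apply_of_mem_bot hbbot, map_add, map_div₀, hlm,
          algEquiv_apply_of_mem_bot hzbot, algEquiv_apply_of_mem_bot htwo]
      rw [map_add, map_add, hmul, algEquiv_apply_of_mem_bot (mul_mem htwo ha₄),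
        algEquiv_apply_of_mem_bot (mul_mem ha₁ hηbot)]
    · rw [rootValue_of_ne (hXl0 l hl), hXl l hl, hone', mul_one]
      rcases Fin.three_cases hij hik hjk l with rfl | rfl | rfl
      · exact absurd rfl hl
      · rw [hs, mul_div_cancel_left₀ _ h2ne]
        exact hram.1.symm
      · rw [ht', mul_div_cancel_left₀ _ h2ne]
        exact hram.2.symm

end ResidueCharTwo

/-! ### The maximal order -/

section MaximalOrder

open scoped NNReal

variable {p : ℕ} [Fact p.Prime] {K : Type*} [Field K] [Algebra ℚ_[p] K] [FiniteDimensional ℚ_[p] K]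

local notation "v" => spectralValuation p K

local notation "ι" => algebraMap K (AlgebraicClosure K)

section Unit

variable [Algebra ℤ_[p] K] [IsScalarTower ℤ_[p] ℚ_[p] K]

theorem spectralValuation_ringOfInt_le_one (x : RingOfInt p K) : v (ι x) ≤ 1 :=
  (mem_ringOfInt_iff p K x).1 x.2

theorem isUnit_ringOfInt_iff (x : RingOfInt p K) : IsUnit x ↔ v (ι x) = 1 := by
  constructor
  · rintro ⟨u, rfl⟩
    have h : v (ι (u : RingOfInt p K)) * v (ι ((u⁻¹ : (RingOfInt p K)ˣ) : RingOfInt p K)) = 1 := by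
      rw [← map_mul, ← map_mul, ← MulMemClass.coe_mul, Units.mul_inv, OneMemClass.coe_one, map_one,
        map_one]
    exact eq_one_of_mul_eq_one (spectralValuation_ringOfInt_le_one _)
      (spectralValuation_ringOfInt_le_one _) h
  · intro h
    have hx : (x : K) ≠ 0 := by
      rintro h0
      rw [h0, map_zero, map_zero] at h
      exact zero_ne_one h
    refine IsUnit.of_mul_eq_one ⟨(x : K)⁻¹, (mem_ringOfInt_iff p K _).2 ?_⟩ (Subtype.ext ?_)
    · rw [map_inv₀, map_inv₀, h, inv_one]
    · exact mul_inv_cancel₀ hx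

theorem mem_maximalIdeal_ringOfInt_iff (x : RingOfInt p K) :
    x ∈ IsLocalRing.maximalIdeal (RingOfInt p K) ↔ v (ι x) < 1 := by
  rw [IsLocalRing.mem_maximalIdeal, mem_nonunits_iff, isUnit_ringOfInt_iff,
    lt_iff_le_and_ne, and_iff_right (spectralValuation_ringOfInt_le_one x)]

end Unit

variable {F : K[X]} {e : Fin 3 → AlgebraicClosure K} {x y : K}

namespace IsRootTriple

variable (he : IsRootTriple F e)
include he

theorem prod_sub_eq (hxy : y ^ 2 = aeval x F) : (ι y) ^ 2 = ∏ i, (ι x - e i) := by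
  rw [← he.aeval_eq, aeval_algebraMap_apply, ← hxy, map_pow]

theorem irreducible_of_isField (h : IsField (AdjoinRoot F)) : Irreducible F := by
  have h1 : (Ideal.span {F} : Ideal K[X]).IsMaximal := Ideal.Quotient.maximal_of_isField _ h
  exact ((Ideal.span_singleton_prime he.monic.ne_zero).1 h1.isPrime).irreducible

theorem exists_algEquiv_eq_of_isField (h : IsField (AdjoinRoot F)) (i j : Fin 3) :
    ∃ σ : AlgebraicClosure K ≃ₐ[K] AlgebraicClosure K, σ (e i) = e j := by
  have hmin (i : Fin 3) : F = minpoly K (e i) :=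
    minpoly.eq_of_irreducible_of_monic (he.irreducible_of_isField h) (he.aeval_root i) he.monic
  obtain ⟨σ, hσ⟩ := isConjRoot_iff_exists_algEquiv.1
    (show IsConjRoot K (e j) (e i) from (hmin j).symm.trans (hmin i))
  exact ⟨σ, hσ⟩

theorem hasSquareValuation_of_isField (h : IsField (AdjoinRoot F)) (hxy : y ^ 2 = aeval x F) :
    HasSquareValuation p e (ι x) := by
  refine hasSquareValuation_of_forall_eq he.isGaloisTriple (fun σ => σ.commutes x)
    (fun σ => σ.commutes y) (he.prod_sub_eq hxy) fun i j => ?_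
  obtain ⟨σ, hσ⟩ := he.exists_algEquiv_eq_of_isField h j i
  exact spectralValuation_sub_eq (σ.commutes x) hσ

variable [Algebra ℤ_[p] K] [IsScalarTower ℤ_[p] ℚ_[p] K]

theorem spectralValuation_root_le_one (hF : ∀ i, F.coeff i ∈ RingOfInt p K) (i : Fin 3) :
    v (e i) ≤ 1 := by
  have h (n : ℕ) := (mem_ringOfInt_iff p K _).1 (hF n)
  have h1 := he.aeval_root i
  have h3 : F.coeff 3 = 1 := by
    have := he.monic.coeff_natDegree
    rwa [he.natDegree_eq] at this
  rw [aeval_eq_sum_range, he.natDegree_eq] at h1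
  simp only [Finset.sum_range_succ, Finset.sum_range_zero, Algebra.smul_def, h3] at h1
  refine Valuation.le_one_of_cubic v (h 2) (h 1) (h 0) ?_
  rw [← h1, map_one]
  ring

omit [Algebra ℚ_[p] K] [FiniteDimensional ℚ_[p] K] [IsScalarTower ℤ_[p] ℚ_[p] K] in
-- Division by the integral monic lift of `F` gives each element of `𝒪[T]/(F)` a representative of
-- degree below `3` with integral coefficients, and a representative of that degree is unique.
theorem not_mem_adjoin_of_coeff {g : K[X]} (hF : ∀ i, F.coeff i ∈ RingOfInt p K)
    (hdeg : g.degree < 3) {n : ℕ} (hg : g.coeff n ∉ RingOfInt p K) :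
    AdjoinRoot.mk F g ∉ Algebra.adjoin (RingOfInt p K) {AdjoinRoot.root F} := by
  intro hmem
  rw [Algebra.adjoin_singleton_eq_range_aeval] at hmem
  obtain ⟨q, hq⟩ := hmem
  have hl : F ∈ Polynomial.lifts (algebraMap (RingOfInt p K) K) := by
    rw [Polynomial.lifts_iff_coeff_lifts]
    exact fun n => ⟨⟨F.coeff n, hF n⟩, rfl⟩
  obtain ⟨F₀, hF₀, -, hm⟩ := Polynomial.lifts_and_natDegree_eq_and_monic hl he.monic
  have hq' : AdjoinRoot.mk F (q.map (algebraMap (RingOfInt p K) K)) = AdjoinRoot.mk F g := by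
    rw [← hq, ← AdjoinRoot.aeval_eq, aeval_map_algebraMap]
    rfl
  rw [AdjoinRoot.mk_eq_mk] at hq'
  have h1 : g = (q %ₘ F₀).map (algebraMap (RingOfInt p K) K) := by
    rw [map_modByMonic _ hm, hF₀, ← (modByMonic_eq_self_iff he.monic (p := g)).2 ?_]
    · exact (modByMonic_eq_of_dvd_sub he.monic hq').symm
    · rw [degree_eq_natDegree he.monic.ne_zero, he.natDegree_eq]
      exact hdeg
  rw [h1, coeff_map] at hg
  exact hg (Subtype.mem _)

/-- Otherwise `F` has a multiple root modulo `π` at `x` with `F(x) = y²` divisible by `π²`, and the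
order `𝒪[T]/(F)` can be enlarged. -/
theorem spectralValuation_derivative_eq_one (hF : ∀ i, F.coeff i ∈ RingOfInt p K)
    (hmax : algInt p F = Algebra.adjoin (RingOfInt p K) {AdjoinRoot.root F})
    (hxy : y ^ 2 = aeval x F) (hx : v (ι x) ≤ 1) (hy : v (ι y) < 1) :
    v (aeval (ι x) (derivative F)) = 1 := by
  obtain ⟨π, hπ⟩ := IsDiscreteValuationRing.exists_irreducible (RingOfInt p K)
  have hπ0 : (π : K) ≠ 0 := fun h => hπ.ne_zero (Subtype.ext h)
  have hdvd (z : K) (hz : v (ι z) < 1) : ∃ w : K, v (ι w) ≤ 1 ∧ z = π * w := by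
    have h1 : (⟨z, (mem_ringOfInt_iff p K z).2 hz.le⟩ : RingOfInt p K) ∈
      IsLocalRing.maximalIdeal (RingOfInt p K) := (mem_maximalIdeal_ringOfInt_iff _).2 hz
    rw [hπ.maximalIdeal_eq, Ideal.mem_span_singleton] at h1
    obtain ⟨w, hw⟩ := h1
    exact ⟨w, spectralValuation_ringOfInt_le_one w, congrArg Subtype.val hw⟩
  have hroot := he.spectralValuation_root_le_one hF
  have hsub (i : Fin 3) : v (ι x - e i) ≤ 1 := Valuation.map_sub_le _ hx (hroot i)
  by_contra hne
  have hlt : v (ι (aeval x (derivative F))) < 1 := by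
    rw [← aeval_algebraMap_apply]
    refine lt_of_le_of_ne ?_ hne
    rw [he.aeval_derivative]
    refine Valuation.map_add_le _ (Valuation.map_add_le _ ?_ ?_) ?_ <;>
    · rw [map_mul]
      exact mul_le_one' (hsub _) (hsub _)
  obtain ⟨c, hc, hcx⟩ := hdvd _ hlt
  obtain ⟨d, hd, hdy⟩ := hdvd _ hy
  -- With `t = T - x` one has `F = t³ + b t² + F'(x) t + F(x)`. The element `g = t(t + b)/π` has
  -- leading coefficient `π⁻¹`, so it lies outside the order.
  set b : K := 3 * x + F.coeff 2 with hb
  set g : K[X] := C (π : K)⁻¹ * ((X - C x) ^ 2 + C b * (X - C x)) with hg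
  have hval (i : Fin 3) : he.hom i (AdjoinRoot.mk F g) =
      (ι π)⁻¹ * ((e i - ι x) ^ 2 + ι b * (e i - ι x)) := by
    rw [he.hom_mk, hg]
    simp
  have hint : AdjoinRoot.mk F g ∈ algInt p F := by
    refine he.isIntegral_of_hom fun i => ?_
    set z := he.hom i (AdjoinRoot.mk F g) with hz
    have hπ0' : ι π ≠ 0 := (_root_.map_ne_zero ι).2 hπ0
    have hz1 : ι π * z = (e i - ι x) ^ 2 + ι b * (e i - ι x) := by
      rw [hz, hval, mul_inv_cancel_left₀ hπ0']
    have hb1 : ι b = 3 * ι x - (e 0 + e 1 + e 2) := by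
      rw [hb, map_add, map_mul, map_ofNat, he.coeff_two]
      ring
    have hc1 : ι π * ι c = (ι x - e 0) * (ι x - e 1) + (ι x - e 0) * (ι x - e 2) +
        (ι x - e 1) * (ι x - e 2) := by
      rw [← he.aeval_derivative, aeval_algebraMap_apply, hcx, map_mul]
    have hd1 : (ι π * ι d) ^ 2 = (ι x - e 0) * (ι x - e 1) * (ι x - e 2) := by
      rw [← map_mul, ← hdy, he.prod_sub_eq hxy, Fin.prod_univ_three]
    -- With `F'(x) = π c` and `y = π d`, this is `(t + b) F(T) = 0` divided by `π²`: a monic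
    -- integral quadratic equation for `z`.
    have hz2 : z ^ 2 + ι c * z + (e i - ι x + ι b) * ι d ^ 2 = 0 := by
      have h1 : (e i - e 0) * (e i - e 1) * (e i - e 2) = 0 := by
        rw [← Fin.prod_univ_three (f := fun j => e i - e j), ← he.aeval_eq, he.aeval_root]
      have h2 : ι π ^ 2 * (z ^ 2 + ι c * z + (e i - ι x + ι b) * ι d ^ 2) = 0 := by
        calc ι π ^ 2 * (z ^ 2 + ι c * z + (e i - ι x + ι b) * ι d ^ 2)
            = (ι π * z) ^ 2 + (ι π * ι c) * (ι π * z) + (e i - ι x + ι b) * (ι π * ι d) ^ 2 := by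
              ring
          _ = (e i - ι x + ι b) * ((e i - e 0) * (e i - e 1) * (e i - e 2)) := by
              rw [hz1, hc1, hd1, hb1]
              ring
          _ = 0 := by rw [h1, mul_zero]
      exact (mul_eq_zero.1 h2).resolve_left (pow_ne_zero 2 hπ0')
    by_contra! h1
    have h2 : z ^ 2 = -(ι c * z + (e i - ι x + ι b) * ι d ^ 2) := by linear_combination hz2
    have hbv : v (ι b) ≤ 1 := by
      rw [← mem_ringOfInt_iff, hb]
      exact add_mem (mul_mem (ofNat_mem _ 3) ((mem_ringOfInt_iff p K x).2 hx)) (hF 2)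
    have h3 : v (z ^ 2) ≤ v z := by
      rw [h2, Valuation.map_neg]
      refine Valuation.map_add_le _ ?_ ?_
      · rw [map_mul]
        exact mul_le_of_le_one_left zero_le hc
      · rw [map_mul, map_pow]
        refine (mul_le_one' (Valuation.map_add_le _ ?_ hbv) (pow_le_one₀ zero_le hd)).trans h1.le
        rw [Valuation.map_sub_swap]
        exact hsub i
    rw [map_pow, pow_two] at h3
    exact absurd h3 (not_le.2 (lt_mul_of_one_lt_left (zero_lt_one.trans h1) h1))
  rw [hmax] at hint
  refine he.not_mem_adjoin_of_coeff hF (g := g) (n := 2) ?_ ?_ hint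
  · rw [hg]
    refine lt_of_le_of_lt (b := ((2 : ℕ) : WithBot ℕ)) ?_ (by norm_num)
    compute_degree
    exact le_rfl
  · have h1 : g.coeff 2 = (π : K)⁻¹ := by
      have : g = C (π : K)⁻¹ * (X ^ 2 + C (b - 2 * x) * X + C (x ^ 2 - b * x)) := by
        rw [hg]
        simp only [map_sub, map_mul, map_pow, map_ofNat]
        ring
      rw [this, coeff_C_mul]
      simp [-map_sub, -map_mul]
    rw [h1]
    intro hmem
    exact hπ.not_isUnit (IsUnit.of_mul_eq_one ⟨_, hmem⟩ (Subtype.ext (mul_inv_cancel₀ hπ0)))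

theorem hasSquareValuation_of_adjoin_eq (hF : ∀ i, F.coeff i ∈ RingOfInt p K)
    (hmax : algInt p F = Algebra.adjoin (RingOfInt p K) {AdjoinRoot.root F})
    (hxy : y ^ 2 = aeval x F) : HasSquareValuation p e (ι x) := by
  have hroot := he.spectralValuation_root_le_one hF
  have hprod := he.prod_sub_eq hxy
  rcases lt_or_ge 1 (v (ι x)) with hx | hx
  · exact hasSquareValuation_of_one_lt he.isGaloisTriple (fun σ => σ.commutes x)
      (fun σ => σ.commutes y) hprod hroot hx
  have hy : v (ι y) ≤ 1 := by
    refine (pow_le_one_iff two_ne_zero).1 ?_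
    rw [← map_pow, hprod, map_prod]
    exact Finset.prod_le_one' fun i _ => Valuation.map_sub_le _ hx (hroot i)
  rcases hy.lt_or_eq with hy | hy
  · refine hasSquareValuation_of_derivative (fun σ => σ.commutes x) (fun σ => σ.commutes y) hprod
      hroot hx ?_
    rw [← he.aeval_derivative]
    exact he.spectralValuation_derivative_eq_one hF hmax hxy hx hy
  · exact hasSquareValuation_of_eq_one hprod hroot hx hy

end IsRootTriple

end MaximalOrder

/-! ### Changes of variables and points -/

namespace WeierstrassCurve.VariableChange

variable {K : Type*} [Field K] (C : VariableChange K) (W : WeierstrassCurve K)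

/-- The abscissa in the old coordinates. -/
def oldX (x : K) : K := (C.u : K) ^ 2 * x + C.r

/-- The ordinate in the old coordinates. -/
def oldY (x y : K) : K := (C.u : K) ^ 3 * y + (C.u : K) ^ 2 * C.s * x + C.t

theorem u_ne_zero : (C.u : K) ≠ 0 := C.u.ne_zero

/-- Clearing the powers of `u` makes the transformation rules polynomial, so the later identities
are linear combinations of them. -/
theorem u_mul_a₁ : (C.u : K) * (C • W).a₁ = W.a₁ + 2 * C.s := by
  rw [variableChange_a₁, ← mul_assoc, C.u.mul_inv, one_mul]

theorem u_mul_a₂ : (C.u : K) ^ 2 * (C • W).a₂ = W.a₂ - C.s * W.a₁ + 3 * C.r - C.s ^ 2 := by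
  rw [variableChange_a₂, ← mul_assoc, ← mul_pow, C.u.mul_inv, one_pow, one_mul]

theorem u_mul_a₃ : (C.u : K) ^ 3 * (C • W).a₃ = W.a₃ + C.r * W.a₁ + 2 * C.t := by
  rw [variableChange_a₃, ← mul_assoc, ← mul_pow, C.u.mul_inv, one_pow, one_mul]

theorem u_mul_a₄ : (C.u : K) ^ 4 * (C • W).a₄ = W.a₄ - C.s * W.a₃ + 2 * C.r * W.a₂ -
    (C.t + C.r * C.s) * W.a₁ + 3 * C.r ^ 2 - 2 * C.s * C.t := by
  rw [variableChange_a₄, ← mul_assoc, ← mul_pow, C.u.mul_inv, one_pow, one_mul]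

theorem u_mul_a₆ : (C.u : K) ^ 6 * (C • W).a₆ = W.a₆ + C.r * W.a₄ + C.r ^ 2 * W.a₂ + C.r ^ 3 -
    C.t * W.a₃ - C.t ^ 2 - C.r * C.t * W.a₁ := by
  rw [variableChange_a₆, ← mul_assoc, ← mul_pow, C.u.mul_inv, one_pow, one_mul]

variable {W}

theorem equation_iff {x y : K} :
    (C • W).toAffine.Equation x y ↔ W.toAffine.Equation (C.oldX x) (C.oldY x y) := by
  rw [Affine.equation_iff', Affine.equation_iff', ← mul_right_inj' (pow_ne_zero 6 C.u_ne_zero),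
    mul_zero, oldX, oldY]
  refine Eq.congr ?_ rfl
  linear_combination (C.u : K) ^ 5 * x * y * C.u_mul_a₁ W - (C.u : K) ^ 4 * x ^ 2 * C.u_mul_a₂ W +
    (C.u : K) ^ 3 * y * C.u_mul_a₃ W - (C.u : K) ^ 2 * x * C.u_mul_a₄ W - C.u_mul_a₆ W

theorem partialY_eq (x y : K) : 2 * C.oldY x y + W.a₁ * C.oldX x + W.a₃ =
    (C.u : K) ^ 3 * (2 * y + (C • W).a₁ * x + (C • W).a₃) := by
  rw [oldX, oldY]
  linear_combination -(C.u : K) ^ 2 * x * C.u_mul_a₁ W - C.u_mul_a₃ W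

/-- The two partial derivatives transform by a triangular invertible matrix, so their simultaneous
vanishing does not depend on the equation. -/
theorem partialX_eq (x y : K) :
    W.a₁ * C.oldY x y - (3 * C.oldX x ^ 2 + 2 * W.a₂ * C.oldX x + W.a₄) =
      (C.u : K) ^ 4 * ((C • W).a₁ * y - (3 * x ^ 2 + 2 * (C • W).a₂ * x + (C • W).a₄)) -
        C.s * ((C.u : K) ^ 3 * (2 * y + (C • W).a₁ * x + (C • W).a₃)) := by
  rw [oldX, oldY]
  linear_combination (-(C.u : K) ^ 3 * y + C.s * (C.u : K) ^ 2 * x) * C.u_mul_a₁ W +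
    2 * (C.u : K) ^ 2 * x * C.u_mul_a₂ W + C.s * C.u_mul_a₃ W + C.u_mul_a₄ W

theorem nonsingular_iff {x y : K} :
    (C • W).toAffine.Nonsingular x y ↔ W.toAffine.Nonsingular (C.oldX x) (C.oldY x y) := by
  rw [Affine.nonsingular_iff', Affine.nonsingular_iff', C.equation_iff, C.partialX_eq,
    C.partialY_eq, and_congr_right_iff]
  intro _
  have h3 := pow_ne_zero 3 C.u_ne_zero
  have h4 := pow_ne_zero 4 C.u_ne_zero
  by_cases h : 2 * y + (C • W).a₁ * x + (C • W).a₃ = 0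
  · simp [h]
  · simp [h]

theorem oldX_inj {x x' : K} : C.oldX x = C.oldX x' ↔ x = x' := by
  simp [oldX]

theorem oldY_inj {x y y' : K} : C.oldY x y = C.oldY x y' ↔ y = y' := by
  simp [oldY]

theorem negY_oldY (x y : K) : W.toAffine.negY (C.oldX x) (C.oldY x y) =
    C.oldY x ((C • W).toAffine.negY x y) := by
  have h := C.partialY_eq (W := W) x y
  change -C.oldY x y - W.a₁ * C.oldX x - W.a₃ = C.oldY x (-y - (C • W).a₁ * x - (C • W).a₃)
  simp only [oldY] at h ⊢
  linear_combination -h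

/-- The change of variables is affine and sends lines of slope `ℓ` to lines of slope `u ℓ + s`; the
tangent case is the transformation of the partial derivatives. -/
theorem slope_old [DecidableEq K] {x₁ x₂ y₁ y₂ : K} (h₁ : (C • W).toAffine.Equation x₁ y₁)
    (h₂ : (C • W).toAffine.Equation x₂ y₂)
    (h : ¬(x₁ = x₂ ∧ y₁ = (C • W).toAffine.negY x₂ y₂)) :
    W.toAffine.slope (C.oldX x₁) (C.oldX x₂) (C.oldY x₁ y₁) (C.oldY x₂ y₂) =
      C.u * (C • W).toAffine.slope x₁ x₂ y₁ y₂ + C.s := by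
  by_cases hx : x₁ = x₂
  · have hy : y₁ ≠ (C • W).toAffine.negY x₂ y₂ := fun h' => h ⟨hx, h'⟩
    have hy' : y₁ - (C • W).toAffine.negY x₁ y₁ ≠ 0 := by
      subst hx
      rw [sub_ne_zero]
      rcases Affine.Y_eq_of_X_eq h₁ h₂ rfl with h' | h'
      · rwa [h'] at hy ⊢
      · exact absurd h' hy
    subst hx
    rw [Affine.slope_of_Y_ne rfl hy, Affine.slope_of_Y_ne rfl (by
      rw [C.negY_oldY, Ne, C.oldY_inj]; exact hy), C.negY_oldY]
    have h3 : C.oldY x₁ y₁ - C.oldY x₁ ((C • W).toAffine.negY x₁ y₁) =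
        (C.u : K) ^ 3 * (y₁ - (C • W).toAffine.negY x₁ y₁) := by
      simp only [oldY]
      ring
    have h4 : y₁ - (C • W).toAffine.negY x₁ y₁ = 2 * y₁ + (C • W).a₁ * x₁ + (C • W).a₃ := by
      rw [Affine.negY]
      ring
    have h5 := C.partialX_eq (W := W) x₁ y₁
    have := C.u_ne_zero
    rw [h3, div_eq_iff (mul_ne_zero (pow_ne_zero 3 this) hy')]
    have h6 := div_mul_cancel₀ (3 * x₁ ^ 2 + 2 * (C • W).a₂ * x₁ + (C • W).a₄ - (C • W).a₁ * y₁) hy'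
    rw [← h4] at h5
    linear_combination -h5 - (C.u : K) ^ 4 * h6
  · have hx' : x₁ - x₂ ≠ 0 := sub_ne_zero.2 hx
    rw [Affine.slope_of_X_ne hx, Affine.slope_of_X_ne (mt C.oldX_inj.1 hx)]
    have := C.u_ne_zero
    have h2 : C.oldX x₁ - C.oldX x₂ = (C.u : K) ^ 2 * (x₁ - x₂) := by
      rw [oldX, oldX]
      ring
    rw [h2, div_eq_iff (mul_ne_zero (pow_ne_zero 2 this) hx'), oldY, oldY]
    linear_combination (-(C.u : K) ^ 3) * div_mul_cancel₀ (y₁ - y₂) hx'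

theorem addX_old (x₁ x₂ ℓ : K) : W.toAffine.addX (C.oldX x₁) (C.oldX x₂) (C.u * ℓ + C.s) =
    C.oldX ((C • W).toAffine.addX x₁ x₂ ℓ) := by
  simp only [Affine.addX, oldX]
  linear_combination (-(C.u : K) * ℓ) * C.u_mul_a₁ W + C.u_mul_a₂ W

theorem addY_old (x₁ x₂ y₁ ℓ : K) :
    W.toAffine.addY (C.oldX x₁) (C.oldX x₂) (C.oldY x₁ y₁) (C.u * ℓ + C.s) =
      C.oldY ((C • W).toAffine.addX x₁ x₂ ℓ) ((C • W).toAffine.addY x₁ x₂ y₁ ℓ) := by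
  rw [Affine.addY, Affine.addY, C.addX_old, ← C.negY_oldY, Affine.negAddY, Affine.negAddY,
    C.addX_old]
  congr 1
  simp only [oldX, oldY]
  ring

/-- The map on points induced by a change of variables. -/
def pointMap : (C • W).toAffine.Point → W.toAffine.Point
  | .zero => .zero
  | .some x y h => .some (C.oldX x) (C.oldY x y) (C.nonsingular_iff.1 h)

theorem pointMap_add [DecidableEq K] (P Q : (C • W).toAffine.Point) :
    C.pointMap (P + Q) = C.pointMap P + C.pointMap Q := by
  rcases P with _ | ⟨x₁, y₁, h₁⟩
  · change C.pointMap (0 + Q) = 0 + C.pointMap Q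
    rw [zero_add, zero_add]
  rcases Q with _ | ⟨x₂, y₂, h₂⟩
  · change C.pointMap (_ + 0) = _ + 0
    rw [add_zero, add_zero]
  by_cases h : x₁ = x₂ ∧ y₁ = (C • W).toAffine.negY x₂ y₂
  · rw [Affine.Point.add_of_Y_eq h.1 h.2]
    refine (Affine.Point.add_of_Y_eq (C.oldX_inj.2 h.1) ?_).symm
    rw [C.negY_oldY, ← h.2, h.1]
  · have h' : ¬(C.oldX x₁ = C.oldX x₂ ∧
        C.oldY x₁ y₁ = W.toAffine.negY (C.oldX x₂) (C.oldY x₂ y₂)) := by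
      rintro ⟨h3, h4⟩
      rw [C.oldX_inj] at h3
      rw [C.negY_oldY, h3, C.oldY_inj] at h4
      exact h ⟨h3, h4⟩
    rw [Affine.Point.add_some h]
    refine Eq.trans ?_ (Affine.Point.add_some h').symm
    rw [pointMap]
    simp only [C.slope_old h₁.1 h₂.1 h, C.addX_old, C.addY_old]

/-- The homomorphism on points induced by a change of variables. -/
def pointHom [DecidableEq K] : (C • W).toAffine.Point →+ W.toAffine.Point where
  toFun := C.pointMap
  map_zero' := rfl
  map_add' := C.pointMap_add

theorem exists_old (x y : K) : ∃ x' y', C.oldX x' = x ∧ C.oldY x' y' = y := by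
  have := C.u_ne_zero
  refine ⟨(x - C.r) / (C.u : K) ^ 2, (y - C.s * (x - C.r) - C.t) / (C.u : K) ^ 3, ?_, ?_⟩ <;>
  · simp only [oldX, oldY]
    field_simp
    ring

theorem pointMap_surjective : Function.Surjective (C.pointMap (W := W)) := by
  rintro (_ | ⟨x, y, h⟩)
  · exact ⟨.zero, rfl⟩
  · obtain ⟨x', y', rfl, rfl⟩ := C.exists_old x y
    exact ⟨.some x' y' (C.nonsingular_iff.2 h), rfl⟩

end WeierstrassCurve.VariableChange

/-! ### The roots of the two-division polynomial -/

section TwoTorsionTriple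

variable {K : Type*} [Field K] [CharZero K]

local notation "ι" => algebraMap K (AlgebraicClosure K)

/-- The family `E` consists of the roots of `4 X³ + b₂ X² + 2 b₄ X + b₆`, and it is stable under
Galois. -/
structure IsTwoTorsionTriple (W : WeierstrassCurve K) (E : Fin 3 → AlgebraicClosure K) : Prop
    extends IsGaloisTriple E where
  b₂ : ι W.b₂ = -4 * (E 0 + E 1 + E 2)
  b₄ : ι W.b₄ = 2 * (E 0 * E 1 + E 0 * E 2 + E 1 * E 2)
  b₆ : ι W.b₆ = -4 * (E 0 * E 1 * E 2)

omit [CharZero K] in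
theorem IsRootTriple.isTwoTorsionTriple {F : K[X]} {e : Fin 3 → AlgebraicClosure K}
    (he : IsRootTriple F e) : IsTwoTorsionTriple (cubicCurve F) e where
  toIsGaloisTriple := he.isGaloisTriple
  b₂ := by
    simp only [WeierstrassCurve.b₂, cubicCurve, map_add, map_mul, map_pow, he.coeff_two, map_ofNat,
      map_zero]
    ring
  b₄ := by
    simp only [WeierstrassCurve.b₄, cubicCurve, map_add, map_mul, he.coeff_one, map_ofNat, map_zero]
    ring
  b₆ := by
    simp only [WeierstrassCurve.b₆, cubicCurve, map_add, map_mul, map_pow, he.coeff_zero, map_ofNat,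
      map_zero]
    ring

namespace IsTwoTorsionTriple

variable {W : WeierstrassCurve K} {E : Fin 3 → AlgebraicClosure K} (hE : IsTwoTorsionTriple W E)
include hE

omit [CharZero K] in
theorem cubic_eq (X : AlgebraicClosure K) :
    4 * X ^ 3 + ι W.b₂ * X ^ 2 + 2 * ι W.b₄ * X + ι W.b₆ = 4 * ∏ i, (X - E i) := by
  rw [hE.b₂, hE.b₄, hE.b₆, Fin.prod_univ_three]
  ring

omit [CharZero K] in
theorem cubic_root (i : Fin 3) :
    4 * E i ^ 3 + ι W.b₂ * E i ^ 2 + 2 * ι W.b₄ * E i + ι W.b₆ = 0 := by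
  rw [hE.cubic_eq, Finset.prod_eq_zero (Finset.mem_univ i) (sub_self _), mul_zero]

theorem Δ_eq : ι W.Δ = 16 * ((E 0 - E 1) * (E 0 - E 2) * (E 1 - E 2)) ^ 2 := by
  have h8 : 4 * ι W.b₈ = ι W.b₂ * ι W.b₆ - ι W.b₄ ^ 2 := by
    rw [← map_pow, ← map_mul, ← map_sub, ← W.b_relation, map_mul, map_ofNat]
  have h4 : (4 : AlgebraicClosure K) ≠ 0 := by norm_num
  refine mul_left_cancel₀ h4 ?_
  rw [WeierstrassCurve.Δ]
  simp only [map_add, map_sub, map_mul, map_neg, map_pow, map_ofNat]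
  have : 4 * (-ι W.b₂ ^ 2 * ι W.b₈ - 8 * ι W.b₄ ^ 3 - 27 * ι W.b₆ ^ 2 +
      9 * ι W.b₂ * ι W.b₄ * ι W.b₆) = -ι W.b₂ ^ 2 * (4 * ι W.b₈) + 4 * (- 8 * ι W.b₄ ^ 3 -
      27 * ι W.b₆ ^ 2 + 9 * ι W.b₂ * ι W.b₄ * ι W.b₆) := by ring
  rw [this, h8, hE.b₂, hE.b₄, hE.b₆]
  ring

/-- Completing the square; the rational square root of the product plays the role of `Y` on a
general Weierstrass equation. -/
theorem half_sq {x y : K} (h : W.toAffine.Equation x y) :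
    (ι ((2 * y + W.a₁ * x + W.a₃) / 2)) ^ 2 = ∏ i, (ι x - E i) := by
  have h4 : (4 : AlgebraicClosure K) ≠ 0 := by norm_num
  have h2 : (2 : AlgebraicClosure K) ≠ 0 := by norm_num
  have h1 : (2 * y + W.a₁ * x + W.a₃) ^ 2 = 4 * x ^ 3 + W.b₂ * x ^ 2 + 2 * W.b₄ * x + W.b₆ := by
    rw [Affine.equation_iff] at h
    simp only [WeierstrassCurve.b₂, WeierstrassCurve.b₄, WeierstrassCurve.b₆]
    linear_combination 4 * h
  refine mul_left_cancel₀ h4 ?_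
  rw [← hE.cubic_eq, map_div₀, div_pow, ← map_pow, h1, map_ofNat]
  simp only [map_add, map_mul, map_pow, map_ofNat]
  field_simp
  ring

omit [CharZero K] in
theorem variableChange (C : VariableChange K) : IsTwoTorsionTriple (C • W)
    fun i => ι ((C.u⁻¹ : Kˣ) : K) ^ 2 * E i + ι (-((C.u⁻¹ : Kˣ) : K) ^ 2 * C.r) where
  toIsGaloisTriple := by
    simpa only [map_pow] using
      hE.toIsGaloisTriple.affine (r := -((C.u⁻¹ : Kˣ) : K) ^ 2 * C.r) (pow_ne_zero 2 C.u⁻¹.ne_zero)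
  b₂ := by
    rw [variableChange_b₂]
    simp only [map_add, map_mul, map_neg, map_pow, map_ofNat, hE.b₂]
    ring
  b₄ := by
    rw [variableChange_b₄]
    simp only [map_add, map_mul, map_neg, map_pow, map_ofNat, hE.b₂, hE.b₄]
    ring
  b₆ := by
    rw [variableChange_b₆]
    simp only [map_add, map_mul, map_neg, map_pow, map_ofNat, hE.b₂, hE.b₄, hE.b₆]
    ring

end IsTwoTorsionTriple

omit [CharZero K] in
theorem HasSquareValuation.of_variableChange {p : ℕ} [Fact p.Prime] [Algebra ℚ_[p] K]
    [FiniteDimensional ℚ_[p] K] {E : Fin 3 → AlgebraicClosure K} {x : K} (C : VariableChange K)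
    (h : HasSquareValuation p
      (fun i => ι ((C.u⁻¹ : Kˣ) : K) ^ 2 * E i + ι (-((C.u⁻¹ : Kˣ) : K) ^ 2 * C.r)) (ι x)) :
    HasSquareValuation p E (ι (C.oldX x)) := by
  have h1 := h.affine (u := (C.u : K)) (r := C.r) C.u_ne_zero
  have h2 : ι (C.u : K) ^ 2 * ι ((C.u⁻¹ : Kˣ) : K) ^ 2 = 1 := by
    rw [← mul_pow, ← map_mul, C.u.mul_inv, map_one, one_pow]
  rw [VariableChange.oldX]
  convert h1 using 2 with i
  simp only [map_mul, map_neg, map_pow]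
  linear_combination (ι C.r - E i) * h2

end TwoTorsionTriple

/-! ### Points on integral Weierstrass equations -/

section IntegralEquation

open scoped NNReal

variable {p : ℕ} [Fact p.Prime] {K : Type*} [Field K]

local notation "v" => spectralValuation p K

local notation "ι" => algebraMap K (AlgebraicClosure K)

variable [Algebra ℤ_[p] K] {W : WeierstrassCurve K}

section Coefficients

variable [IsIntegral (RingOfInt p K) W]

theorem a₁_mem : W.a₁ ∈ RingOfInt p K := integralModel_a₁_eq (RingOfInt p K) W ▸ Subtype.mem _

theorem a₂_mem : W.a₂ ∈ RingOfInt p K := integralModel_a₂_eq (RingOfInt p K) W ▸ Subtype.mem _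

theorem a₃_mem : W.a₃ ∈ RingOfInt p K := integralModel_a₃_eq (RingOfInt p K) W ▸ Subtype.mem _

theorem a₄_mem : W.a₄ ∈ RingOfInt p K := integralModel_a₄_eq (RingOfInt p K) W ▸ Subtype.mem _

theorem a₆_mem : W.a₆ ∈ RingOfInt p K := integralModel_a₆_eq (RingOfInt p K) W ▸ Subtype.mem _

theorem b₂_mem : W.b₂ ∈ RingOfInt p K := integralModel_b₂_eq (RingOfInt p K) W ▸ Subtype.mem _

theorem b₄_mem : W.b₄ ∈ RingOfInt p K := integralModel_b₄_eq (RingOfInt p K) W ▸ Subtype.mem _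

theorem b₆_mem : W.b₆ ∈ RingOfInt p K := integralModel_b₆_eq (RingOfInt p K) W ▸ Subtype.mem _

theorem b₈_mem : W.b₈ ∈ RingOfInt p K := integralModel_b₈_eq (RingOfInt p K) W ▸ Subtype.mem _

variable [Algebra ℚ_[p] K] [FiniteDimensional ℚ_[p] K] [IsScalarTower ℤ_[p] ℚ_[p] K]

theorem y_mem_of_equation {x y : K} (h : W.toAffine.Equation x y) (hx : x ∈ RingOfInt p K) :
    y ∈ RingOfInt p K := by
  have h1 : W.a₁ * x + W.a₃ ∈ RingOfInt p K := add_mem (mul_mem a₁_mem hx) a₃_mem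
  have h2 : x ^ 3 + W.a₂ * x ^ 2 + W.a₄ * x + W.a₆ ∈ RingOfInt p K :=
    add_mem (add_mem (add_mem (pow_mem hx 3) (mul_mem a₂_mem (pow_mem hx 2)))
      (mul_mem a₄_mem hx)) a₆_mem
  have heq : y ^ 2 = x ^ 3 + W.a₂ * x ^ 2 + W.a₄ * x + W.a₆ - (W.a₁ * x + W.a₃) * y := by
    rw [Affine.equation_iff] at h
    linear_combination h
  rw [mem_ringOfInt_iff] at h1 h2 ⊢
  by_contra! hy
  have h3 : v (ι (y ^ 2)) ≤ v (ι y) := by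
    rw [heq, map_sub, map_mul]
    refine Valuation.map_sub_le _ (h2.trans hy.le) ?_
    rw [map_mul]
    exact mul_le_of_le_one_left zero_le h1
  rw [map_pow, map_pow, pow_two] at h3
  exact absurd h3 (not_le.2 (lt_mul_of_one_lt_left (zero_lt_one.trans hy) hy))

end Coefficients

variable [Algebra ℚ_[p] K] [FiniteDimensional ℚ_[p] K] [IsScalarTower ℤ_[p] ℚ_[p] K]

section Odd

variable [CharZero K]

/-- For integral points, one of the partial derivatives `ξ`, `η` is a unit. If `η` is, the product
of the differences is a unit because `2` is; otherwise the unit `ξ` makes the derivative of the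
cubic a unit. -/
theorem hasSquareValuation_of_hasNonsingularReduction [IsMinimal (RingOfInt p K) W]
    {E : Fin 3 → AlgebraicClosure K} (hE : IsTwoTorsionTriple W E) (h2 : v 2 = 1) {x y : K}
    (h : W.toAffine.Nonsingular x y) (hns : HasNonsingularReduction p W (.some x y h)) :
    HasSquareValuation p E (ι x) := by
  have h4 : v 4 = 1 := by
    rw [show (4 : AlgebraicClosure K) = 2 ^ 2 by norm_num, map_pow, h2, one_pow]
  have hle (z : K) (hz : z ∈ RingOfInt p K) : v (ι z) ≤ 1 := (mem_ringOfInt_iff p K z).1 hz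
  have hroot (i : Fin 3) : v (E i) ≤ 1 := by
    have h5 : (4 : AlgebraicClosure K) ≠ 0 := by norm_num
    refine Valuation.le_one_of_cubic v (a := ι W.b₂ / 4) (b := 2 * ι W.b₄ / 4) (c := ι W.b₆ / 4)
      ?_ ?_ ?_ ?_
    · rw [map_div₀, h4, div_one]
      exact hle _ b₂_mem
    · rw [map_div₀, h4, div_one, map_mul, h2, one_mul]
      exact hle _ b₄_mem
    · rw [map_div₀, h4, div_one]
      exact hle _ b₆_mem
    · have := hE.cubic_root i
      field_simp
      linear_combination this
  have hprod := hE.half_sq h.1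
  set η := 2 * y + W.a₁ * x + W.a₃ with hη
  have hηv : v (ι (η / 2)) = v (ι η) := by
    rw [map_div₀, map_div₀, map_ofNat, h2, div_one]
  rcases lt_or_ge 1 (v (ι x)) with hx | hx
  · exact hasSquareValuation_of_one_lt hE.toIsGaloisTriple (fun σ => σ.commutes x)
      (fun σ => σ.commutes _) hprod hroot hx
  have hxm := (mem_ringOfInt_iff p K x).2 hx
  have hym := y_mem_of_equation h.1 hxm
  have hηm : η ∈ RingOfInt p K :=
    add_mem (add_mem (mul_mem (ofNat_mem _ 2) hym) (mul_mem a₁_mem hxm)) a₃_mem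
  rcases (hle η hηm).lt_or_eq with hη1 | hη1
  swap
  · exact hasSquareValuation_of_eq_one hprod hroot hx (hηv.trans hη1)
  set ξ := W.a₁ * y - (3 * x ^ 2 + 2 * W.a₂ * x + W.a₄) with hξ
  have hξm : ξ ∈ RingOfInt p K :=
    sub_mem (mul_mem a₁_mem hym) (add_mem (add_mem (mul_mem (ofNat_mem _ 3) (pow_mem hxm 2))
      (mul_mem (mul_mem (ofNat_mem _ 2) a₂_mem) hxm)) a₄_mem)
  have hξ1 : v (ι ξ) = 1 := by
    have h5 := hns ⟨x, hxm⟩ ⟨y, hym⟩ rfl rfl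
    rw [Affine.nonsingular_iff'] at h5
    set W₀ := integralModel (RingOfInt p K) W
    have h6 : IsLocalRing.residue (RingOfInt p K) ⟨ξ, hξm⟩ ≠ 0 ∨
        IsLocalRing.residue (RingOfInt p K) ⟨η, hηm⟩ ≠ 0 := by
      have h7 : (⟨ξ, hξm⟩ : RingOfInt p K) = W₀.a₁ * ⟨y, hym⟩ -
          (3 * ⟨x, hxm⟩ ^ 2 + 2 * W₀.a₂ * ⟨x, hxm⟩ + W₀.a₄) := by
        refine Subtype.ext ?_
        change ξ = algebraMap (RingOfInt p K) K W₀.a₁ * y - (3 * x ^ 2 +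
          2 * algebraMap (RingOfInt p K) K W₀.a₂ * x + algebraMap (RingOfInt p K) K W₀.a₄)
        rw [integralModel_a₁_eq, integralModel_a₂_eq, integralModel_a₄_eq]
      have h8 : (⟨η, hηm⟩ : RingOfInt p K) =
          2 * ⟨y, hym⟩ + W₀.a₁ * ⟨x, hxm⟩ + W₀.a₃ := by
        refine Subtype.ext ?_
        change η = 2 * y + algebraMap (RingOfInt p K) K W₀.a₁ * x +
          algebraMap (RingOfInt p K) K W₀.a₃
        rw [integralModel_a₁_eq, integralModel_a₃_eq]
      rw [h7, h8]
      simp only [map_sub, map_add, map_mul, map_pow, map_ofNat]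
      exact h5.2
    simp only [ne_eq, IsLocalRing.residue_eq_zero_iff, mem_maximalIdeal_ringOfInt_iff] at h6
    rcases h6 with h6 | h6
    · exact le_antisymm (hle _ hξm) (not_lt.1 h6)
    · exact absurd hη1 h6
  refine hasSquareValuation_of_derivative (fun σ => σ.commutes x) (fun σ => σ.commutes _) hprod
    hroot hx ?_
  -- Twice the derivative of the monic cubic is `6x² + b₂x + b₄`; modulo the nonunit `η` it is
  -- `-2ξ`.
  have h5 : 2 * ((ι x - E 0) * (ι x - E 1) + (ι x - E 0) * (ι x - E 2) +
      (ι x - E 1) * (ι x - E 2)) = ι (W.a₁ * η) - 2 * ι ξ := by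
    have hb₂ := hE.b₂
    have hb₄ := hE.b₄
    simp only [WeierstrassCurve.b₂, WeierstrassCurve.b₄, map_add, map_mul, map_pow,
      map_ofNat] at hb₂ hb₄
    simp only [hη, hξ, map_add, map_sub, map_mul, map_pow, map_ofNat]
    linear_combination -hb₂ * ι x - hb₄
  have h6 : v (ι (W.a₁ * η)) < v (2 * ι ξ) := by
    rw [map_mul v, h2, hξ1, one_mul, map_mul, map_mul]
    exact (mul_le_of_le_one_left zero_le (hle _ a₁_mem)).trans_lt hη1
  rw [← one_mul (v _), ← h2, ← map_mul, h5, Valuation.map_sub_eq_of_lt_right _ h6, map_mul, h2, hξ1,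
    one_mul]

end Odd

section Two

variable [CharZero K] [IsIntegral (RingOfInt p K) W] {E : Fin 3 → AlgebraicClosure K}

/-- Since `K` is unramified, `a₁` is divisible by `2`, hence `b₂` by `4` and `b₄` by `2`. Then `Δ`
is congruent to `-27 b₆²`, so `b₆` is a unit. -/
theorem hasSquareValuation_of_Δ_of_a₁_lt (hE : IsTwoTorsionTriple W E) (h2 : v 2 < 1)
    (hun : ∀ z : K, v (ι z) < 1 → v (ι z) ≤ v 2) (hΔ : v (ι W.Δ) = 1) (ha₁ : v (ι W.a₁) < 1)
    {x y : K} (h : W.toAffine.Equation x y) : HasSquareValuation p E (ι x) := by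
  have hle (z : K) (hz : z ∈ RingOfInt p K) : v (ι z) ≤ 1 := (mem_ringOfInt_iff p K z).1 hz
  have h4 : v 4 = v 2 ^ 2 := by
    rw [show (4 : AlgebraicClosure K) = 2 ^ 2 by norm_num, map_pow]
  have hb₂ : v (ι W.b₂) ≤ v 2 ^ 2 := by
    rw [WeierstrassCurve.b₂, map_add, map_mul, map_pow, map_ofNat]
    refine Valuation.map_add_le _ ?_ ?_
    · rw [map_pow]
      exact pow_le_pow_left₀ zero_le (hun _ ha₁) 2
    · rw [map_mul, h4]
      exact mul_le_of_le_one_right zero_le (hle _ a₂_mem)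
  have hb₄ : v (ι W.b₄) ≤ v 2 := by
    rw [WeierstrassCurve.b₄, map_add, map_mul, map_mul, map_ofNat]
    refine Valuation.map_add_le _ ?_ ?_
    · rw [map_mul]
      exact mul_le_of_le_one_right zero_le (hle _ a₄_mem)
    · rw [map_mul]
      exact (mul_le_of_le_one_right zero_le (hle _ a₃_mem)).trans (hun _ ha₁)
  have hb₂1 : v (ι W.b₂) < 1 := hb₂.trans_lt (pow_lt_one₀ zero_le h2 two_ne_zero)
  have hb₆ : v (ι W.b₆) = 1 := by
    refine le_antisymm (hle _ b₆_mem) (le_of_not_gt fun hb₆ => hΔ.not_lt ?_)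
    have hint (z : K) (hz : z ∈ RingOfInt p K) : v (ι z) ≤ 1 := hle z hz
    have hΔ' : W.Δ = W.b₂ * (-W.b₂ * W.b₈ + 9 * W.b₄ * W.b₆) + W.b₄ * (-8 * W.b₄ ^ 2) +
        W.b₆ * (-27 * W.b₆) := by
      rw [WeierstrassCurve.Δ]
      ring
    have hmul (a b : K) (ha : v (ι a) < 1) (hb : b ∈ RingOfInt p K) : v (ι (a * b)) < 1 := by
      rw [map_mul, map_mul]
      exact (mul_le_of_le_one_right zero_le (hle b hb)).trans_lt ha
    rw [hΔ', map_add ι, map_add ι]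
    refine Valuation.map_add_lt _ (Valuation.map_add_lt _ (hmul _ _ hb₂1 ?_)
      (hmul _ _ (hb₄.trans_lt h2) ?_)) (hmul _ _ hb₆ ?_)
    · exact add_mem (mul_mem (neg_mem b₂_mem) b₈_mem)
        (mul_mem (mul_mem (ofNat_mem _ 9) b₄_mem) b₆_mem)
    · exact mul_mem (neg_mem (ofNat_mem _ 8)) (pow_mem b₄_mem 2)
    · exact mul_mem (neg_mem (ofNat_mem _ 27)) b₆_mem
  refine hasSquareValuation_supersingular hE.toIsGaloisTriple (IntermediateField.algebraMap_mem _ x)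
    (IntermediateField.algebraMap_mem _ _) (hE.half_sq h) h2 ?_ hb₂ hb₄ hb₆ hE.cubic_root
  rcases le_or_gt (v (ι x)) 1 with hx | hx
  · exact Or.inl hx
  -- The inverse of a nonintegral `x` is a nonunit of `K`, hence divisible by `2`.
  · right
    have hx0 := zero_lt_one.trans hx
    have h3 : v (ι x⁻¹) ≤ v 2 := hun _ (by
      rw [map_inv₀, map_inv₀]
      exact inv_lt_one_of_one_lt₀ hx)
    rw [map_inv₀, map_inv₀] at h3
    exact (inv_le_iff_one_le_mul₀ hx0).1 h3

omit [IsIntegral (RingOfInt p K) W] [Algebra ℤ_[p] K] [IsScalarTower ℤ_[p] ℚ_[p] K] in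
theorem hasSquareValuation_of_Δ_of_a₃_eq_zero (hE : IsTwoTorsionTriple W E) (h2 : v 2 < 1)
    (hun : ∀ z : K, v (ι z) < 1 → v (ι z) ≤ v 2) (hΔ : v (ι W.Δ) = 1) (ha₁ : v (ι W.a₁) = 1)
    (ha₂ : v (ι W.a₂) ≤ 1) (ha₃ : W.a₃ = 0) (ha₄ : v (ι W.a₄) ≤ 1) (ha₆ : v (ι W.a₆) ≤ 1)
    {x y : K} (h : W.toAffine.Equation x y) : HasSquareValuation p E (ι x) := by
  have hbot (z : K) := IntermediateField.algebraMap_mem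
    (⊥ : IntermediateField K (AlgebraicClosure K)) z
  have hb₂ := hE.b₂
  have hb₄ := hE.b₄
  have hb₆ := hE.b₆
  simp only [WeierstrassCurve.b₂, WeierstrassCurve.b₄, WeierstrassCurve.b₆, ha₃, map_add, map_mul,
    map_pow, map_ofNat, mul_zero, add_zero, zero_pow two_ne_zero, zero_add]
    at hb₂ hb₄ hb₆
  have h20 : (2 : AlgebraicClosure K) ≠ 0 := by norm_num
  have h40 : (4 : AlgebraicClosure K) ≠ 0 := by norm_num
  refine hasSquareValuation_ordinary h2 ((Valuation.ne_zero_iff _).2 h20) ?_ (hbot x) (hbot y)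
    (hbot W.a₁) (hbot W.a₂) (hbot W.a₄) ha₁ ha₂ ha₄ ha₆ ?_ ?_ ?_ ?_ ?_
  · intro z hz
    obtain ⟨z, rfl⟩ := IntermediateField.mem_bot.1 hz
    exact hun z
  · rw [Affine.equation_iff, ha₃] at h
    have h3 := congrArg ι h
    simp only [map_add, map_mul, map_pow, map_zero] at h3
    linear_combination h3
  · linear_combination hb₂
  · exact (mul_left_cancel₀ h20 hb₄).symm
  · refine mul_left_cancel₀ h40 ?_
    linear_combination hb₆
  · rw [← hE.Δ_eq, hΔ]

theorem hasSquareValuation_of_Δ (hE : IsTwoTorsionTriple W E) (h2 : v 2 < 1)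
    (hun : ∀ z : K, v (ι z) < 1 → v (ι z) ≤ v 2) (hΔ : v (ι W.Δ) = 1)
    {x y : K} (h : W.toAffine.Equation x y) : HasSquareValuation p E (ι x) := by
  have hle (z : K) (hz : z ∈ RingOfInt p K) : v (ι z) ≤ 1 := (mem_ringOfInt_iff p K z).1 hz
  rcases (hle W.a₁ a₁_mem).lt_or_eq with ha₁ | ha₁
  · exact hasSquareValuation_of_Δ_of_a₁_lt hE h2 hun hΔ ha₁ h
  have ha₁0 : W.a₁ ≠ 0 := by
    intro h0
    rw [h0, map_zero, map_zero] at ha₁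
    exact zero_ne_one ha₁
  -- For `a₁` a unit, this integral translation makes `a₃` vanish while keeping `a₁` and `Δ`.
  set r := -W.a₃ / W.a₁ with hr
  have hrm : r ∈ RingOfInt p K := by
    rw [mem_ringOfInt_iff, hr, map_div₀, map_div₀, ha₁, div_one]
    exact hle _ (neg_mem a₃_mem)
  set C : VariableChange K := ⟨1, r, 0, 0⟩ with hC
  obtain ⟨x', y', rfl, rfl⟩ := C.exists_old x y
  have ha₁' : (C • W).a₁ = W.a₁ := by
    rw [variableChange_a₁, hC]
    simp
  refine HasSquareValuation.of_variableChange C (hasSquareValuation_of_Δ_of_a₃_eq_zero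
    (hE.variableChange C) h2 hun ?_ ?_ (hle _ ?_) ?_ (hle _ ?_) (hle _ ?_) (C.equation_iff.2 h))
  · rw [variableChange_Δ, hC]
    simpa using hΔ
  · rw [ha₁', ha₁]
  · rw [variableChange_a₂, hC]
    simpa using add_mem a₂_mem (mul_mem (ofNat_mem _ 3) hrm)
  · rw [variableChange_a₃, hC, hr]
    simp [div_mul_cancel₀ _ ha₁0]
  · rw [variableChange_a₄, hC]
    simpa using add_mem (add_mem a₄_mem (mul_mem (mul_mem (ofNat_mem _ 2) hrm) a₂_mem))
      (mul_mem (ofNat_mem _ 3) (pow_mem hrm 2))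
  · rw [variableChange_a₆, hC]
    simpa using add_mem (add_mem (add_mem a₆_mem (mul_mem hrm a₄_mem))
      (mul_mem (pow_mem hrm 2) a₂_mem)) (pow_mem hrm 3)

end Two

end IntegralEquation

/-! ### The image of the Kummer map -/

section KummerImage

open scoped Classical

variable {p : ℕ} [Fact p.Prime] {K : Type*} [Field K] [Algebra ℚ_[p] K] [FiniteDimensional ℚ_[p] K]
  [Algebra ℤ_[p] K] [IsScalarTower ℤ_[p] ℚ_[p] K] {F : K[X]} {e : Fin 3 → AlgebraicClosure K}

local notation "v" => spectralValuation p K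

local notation "ι" => algebraMap K (AlgebraicClosure K)

omit [Algebra ℤ_[p] K] [IsScalarTower ℤ_[p] ℚ_[p] K] in
variable (p K) in
theorem spectralValuation_prime_lt_one : v (p : AlgebraicClosure K) < 1 := by
  rw [← NNReal.coe_lt_coe, spectralValuation_natCast, NNReal.coe_one]
  exact inv_lt_one_of_one_lt₀ (Nat.one_lt_cast.2 (Fact.out : p.Prime).one_lt)

theorem spectralValuation_natCast_le_one (n : ℕ) : v (n : AlgebraicClosure K) ≤ 1 := by
  have h := spectralValuation_ringOfInt_le_one (p := p) (K := K) n
  simpa using h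

theorem spectralValuation_two_eq_one (h : 2 < p) : v 2 = 1 := by
  obtain ⟨k, hk⟩ := (Fact.out : p.Prime).odd_of_ne_two h.ne'
  refine le_antisymm (by simpa using spectralValuation_natCast_le_one (p := p) (K := K) 2)
    (le_of_not_gt fun h2 => ?_)
  -- If `2` were a nonunit, then `1 = p - 2k` would be a difference of nonunits.
  have h1 : (1 : AlgebraicClosure K) = p - 2 * k := by
    rw [hk]
    push_cast
    ring
  have h3 : v (1 : AlgebraicClosure K) < 1 := by
    rw [h1]
    refine Valuation.map_sub_lt _ (spectralValuation_prime_lt_one p K) ?_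
    rw [map_mul]
    exact (mul_le_of_le_one_right zero_le (spectralValuation_natCast_le_one k)).trans_lt h2
  rw [map_one] at h3
  exact lt_irrefl _ h3

theorem spectralValuation_Δ_eq_one {W : WeierstrassCurve K}
    (hW : W.HasGoodReduction (RingOfInt p K)) :
    v (ι W.Δ) = 1 := by
  have h := hW.goodReduction
  rw [← integralModel_Δ_eq (RingOfInt p K) W] at h ⊢
  refine le_antisymm (spectralValuation_ringOfInt_le_one _) (le_of_not_gt fun hlt => h.not_lt ?_)
  rw [IsDedekindDomain.HeightOneSpectrum.valuation_lt_one_iff_mem]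
  exact (mem_maximalIdeal_ringOfInt_iff _).2 hlt

theorem spectralValuation_le_of_unramified
    (h : IsLocalRing.maximalIdeal (RingOfInt p K) = Ideal.span {(p : RingOfInt p K)}) {z : K}
    (hz : v (ι z) < 1) : v (ι z) ≤ v (p : AlgebraicClosure K) := by
  have h1 := (mem_maximalIdeal_ringOfInt_iff (⟨z, (mem_ringOfInt_iff p K z).2 hz.le⟩ :
    RingOfInt p K)).2 hz
  rw [h, Ideal.mem_span_singleton] at h1
  obtain ⟨w, hw⟩ := h1
  have h2 : z = p * w := by simpa using congrArg Subtype.val hw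
  rw [h2, map_mul, map_mul, map_natCast]
  exact mul_le_of_le_one_right zero_le (spectralValuation_ringOfInt_le_one w)

namespace IsRootTriple

variable (he : IsRootTriple F e)
include he

/-- The points whose Kummer class is a class of units. -/
noncomputable def unitPoints [CharZero K] : AddSubgroup ((cubicCurve F)⁄K).toAffine.Point where
  carrier := {P | ∀ c, IsKummerClass F P c → c ∈ unitSquareNormClassesIn p F}
  zero_mem' c hc := by
    rw [he.isKummerClass_unique hc he.isKummerClass_zero]
    exact one_mem _
  add_mem' {P Q} hP hQ c hc := by
    obtain ⟨c₁, h₁⟩ := he.exists_isKummerClass P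
    obtain ⟨c₂, h₂⟩ := he.exists_isKummerClass Q
    rw [he.isKummerClass_unique hc (he.isKummerClass_add h₁ h₂)]
    exact mul_mem (hP _ h₁) (hQ _ h₂)
  neg_mem' {P} hP c hc := by
    obtain ⟨c₁, h₁⟩ := he.exists_isKummerClass P
    have h := he.isKummerClass_add h₁ hc
    rw [add_neg_cancel] at h
    rw [eq_inv_of_mul_eq_one_right (he.isKummerClass_unique h he.isKummerClass_zero)]
    exact inv_mem (hP _ h₁)

omit [Algebra ℚ_[p] K] [FiniteDimensional ℚ_[p] K] [IsScalarTower ℤ_[p] ℚ_[p] K] in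
theorem two_nsmul_mem_unitPoints [CharZero K] (P : ((cubicCurve F)⁄K).toAffine.Point) :
    2 • P ∈ he.unitPoints (p := p) := by
  intro c hc
  obtain ⟨c₁, h₁⟩ := he.exists_isKummerClass P
  have h := he.isKummerClass_add h₁ h₁
  rw [← two_nsmul] at h
  rw [he.isKummerClass_unique hc h]
  have h2 : c₁ * c₁ = 1 := by
    obtain ⟨a, rfl⟩ := QuotientGroup.mk_surjective c₁
    rw [← QuotientGroup.mk_mul, QuotientGroup.eq_one_iff]
    exact ⟨a, pow_two a⟩
  rw [h2]
  exact one_mem _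

-- Doubles have trivial class, so an odd multiple of `P` has the same class as `P`.
omit [Algebra ℚ_[p] K] [FiniteDimensional ℚ_[p] K] [IsScalarTower ℤ_[p] ℚ_[p] K] in
theorem mem_unitPoints_of_odd_nsmul [CharZero K] {P : ((cubicCurve F)⁄K).toAffine.Point} {m : ℕ}
    (hm : Odd m) (h : m • P ∈ he.unitPoints (p := p)) : P ∈ he.unitPoints (p := p) := by
  obtain ⟨k, rfl⟩ := hm
  rw [add_nsmul, one_nsmul, mul_nsmul] at h
  exact ((he.unitPoints (p := p)).add_mem_cancel_left
    (AddSubgroup.nsmul_mem _ (he.two_nsmul_mem_unitPoints P) k)).1 h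

omit [FiniteDimensional ℚ_[p] K] [Algebra ℚ_[p] K] [Algebra ℤ_[p] K]
  [IsScalarTower ℤ_[p] ℚ_[p] K] in
theorem isTwoTorsionTriple_baseChange : IsTwoTorsionTriple ((cubicCurve F)⁄K) e :=
  (show (cubicCurve F)⁄K = cubicCurve F from WeierstrassCurve.map_id _) ▸ he.isTwoTorsionTriple

/-- Pulled back to the minimal equation, the subgroup of points with unit class contains all points
of nonsingular reduction, hence `E_0(K)`. The index carries every point into `E_0(K)` and is odd. -/
theorem mem_unitPoints_of_odd_index [CharZero K] (hp : 2 < p) {W : WeierstrassCurve K}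
    [IsMinimal (RingOfInt p K) W] {C : VariableChange K} (hW : W = C • ((cubicCurve F)⁄K))
    (hodd : Odd (nonsingularPart p W).index) (P : ((cubicCurve F)⁄K).toAffine.Point) :
    P ∈ he.unitPoints (p := p) := by
  subst hW
  have hle : nonsingularPart p (C • ((cubicCurve F)⁄K)) ≤
      (he.unitPoints (p := p)).comap C.pointHom := by
    refine (AddSubgroup.closure_le _).2 ?_
    rintro (_ | ⟨x, y, h⟩) hQ
    · exact zero_mem _
    · intro c hc
      exact he.mk_mem_of_hasSquareValuation (C.nonsingular_iff.1 h)
        (HasSquareValuation.of_variableChange C (hasSquareValuation_of_hasNonsingularReduction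
          (he.isTwoTorsionTriple_baseChange.variableChange C) (spectralValuation_two_eq_one hp) h
          hQ)) hc
  obtain ⟨Q, rfl⟩ := C.pointMap_surjective P
  refine he.mem_unitPoints_of_odd_nsmul hodd ?_
  have h := hle (AddSubgroup.nsmul_index_mem (nonsingularPart p (C • ((cubicCurve F)⁄K))) Q)
  rw [AddSubgroup.mem_comap, map_nsmul] at h
  exact h

theorem hasSquareValuation_of_hasGoodReduction [CharZero K] (hp : p = 2)
    (hun : IsLocalRing.maximalIdeal (RingOfInt p K) = Ideal.span {(p : RingOfInt p K)})
    {W : WeierstrassCurve K} {C : VariableChange K} (hW : W = C • ((cubicCurve F)⁄K))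
    (hgood : W.HasGoodReduction (RingOfInt p K)) {x y : K}
    (h : ((cubicCurve F)⁄K).toAffine.Equation x y) : HasSquareValuation p e (ι x) := by
  subst hW
  have h2 : (p : AlgebraicClosure K) = 2 := by rw [hp, Nat.cast_ofNat]
  obtain ⟨x', y', rfl, rfl⟩ := C.exists_old x y
  refine HasSquareValuation.of_variableChange C (hasSquareValuation_of_Δ
    (he.isTwoTorsionTriple_baseChange.variableChange C) ?_ (fun z hz => ?_)
    (spectralValuation_Δ_eq_one hgood) (C.equation_iff.2 h))
  · rw [← h2]
    exact spectralValuation_prime_lt_one p K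
  · rw [← h2]
    exact spectralValuation_le_of_unramified hun hz

end IsRootTriple

end KummerImage

theorem mainTheorem5 (p : ℕ) [Fact p.Prime] (K : Type*) [Field K] [Algebra ℚ_[p] K]
    [Algebra ℤ_[p] K] [IsScalarTower ℤ_[p] ℚ_[p] K] [FiniteDimensional ℚ_[p] K]
    (F : Polynomial K) (hF : SatisfiesDagger p F) :
    (∀ P : ((cubicCurve F)⁄K).toAffine.Point, ∃! c : SqClass (AdjoinRoot F)ˣ, IsKummerClass F P c) ∧
    kummerImage F ⊆ (unitSquareNormClassesIn p F : Set (SqClass (AdjoinRoot F)ˣ)) := by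
  have : CharZero K := charZero_of_injective_algebraMap (algebraMap ℚ_[p] K).injective
  obtain ⟨e, he⟩ := exists_isRootTriple hF.monic hF.natDegree_eq hF.squarefree
  refine ⟨he.existsUnique_isKummerClass, ?_⟩
  rintro c ⟨P, hc⟩
  have hmin : (cubicCurve F).minimal (RingOfInt p K) =
      ((cubicCurve F).exists_isMinimal (RingOfInt p K)).choose • ((cubicCurve F)⁄K) := by
    rw [show (cubicCurve F)⁄K = cubicCurve F from WeierstrassCurve.map_id _]
    rfl
  have hpoint (h : ∀ x y : K, ((cubicCurve F)⁄K).toAffine.Equation x y →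
      HasSquareValuation p e (algebraMap K _ x)) : c ∈ unitSquareNormClassesIn p F := by
    rcases P with _ | ⟨x, y, hxy⟩
    · rw [he.isKummerClass_unique hc he.isKummerClass_zero]
      exact one_mem _
    · exact he.mk_mem_of_hasSquareValuation hxy (h x y hxy.1) hc
  rcases hF.cases with h | h | ⟨hp, h⟩ | ⟨hp, hun, h⟩
  · exact hpoint fun x y hxy => he.hasSquareValuation_of_isField h (he.equation_iff.1 hxy)
  · exact hpoint fun x y hxy =>
      he.hasSquareValuation_of_adjoin_eq hF.coeff_mem h (he.equation_iff.1 hxy)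
  · exact he.mem_unitPoints_of_odd_index hp hmin h P c hc
  · exact hpoint fun x y hxy => he.hasSquareValuation_of_hasGoodReduction hp hun hmin h hxy
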